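/- Let $\mathbb D$ be the open unit disk and $\mathbb T$ the unit circle with normalised Lebesgue measure $m$; write $L^p=L^p(\mathbb T,m)$, and let $H^2\subset L^2$ be the Hardy space, i.e. the subspace of functions whose Fourier coefficients of negative index vanish. A function $\Theta$ is inner if it is bounded and analytic in $\mathbb D$ and its radial limits have modulus one almost everywhere on $\mathbb T$. Functions on $\mathbb D$ are identified with their radial boundary values. For an inner function $\Theta$ let $K_\Theta=H^2\ominus\Theta H^2$ and let $P_\Theta$ be the orthogonal projection of $L^2$ onto $K_\Theta$. For $\varphi\in L^2$ the truncated Toeplitz operator $A_\varphi^\Theta$ with symbol $\varphi$ is the densely defined operator $A^\Theta_\varphi f=P_\Theta(\varphi f)$, $f\in K_\Theta\cap L^\infty$ $(=K_\Theta\cap H^\infty)$. A bounded operator $A$ on $K_\Theta$ is a truncated Toeplitz operator, with symbol $\varphi\in L^2$, if $Af=A^\Theta_\varphi f$ for all $f\in K_\Theta\cap L^\infty$; symbols are not unique. The function $\Theta$ has an angular derivative (in the sense of Carathéodory) at $\zeta\in\mathbb T$ if $\Theta$ and $\Theta'$ have nontangential limits at $\zeta$ and the limit $\Theta(\zeta)$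 of $\Theta$ satisfies $|\Theta(\zeta)|=1$. **Theorem.** (a) Let $\Theta$ be an inner function which has an angular derivative at $\zeta\in\mathbb T$, and let $$k_\zeta^\Theta(z)=\frac{1-\overline{\Theta(\zeta)}\,\Theta(z)}{1-\bar\zeta z}.$$ Then $k_\zeta^\Theta\in K_\Theta$, the operator $k_\zeta^\Theta\otimes k_\zeta^\Theta:\ f\mapsto\langle f,k_\zeta^\Theta\rangle k_\zeta^\Theta$ is a bounded truncated Toeplitz operator on $K_\Theta$, and for every $p\in(2,\infty)$ the following are equivalent: 1. $k_\zeta^\Theta\otimes k_\zeta^\Theta$ has a symbol $\psi\in L^p$; 2. $k_\zeta^\Theta\in L^p$. In particular, if $k_\zeta^\Theta\notin L^p$ for some $p\in(2,\infty)$, then $k_\zeta^\Theta\otimes k_\zeta^\Theta$ is a bounded truncated Toeplitz operator which has no bounded symbol. (b) Sarason's question, whether every bounded truncated Toeplitz operator has a bounded symbol (and in particular whether the operators $k_\zeta^\Theta\otimes k_\zeta^\Theta$ do), has a negative answer: there are an inner function $\Theta$ and a point $\zeta\in\mathbb T$ at which $\Theta$ has an angular derivative such that the bounded truncated Toeplitz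 operator $k_\zeta^\Theta\otimes k_\zeta^\Theta$ has no bounded symbol. -/

import Mathlib

open MeasureTheory Filter Topology Metric
open scoped ENNReal ComplexConjugate

namespace TruncatedToeplitz

noncomputable section

/-- The unit circle `𝕋`, parametrised by `t ↦ e^{2πit}`, `t ∈ ℝ/ℤ`, with the normalised Lebesgue
measure `m`. The point `e^{2πit}` is `AddCircle.toCircle t`. -/
abbrev circleMeasure : Measure UnitAddCircle := AddCircle.haarAddCircle

/-- `L² = L²(𝕋, m)`. -/
abbrev L2 : Type := Lp ℂ 2 circleMeasure

/-- The radial limit `lim_{r → 1⁻} f(rζ)`. -/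
def radialLimit (f : ℂ → ℂ) (ζ : ℂ) : ℂ :=
  limUnder (𝓝[<] (1 : ℝ)) fun r : ℝ => f (r * ζ)

/-- The boundary function on `𝕋` of a function `f` on the unit disk (its radial limits). -/
def boundaryFun (f : ℂ → ℂ) (t : UnitAddCircle) : ℂ :=
  radialLimit f (AddCircle.toCircle t)

/-- `Θ` is inner: bounded and analytic in the open unit disk, and for almost every point of the
circle the radial limit exists and is unimodular. (Values of `Θ` off the open disk are
irrelevant.) -/
structure IsInner (Θ : ℂ → ℂ) : Prop where
  analytic : DifferentiableOn ℂ Θ (ball 0 1)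
  bounded : ∃ C : ℝ, ∀ z ∈ ball (0 : ℂ) 1, ‖Θ z‖ ≤ C
  unimodular : ∀ᵐ t ∂circleMeasure, ∃ w : ℂ, ‖w‖ = 1 ∧
    Tendsto (fun r : ℝ => Θ (r * (AddCircle.toCircle t : ℂ))) (𝓝[<] 1) (𝓝 w)

/-- `f` has the nontangential limit `w` at `ζ`: for every `M`, `f(z) → w` as `z → ζ` inside the
Stolz region `{z : |z| < 1, |z - ζ| < M (1 - |z|)}`. -/
def HasNontangentialLimit (f : ℂ → ℂ) (ζ w : ℂ) : Prop :=
  ∀ M : ℝ, Tendsto f (𝓝[{z : ℂ | ‖z‖ < 1 ∧ ‖z - ζ‖ < M * (1 - ‖z‖)}] ζ) (𝓝 w)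

/-- `Θ` has an angular derivative in the sense of Carathéodory at `ζ`: `Θ` and `Θ'` have
nontangential limits at `ζ`, and that of `Θ` is unimodular. -/
def HasAngularDerivative (Θ : ℂ → ℂ) (ζ : Circle) : Prop :=
  ∃ a b : ℂ, ‖a‖ = 1 ∧ HasNontangentialLimit Θ ζ a ∧ HasNontangentialLimit (deriv Θ) ζ b

/-- `k_ζ^Θ(z) = (1 - conj(Θ(ζ)) Θ(z)) / (1 - conj(ζ) z)` in the disk, for `ζ` on the circle;
`Θ(ζ)` is the boundary value of `Θ` at `ζ`. -/
def boundaryKernel (Θ : ℂ → ℂ) (ζ : Circle) (z : ℂ) : ℂ :=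
  (1 - conj (radialLimit Θ ζ) * Θ z) / (1 - conj (ζ : ℂ) * z)

/-- The Hardy space `H²`, as the subspace of `L²` of functions whose Fourier coefficients of
negative index vanish. -/
def hardy : Submodule ℂ L2 where
  carrier := {f | ∀ n : ℤ, n < 0 → fourierCoeff (f : UnitAddCircle → ℂ) n = 0}
  zero_mem' n _ := by
    rw [← fourierBasis_repr]; simp
  add_mem' {f g} hf hg n hn := by
    have h1 := hf n hn
    have h2 := hg n hn
    rw [← fourierBasis_repr] at h1 h2 ⊢
    simp [h1, h2]
  smul_mem' c f hf n hn := by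
    have h1 := hf n hn
    rw [← fourierBasis_repr] at h1 ⊢
    simp [h1]

/-- `Θ H²`, as a subspace of `L²`. -/
def innerMulHardy (Θ : ℂ → ℂ) : Submodule ℂ L2 where
  carrier := {h | ∃ g ∈ hardy,
    (h : UnitAddCircle → ℂ) =ᵐ[circleMeasure] fun t => boundaryFun Θ t * g t}
  zero_mem' := by
    refine ⟨0, hardy.zero_mem, ?_⟩
    filter_upwards with t
    simp
  add_mem' := by
    rintro f g ⟨f', hf', hf⟩ ⟨g', hg', hg⟩
    refine ⟨f' + g', hardy.add_mem hf' hg', ?_⟩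
    filter_upwards [hf, hg, Lp.coeFn_add f g, Lp.coeFn_add f' g'] with t h1 h2 h3 h4
    simp only [h3, h4, Pi.add_apply, h1, h2]
    ring
  smul_mem' := by
    rintro c f ⟨f', hf', hf⟩
    refine ⟨c • f', hardy.smul_mem c hf', ?_⟩
    filter_upwards [hf, Lp.coeFn_smul c f, Lp.coeFn_smul c f'] with t h1 h2 h3
    simp only [h2, h3, Pi.smul_apply, h1, smul_eq_mul]
    ring

/-- The model space `K_Θ = H² ⊖ Θ H²`. -/
def modelSpace (Θ : ℂ → ℂ) : Submodule ℂ L2 :=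
  hardy ⊓ (innerMulHardy Θ)ᗮ

theorem isClosed_hardy : IsClosed (hardy : Set L2) := by
  have h : (hardy : Set L2) =
      ⋂ n : ℤ, ⋂ _ : n < 0, {f : L2 | inner ℂ (fourierLp 2 n) f = 0} := by
    ext f
    simp only [Set.mem_iInter, Set.mem_ofPred_eq]
    refine forall₂_congr fun n _ => ?_
    rw [← fourierBasis_repr, HilbertBasis.repr_apply_apply, coe_fourierBasis]
  rw [h]
  exact isClosed_iInter fun n => isClosed_iInter fun _ =>
    isClosed_eq (continuous_const.inner continuous_id) continuous_const

instance completeSpace_modelSpace (Θ : ℂ → ℂ) : CompleteSpace (modelSpace Θ) :=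
  (isClosed_hardy.inter (innerMulHardy Θ).isClosed_orthogonal).completeSpace_coe

/-- The bounded functions in `K_Θ`. -/
def boundedPart (Θ : ℂ → ℂ) : Submodule ℂ (modelSpace Θ) where
  carrier := {f | MemLp ((f : L2) : UnitAddCircle → ℂ) ∞ circleMeasure}
  zero_mem' := (MemLp.zero (ε := ℂ)).ae_eq (Lp.coeFn_zero ℂ 2 circleMeasure).symm
  add_mem' {f g} hf hg := (MemLp.add hf hg).ae_eq (Lp.coeFn_add (f : L2) (g : L2)).symm
  smul_mem' c f hf := (MemLp.const_smul hf c).ae_eq (Lp.coeFn_smul c (f : L2)).symm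

/-- The product `φ f ∈ L²` of `φ ∈ L²` and a bounded function `f` in `K_Θ`. -/
def mulBounded (Θ : ℂ → ℂ) (φ : L2) (f : boundedPart Θ) : L2 :=
  (MemLp.mul (p := 2) (q := ∞) (r := 2) f.2 (Lp.memLp φ)).toLp
    ((φ : UnitAddCircle → ℂ) * (((f : modelSpace Θ) : L2) : UnitAddCircle → ℂ))

/-- The truncated Toeplitz operator `A_φ^Θ` with symbol `φ ∈ L²`: the densely defined operator
on `K_Θ` with domain the bounded functions in `K_Θ`, given by `A_φ^Θ f = P_Θ (φ f)`. -/
def truncatedToeplitz (Θ : ℂ → ℂ) (φ : L2) : modelSpace Θ →ₗ.[ℂ] modelSpace Θ where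
  domain := boundedPart Θ
  toFun :=
    { toFun := fun f => (modelSpace Θ).orthogonalProjectionOnto (mulBounded Θ φ f)
      map_add' := fun f g => by
        rw [← map_add]
        congr 1
        rw [mulBounded, mulBounded, mulBounded, ← MemLp.toLp_add]
        apply MemLp.toLp_congr
        filter_upwards [Lp.coeFn_add ((f : modelSpace Θ) : L2) ((g : modelSpace Θ) : L2)]
          with t ht
        have : ((((f + g : boundedPart Θ) : modelSpace Θ) : L2) : UnitAddCircle → ℂ) t
            = (((f : modelSpace Θ) : L2) : UnitAddCircle → ℂ) t
              + (((g : modelSpace Θ) : L2) : UnitAddCircle → ℂ) t := ht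
        simp only [Pi.mul_apply, Pi.add_apply, this]
        ring
      map_smul' := fun c f => by
        rw [RingHom.id_apply, ← map_smul]
        congr 1
        rw [mulBounded, mulBounded, ← MemLp.toLp_const_smul]
        apply MemLp.toLp_congr
        filter_upwards [Lp.coeFn_smul c ((f : modelSpace Θ) : L2)] with t ht
        have : ((((c • f : boundedPart Θ) : modelSpace Θ) : L2) : UnitAddCircle → ℂ) t
            = c * (((f : modelSpace Θ) : L2) : UnitAddCircle → ℂ) t := ht
        simp only [Pi.mul_apply, Pi.smul_apply, this, smul_eq_mul]
        ring }

/-- `φ ∈ L²` is a symbol of the bounded operator `A` on `K_Θ`: `A` agrees with `A_φ^Θ` on the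
domain of `A_φ^Θ`. -/
def IsSymbol (Θ : ℂ → ℂ) (φ : L2) (A : modelSpace Θ →L[ℂ] modelSpace Θ) : Prop :=
  ∀ f : (truncatedToeplitz Θ φ).domain, truncatedToeplitz Θ φ f = A f

/-- The bounded operator `A` on `K_Θ` is a truncated Toeplitz operator. -/
def IsTruncatedToeplitz (Θ : ℂ → ℂ) (A : modelSpace Θ →L[ℂ] modelSpace Θ) : Prop :=
  ∃ φ : L2, IsSymbol Θ φ A

/-- `A` has a symbol in `L^p` (used for `p ≥ 2`, where `L^p ⊆ L²`). -/
def HasSymbolIn (Θ : ℂ → ℂ) (p : ℝ≥0∞) (A : modelSpace Θ →L[ℂ] modelSpace Θ) : Prop :=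
  ∃ ψ : L2, MemLp (ψ : UnitAddCircle → ℂ) p circleMeasure ∧ IsSymbol Θ ψ A

/-- The element `k` of `K_Θ` is (the boundary function of) the kernel `k_ζ^Θ`. -/
def IsBoundaryKernel (Θ : ℂ → ℂ) (ζ : Circle) (k : modelSpace Θ) : Prop :=
  ((k : L2) : UnitAddCircle → ℂ) =ᵐ[circleMeasure] boundaryFun (boundaryKernel Θ ζ)

end

end TruncatedToeplitz

open TruncatedToeplitz

/-! Write `c_u` for the Cauchy kernel and `k_u = (1 - conj(Θ(u)) Θ) c_u` for the reproducing kernel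
of `K_Θ` at a point `u` of the disk. On the circle the Poisson kernel is `c_u + conj(c_u) - 1`.
Replacing `c_u` by `k_u` changes this by a multiple of `Θ c_u` and the conjugate of that, and both
integrate to zero against every product `k_v conj(k_w)`. So on such products `k_u + conj(k_u) - 1`
acts as the Poisson kernel at `u`.

Let `u → ζ` radially. The angular derivative makes the radial difference quotients of `Θ` bounded,
so the `k_u` converge to `k_ζ` under a square integrable majorant, and the Poisson integrals of `k_v
conj(k_w)` converge to `conj(k_ζ(v)) k_ζ(w)`. As the `k_w` are total in `K_Θ`, the function `k_ζ +
conj(k_ζ) - 1` is a symbol of `k_ζ ⊗ k_ζ`, and it lies in `L^p` when `k_ζ` does (`isSymbol_symbol`).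

Conversely, for a symbol `ψ ∈ L^p`, applying the operator to the bounded function `k_0` gives
`conj(k_ζ(0)) k_ζ = P_Θ(ψ k_0)`. Since `P_Θ h = P₊ h - Θ P₊(conj(Θ) h)`, it remains to know that
`P₊` preserves `L^p` (`memLp_starProjection_hardy`). This is M. Riesz's theorem: for exponents `4m`
it follows by integrating a pointwise inequality whose error term is the real part of an analytic
function vanishing at `0`, and Marcinkiewicz interpolation with `L²` gives the exponents between.

For (b), take the singular inner function with masses `s³` at points at distance about `s` from `1`,
for `s = 2⁻ⁿ`. Convergence of `∑ s³ / s²` gives an angular derivative at `1`. At distance `s³` from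
an atom `|Θ| ≤ 1/2`, so `|k_1|` is at least of order `s⁻¹` there, whereas a kernel in `L⁴` grows at
most like `(1 - |w|)^{-1/4} = s^{-3/4}`. -/

namespace TruncatedToeplitz

noncomputable section

/-! ### The circle, Cauchy kernels, and boundary values of bounded analytic functions -/

/-- The point `e^{2πit}` of the unit circle, as a complex number. -/
abbrev circlePoint (t : UnitAddCircle) : ℂ := (AddCircle.toCircle t : ℂ)

theorem norm_circlePoint (t : UnitAddCircle) : ‖circlePoint t‖ = 1 := Circle.norm_coe _

theorem circlePoint_mul_conj (t : UnitAddCircle) : circlePoint t * conj (circlePoint t) = 1 := by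
  rw [Complex.mul_conj, Complex.normSq_eq_norm_sq, norm_circlePoint]; simp

theorem continuous_circlePoint : Continuous circlePoint :=
  continuous_induced_dom.comp AddCircle.continuous_toCircle

theorem fourier_natCast (n : ℕ) (t : UnitAddCircle) : fourier (n : ℤ) t = circlePoint t ^ n := by
  rw [fourier_apply, natCast_zsmul, AddCircle.toCircle_nsmul, Circle.coe_pow]

theorem fourier_neg_natCast (n : ℕ) (t : UnitAddCircle) :
    fourier (-(n : ℤ)) t = conj (circlePoint t ^ n) := by
  rw [fourier_neg, fourier_natCast]

/-- Both sides are interval integrals, over one period of `t` and of `2πt`. This gives access to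
Cauchy's formula for circle averages. -/
theorem integral_circle_eq_circleAverage (G : ℂ → ℂ) (r : ℝ) :
    ∫ t, G (r * circlePoint t) ∂circleMeasure = Real.circleAverage G 0 r := by
  have h := fourierCoeff_eq_intervalIntegral
    (fun t : UnitAddCircle => G (r * circlePoint t)) 0 0
  simp only [fourierCoeff, neg_zero, fourier_zero, one_smul, zero_add, div_one] at h
  rw [h, Real.circleAverage_def]
  have h2 := intervalIntegral.integral_comp_mul_left (a := 0) (b := 1)
    (fun θ : ℝ => G (circleMap 0 r θ)) (c := 2 * Real.pi) (by positivity)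
  rw [mul_zero, mul_one] at h2
  rw [← h2]
  refine intervalIntegral.integral_congr fun x _ => ?_
  simp only [circlePoint, AddCircle.toCircle_apply_mk, Circle.coe_exp, circleMap, div_one, zero_add]

/-- The Cauchy kernel `1 / (1 - conj(w) z)`. -/
def cauchyKernel (w z : ℂ) : ℂ := 1 / (1 - conj w * z)

theorem one_sub_conj_mul_ne_zero {w z : ℂ} (hw : ‖w‖ < 1) (hz : ‖z‖ ≤ 1) :
    1 - conj w * z ≠ 0 := by
  intro h
  have h1 : ‖conj w * z‖ = 1 := by rw [← sub_eq_zero.mp h]; simp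
  rw [norm_mul, RCLike.norm_conj] at h1
  nlinarith [norm_nonneg w, norm_nonneg z]

theorem one_sub_norm_le {w z : ℂ} (hz : ‖z‖ ≤ 1) : 1 - ‖w‖ ≤ ‖1 - conj w * z‖ := by
  have h := norm_sub_norm_le (1 : ℂ) (conj w * z)
  rw [norm_mul, RCLike.norm_conj, norm_one] at h
  nlinarith [norm_nonneg w, norm_nonneg z]

theorem norm_cauchyKernel_le {w z : ℂ} (hw : ‖w‖ < 1) (hz : ‖z‖ ≤ 1) :
    ‖cauchyKernel w z‖ ≤ 1 / (1 - ‖w‖) := by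
  rw [cauchyKernel, norm_div, norm_one]
  exact one_div_le_one_div_of_le (by linarith) (one_sub_norm_le hz)

theorem differentiableAt_cauchyKernel {w z : ℂ} (hw : ‖w‖ < 1) (hz : ‖z‖ ≤ 1) :
    DifferentiableAt ℂ (cauchyKernel w) z :=
  (differentiableAt_const _).div (by fun_prop) (one_sub_conj_mul_ne_zero hw hz)

theorem continuous_cauchyKernel_circlePoint {w : ℂ} (hw : ‖w‖ < 1) :
    Continuous fun t => cauchyKernel w (circlePoint t) := by
  refine continuous_const.div (continuous_const.sub
    (continuous_const.mul continuous_circlePoint)) fun t => ?_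
  exact one_sub_conj_mul_ne_zero hw (norm_circlePoint t).le

/-- On the circle `conj(z) = 1/z`, which turns the conjugate kernel into the factor of Cauchy's
formula. -/
theorem conj_cauchyKernel_circlePoint {w : ℂ} (hw : ‖w‖ < 1) (t : UnitAddCircle) :
    conj (cauchyKernel w (circlePoint t)) = circlePoint t / (circlePoint t - w) := by
  have h1 := circlePoint_mul_conj t
  have h2 : circlePoint t - w ≠ 0 := by
    intro h
    rw [← sub_eq_zero.mp h, norm_circlePoint] at hw
    exact lt_irrefl _ hw
  have h3 : 1 - w * conj (circlePoint t) ≠ 0 := by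
    have := one_sub_conj_mul_ne_zero hw (norm_circlePoint t).le
    intro h
    apply this
    have := congrArg conj h
    simpa using this
  simp only [cauchyKernel, map_div₀, map_one, map_sub, map_mul, Complex.conj_conj]
  rw [div_eq_div_iff h3 h2]
  linear_combination w * h1

/-- `F` is bounded and analytic in the unit disk, with radial boundary values `f` a.e. -/
structure HasBoundaryValues (F : ℂ → ℂ) (f : UnitAddCircle → ℂ) : Prop where
  analytic : DifferentiableOn ℂ F (ball 0 1)
  bounded : ∃ C : ℝ, ∀ z ∈ ball (0 : ℂ) 1, ‖F z‖ ≤ C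
  tendsto : ∀ᵐ t ∂circleMeasure,
    Tendsto (fun r : ℝ => F (r * circlePoint t)) (𝓝[<] 1) (𝓝 (f t))

theorem ofReal_mul_mem_ball {r : ℝ} (h0 : 0 ≤ r) (h1 : r < 1) {z : ℂ} (hz : ‖z‖ ≤ 1) :
    (r : ℂ) * z ∈ ball (0 : ℂ) 1 := by
  rw [mem_ball_zero_iff, norm_mul, Complex.norm_real, Real.norm_of_nonneg h0]
  nlinarith [norm_nonneg z]

theorem eventually_radius : ∀ᶠ r : ℝ in 𝓝[<] 1, 0 ≤ r ∧ r < 1 := by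
  filter_upwards [Ioo_mem_nhdsLT (show (0 : ℝ) < 1 by norm_num)] with r hr
  exact ⟨hr.1.le, hr.2⟩

/-- A sequence of radii in `[0, 1)` increasing to `1`. -/
def radius (n : ℕ) : ℝ := 1 - 1 / ((n : ℝ) + 1)

theorem radius_nonneg (n : ℕ) : 0 ≤ radius n := by
  have : 1 / ((n : ℝ) + 1) ≤ 1 := by
    rw [div_le_one (by positivity)]; linarith [Nat.cast_nonneg (α := ℝ) n]
  simp only [radius]; linarith

theorem radius_lt_one (n : ℕ) : radius n < 1 := by
  have : 0 < 1 / ((n : ℝ) + 1) := by positivity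
  simp only [radius]; linarith

theorem tendsto_radius : Tendsto radius atTop (𝓝[<] 1) := by
  refine tendsto_nhdsWithin_iff.mpr ⟨?_, Eventually.of_forall radius_lt_one⟩
  have h := (tendsto_const_nhds (x := (1 : ℝ))).sub
    (tendsto_one_div_add_atTop_nhds_zero_nat (𝕜 := ℝ))
  rwa [sub_zero] at h

theorem tendsto_radius_mul (z : ℂ) :
    Tendsto (fun r : ℝ => (r : ℂ) * z) (𝓝[<] 1) (𝓝 z) := by
  have h : Tendsto (fun r : ℝ => (r : ℂ) * z) (𝓝 1) (𝓝 (((1 : ℝ) : ℂ) * z)) :=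
    (Complex.continuous_ofReal.mul continuous_const).tendsto 1
  rw [Complex.ofReal_one, one_mul] at h
  exact h.mono_left nhdsWithin_le_nhds

theorem continuous_radial {F : ℂ → ℂ} (hF : DifferentiableOn ℂ F (ball 0 1)) {r : ℝ}
    (h0 : 0 ≤ r) (h1 : r < 1) : Continuous fun t => F (r * circlePoint t) :=
  hF.continuousOn.comp_continuous (continuous_const.mul continuous_circlePoint)
    fun t => ofReal_mul_mem_ball h0 h1 (norm_circlePoint t).le

namespace HasBoundaryValues

variable {F G : ℂ → ℂ} {f g : UnitAddCircle → ℂ}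

theorem aestronglyMeasurable (hF : HasBoundaryValues F f) :
    AEStronglyMeasurable f circleMeasure := by
  refine aestronglyMeasurable_of_tendsto_ae atTop
    (f := fun (n : ℕ) t => F (radius n * circlePoint t)) (fun n => ?_) ?_
  · exact (continuous_radial hF.analytic (radius_nonneg n) (radius_lt_one n)).aestronglyMeasurable
  · filter_upwards [hF.tendsto] with t ht using ht.comp tendsto_radius

theorem memLp_top (hF : HasBoundaryValues F f) : MemLp f ∞ circleMeasure := by
  obtain ⟨C, hC⟩ := hF.bounded
  refine memLp_top_of_bound hF.aestronglyMeasurable C ?_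
  filter_upwards [hF.tendsto] with t ht
  refine le_of_tendsto ht.norm ?_
  filter_upwards [eventually_radius] with r hr
  exact hC _ (ofReal_mul_mem_ball hr.1 hr.2 (norm_circlePoint t).le)

theorem memLp (hF : HasBoundaryValues F f) (p : ℝ≥0∞) : MemLp f p circleMeasure :=
  hF.memLp_top.mono_exponent le_top

theorem const (c : ℂ) : HasBoundaryValues (fun _ => c) (fun _ => c) where
  analytic := differentiableOn_const c
  bounded := ⟨‖c‖, fun _ _ => le_rfl⟩
  tendsto := Eventually.of_forall fun _ => tendsto_const_nhds

theorem of_continuous (hF : DifferentiableOn ℂ F (ball 0 1))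
    (hc : ContinuousOn F (closedBall 0 1)) :
    HasBoundaryValues F (fun t => F (circlePoint t)) where
  analytic := hF
  bounded := by
    obtain ⟨C, hC⟩ := (isCompact_closedBall (0 : ℂ) 1).exists_bound_of_continuousOn hc
    exact ⟨C, fun z hz => hC z (ball_subset_closedBall hz)⟩
  tendsto := Eventually.of_forall fun t => by
    have h := hc (circlePoint t) (by simp [norm_circlePoint])
    refine Tendsto.comp h (tendsto_nhdsWithin_iff.mpr ⟨tendsto_radius_mul _, ?_⟩)
    filter_upwards [eventually_radius] with r hr
    exact ball_subset_closedBall (ofReal_mul_mem_ball hr.1 hr.2 (norm_circlePoint t).le)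

theorem pow_id (n : ℕ) : HasBoundaryValues (fun z => z ^ n) (fun t => circlePoint t ^ n) :=
  of_continuous (by fun_prop) (by fun_prop)

theorem cauchy {w : ℂ} (hw : ‖w‖ < 1) :
    HasBoundaryValues (cauchyKernel w) (fun t => cauchyKernel w (circlePoint t)) :=
  of_continuous
    (fun _ hz => (differentiableAt_cauchyKernel hw
      (mem_ball_zero_iff.mp hz).le).differentiableWithinAt)
    (fun _ hz => (differentiableAt_cauchyKernel hw
      (mem_closedBall_zero_iff.mp hz)).continuousAt.continuousWithinAt)

theorem mul (hF : HasBoundaryValues F f) (hG : HasBoundaryValues G g) :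
    HasBoundaryValues (fun z => F z * G z) (fun t => f t * g t) where
  analytic := hF.analytic.mul hG.analytic
  bounded := by
    obtain ⟨C, hC⟩ := hF.bounded
    obtain ⟨D, hD⟩ := hG.bounded
    refine ⟨C * D, fun z hz => ?_⟩
    rw [norm_mul]
    exact mul_le_mul (hC z hz) (hD z hz) (norm_nonneg _) ((norm_nonneg _).trans (hC z hz))
  tendsto := by filter_upwards [hF.tendsto, hG.tendsto] with t h1 h2 using h1.mul h2

theorem sub (hF : HasBoundaryValues F f) (hG : HasBoundaryValues G g) :
    HasBoundaryValues (fun z => F z - G z) (fun t => f t - g t) where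
  analytic := hF.analytic.sub hG.analytic
  bounded := by
    obtain ⟨C, hC⟩ := hF.bounded
    obtain ⟨D, hD⟩ := hG.bounded
    exact ⟨C + D, fun z hz => (norm_sub_le _ _).trans (add_le_add (hC z hz) (hD z hz))⟩
  tendsto := by filter_upwards [hF.tendsto, hG.tendsto] with t h1 h2 using h1.sub h2

/-- Cauchy's formula for bounded analytic functions, in terms of the boundary values. -/
theorem integral_mul_conj_cauchyKernel (hF : HasBoundaryValues F f) {w : ℂ} (hw : ‖w‖ < 1) :
    ∫ t, f t * conj (cauchyKernel w (circlePoint t)) ∂circleMeasure = F w := by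
  obtain ⟨C, hC⟩ := hF.bounded
  have hcont := (continuous_cauchyKernel_circlePoint hw)
  -- The dilate `z ↦ F(r_n z)` is analytic beyond the closed disk, so Cauchy's formula applies to
  -- it. Dominated convergence then lets `r_n → 1`.
  have h1 : ∀ n, ∫ t, F (radius n * circlePoint t)
      * conj (cauchyKernel w (circlePoint t)) ∂circleMeasure
      = F (radius n * w) := by
    intro n
    have hd : DiffContOnCl ℂ (fun z => F (radius n * z)) (ball 0 |1|) := by
      rw [abs_one]
      refine DifferentiableOn.diffContOnCl ?_
      rw [closure_ball _ one_ne_zero]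
      refine hF.analytic.comp (by fun_prop) fun z hz => ?_
      exact ofReal_mul_mem_ball (radius_nonneg n) (radius_lt_one n) (by simpa using hz)
    have h := hd.circleAverage_smul_div (w := w) (by simpa using hw)
    rw [← h, ← integral_circle_eq_circleAverage]
    refine integral_congr_ae (Eventually.of_forall fun t => ?_)
    simp only [Complex.ofReal_one, one_mul, sub_zero, smul_eq_mul]
    rw [conj_cauchyKernel_circlePoint hw, mul_comm]
  have h2 : Tendsto (fun n => F (radius n * w)) atTop (𝓝 (F w)) := by
    have hc : ContinuousAt F w := (hF.analytic.differentiableAt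
      (isOpen_ball.mem_nhds (mem_ball_zero_iff.mpr hw))).continuousAt
    exact hc.tendsto.comp ((tendsto_radius_mul w).comp tendsto_radius)
  have h3 : Tendsto (fun n => ∫ t, F (radius n * circlePoint t)
      * conj (cauchyKernel w (circlePoint t)) ∂circleMeasure) atTop
      (𝓝 (∫ t, f t * conj (cauchyKernel w (circlePoint t)) ∂circleMeasure)) := by
    refine tendsto_integral_of_dominated_convergence (fun _ => C * (1 / (1 - ‖w‖)))
      (fun n => ?_) (integrable_const _) (fun n => Eventually.of_forall fun t => ?_) ?_
    · exact ((continuous_radial hF.analytic (radius_nonneg n) (radius_lt_one n)).mul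
        (Complex.continuous_conj.comp hcont)).aestronglyMeasurable
    · rw [norm_mul, RCLike.norm_conj]
      have h := hC _ (ofReal_mul_mem_ball (radius_nonneg n) (radius_lt_one n)
        (norm_circlePoint t).le)
      exact mul_le_mul h (norm_cauchyKernel_le hw (norm_circlePoint t).le) (norm_nonneg _)
        ((norm_nonneg _).trans h)
    · filter_upwards [hF.tendsto] with t ht using (ht.comp tendsto_radius).mul_const _
  simp only [h1] at h3
  exact tendsto_nhds_unique h3 h2

theorem integral_eq (hF : HasBoundaryValues F f) : ∫ t, f t ∂circleMeasure = F 0 := by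
  have h := hF.integral_mul_conj_cauchyKernel (w := 0) (by simp)
  simpa [cauchyKernel] using h

end HasBoundaryValues

/-! ### The Poisson kernel -/

/-- The Poisson kernel of the disk at `w`, on the circle. -/
def diskPoissonKernel (w : ℂ) (t : UnitAddCircle) : ℝ :=
  (1 - ‖w‖ ^ 2) * ‖cauchyKernel w (circlePoint t)‖ ^ 2

/-- The decomposition into an analytic part, an antianalytic part and a constant is the model for
the symbol `k_ζ + conj(k_ζ) - 1`. -/
theorem diskPoissonKernel_eq {w : ℂ} (hw : ‖w‖ < 1) (t : UnitAddCircle) :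
    (diskPoissonKernel w t : ℂ) = cauchyKernel w (circlePoint t)
      + conj (cauchyKernel w (circlePoint t)) - 1 := by
  have h1 := circlePoint_mul_conj t
  have h2 := one_sub_conj_mul_ne_zero hw (norm_circlePoint t).le
  have h3 : 1 - w * conj (circlePoint t) ≠ 0 := by
    intro h
    apply h2
    simpa using congrArg conj h
  have h4 : w * conj w = (‖w‖ : ℂ) ^ 2 := by
    rw [Complex.mul_conj, Complex.normSq_eq_norm_sq]; simp
  rw [diskPoissonKernel, Complex.ofReal_mul, Complex.ofReal_pow, ← Complex.conj_mul']
  simp only [cauchyKernel, map_div₀, map_one, map_sub, map_mul, Complex.conj_conj,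
    Complex.ofReal_sub, Complex.ofReal_one, Complex.ofReal_pow, ← h4]
  field_simp
  linear_combination (w * conj w) * h1

theorem diskPoissonKernel_nonneg {w : ℂ} (hw : ‖w‖ < 1) (t : UnitAddCircle) :
    0 ≤ diskPoissonKernel w t :=
  mul_nonneg (by nlinarith [norm_nonneg w]) (by positivity)

theorem diskPoissonKernel_le {w : ℂ} (hw : ‖w‖ < 1) (t : UnitAddCircle) :
    diskPoissonKernel w t ≤ 2 / (1 - ‖w‖) := by
  have h1 := norm_cauchyKernel_le hw (norm_circlePoint t).le
  have h2 : 0 < 1 - ‖w‖ := by linarith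
  calc diskPoissonKernel w t ≤ (1 - ‖w‖ ^ 2) * (1 / (1 - ‖w‖)) ^ 2 := by
        refine mul_le_mul_of_nonneg_left ?_ (by nlinarith [norm_nonneg w])
        exact pow_le_pow_left₀ (norm_nonneg _) h1 2
    _ = (1 + ‖w‖) / (1 - ‖w‖) := by field_simp; ring
    _ ≤ 2 / (1 - ‖w‖) := by gcongr; linarith

theorem continuous_diskPoissonKernel {w : ℂ} (hw : ‖w‖ < 1) :
    Continuous (diskPoissonKernel w) :=
  continuous_const.mul ((continuous_cauchyKernel_circlePoint hw).norm.pow 2)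

/-- The Poisson formula for bounded analytic functions, in terms of the boundary values. -/
theorem HasBoundaryValues.integral_mul_diskPoissonKernel {F : ℂ → ℂ} {f : UnitAddCircle → ℂ}
    (hF : HasBoundaryValues F f) {w : ℂ} (hw : ‖w‖ < 1) :
    ∫ t, f t * diskPoissonKernel w t ∂circleMeasure = F w := by
  have hc := HasBoundaryValues.cauchy hw
  have i1 : Integrable (fun t => f t * cauchyKernel w (circlePoint t)) circleMeasure :=
    ((hF.mul hc).memLp 1).integrable le_rfl
  have i2 : Integrable (fun t => f t * conj (cauchyKernel w (circlePoint t))) circleMeasure := by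
    refine (MemLp.mul (p := ∞) (q := 1) (r := 1) ?_ (hF.memLp ∞)).integrable le_rfl
    exact (hc.memLp 1).star
  have i3 : Integrable f circleMeasure := (hF.memLp 1).integrable le_rfl
  have i12 : Integrable (fun t => f t * cauchyKernel w (circlePoint t)
      + f t * conj (cauchyKernel w (circlePoint t))) circleMeasure := i1.add i2
  -- The conjugate Cauchy kernel reproduces `F w`. The other two terms are `F 0` and `-F 0`, as the
  -- Cauchy kernel equals `1` at the origin.
  simp only [diskPoissonKernel_eq hw, mul_sub, mul_add, mul_one]
  rw [integral_sub i12 i3, integral_add i1 i2, hF.integral_mul_conj_cauchyKernel hw,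
    (hF.mul hc).integral_eq, hF.integral_eq]
  simp [cauchyKernel]

theorem integral_diskPoissonKernel {w : ℂ} (hw : ‖w‖ < 1) :
    ∫ t, diskPoissonKernel w t ∂circleMeasure = 1 := by
  have h := (HasBoundaryValues.const 1).integral_mul_diskPoissonKernel hw
  simp only [one_mul] at h
  rw [integral_complex_ofReal] at h
  exact_mod_cast h

theorem memLp_diskPoissonKernel {w : ℂ} (hw : ‖w‖ < 1) :
    MemLp (fun t => (diskPoissonKernel w t : ℂ)) ∞ circleMeasure := by
  refine memLp_top_of_bound (Complex.continuous_ofReal.comp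
    (continuous_diskPoissonKernel hw)).aestronglyMeasurable (2 / (1 - ‖w‖))
    (Eventually.of_forall fun t => ?_)
  rw [Complex.norm_real, Real.norm_of_nonneg (diskPoissonKernel_nonneg hw t)]
  exact diskPoissonKernel_le hw t

/-! ### Pairings in `L²` and the Hardy space -/

theorem ae_norm_le_toReal_eLpNorm_top {v : UnitAddCircle → ℂ}
    (hv : MemLp v ∞ circleMeasure) :
    ∀ᵐ t ∂circleMeasure, ‖v t‖ ≤ (eLpNorm v ∞ circleMeasure).toReal := by
  rw [eLpNorm_exponent_top]
  filter_upwards [enorm_ae_le_eLpNormEssSup v circleMeasure] with t ht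
  rw [← toReal_enorm]
  exact ENNReal.toReal_mono (by rw [← eLpNorm_exponent_top]; exact hv.2.ne) ht

theorem L2_inner_eq_integral (f g : L2) :
    inner ℂ f g = ∫ t, g t * conj (f t) ∂circleMeasure := by
  simp only [MeasureTheory.L2.inner_def, RCLike.inner_apply]

theorem inner_toLp_left {u : UnitAddCircle → ℂ} (hu : MemLp u 2 circleMeasure) (g : L2) :
    inner ℂ (hu.toLp u) g = ∫ t, g t * conj (u t) ∂circleMeasure := by
  rw [L2_inner_eq_integral]
  refine integral_congr_ae ?_
  filter_upwards [hu.coeFn_toLp] with t ht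
  rw [ht]

theorem inner_toLp_right {u : UnitAddCircle → ℂ} (hu : MemLp u 2 circleMeasure) (g : L2) :
    inner ℂ g (hu.toLp u) = ∫ t, u t * conj (g t) ∂circleMeasure := by
  rw [L2_inner_eq_integral]
  refine integral_congr_ae ?_
  filter_upwards [hu.coeFn_toLp] with t ht
  rw [ht]

theorem memLp_mul_of_top {p : ℝ≥0∞} {f g : UnitAddCircle → ℂ} (hf : MemLp f ∞ circleMeasure)
    (hg : MemLp g p circleMeasure) : MemLp (fun t => f t * g t) p circleMeasure :=
  MemLp.mul (p := ∞) (q := p) (r := p) hg hf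

theorem memLp_conj {p : ℝ≥0∞} {f : UnitAddCircle → ℂ} (hf : MemLp f p circleMeasure) :
    MemLp (fun t => conj (f t)) p circleMeasure := hf.star

theorem integral_conj_circle (f : UnitAddCircle → ℂ) :
    ∫ t, conj (f t) ∂circleMeasure = conj (∫ t, f t ∂circleMeasure) := integral_conj

theorem memLp_circlePoint_pow (n : ℕ) (p : ℝ≥0∞) :
    MemLp (fun t => circlePoint t ^ n) p circleMeasure := (HasBoundaryValues.pow_id n).memLp p

theorem inner_fourierBasis_natCast (n : ℕ) (u : L2) :
    inner ℂ (fourierBasis (n : ℤ)) u = ∫ t, u t * conj (circlePoint t ^ n) ∂circleMeasure := by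
  rw [← HilbertBasis.repr_apply_apply, fourierBasis_repr, fourierCoeff]
  refine integral_congr_ae (Eventually.of_forall fun t => ?_)
  simp only [smul_eq_mul, fourier_neg_natCast, mul_comm]

theorem mem_hardy_iff (f : L2) :
    f ∈ hardy ↔ ∀ n : ℕ, ∫ t, f t * circlePoint t ^ (n + 1) ∂circleMeasure = 0 := by
  have h : ∀ n : ℕ, fourierCoeff (f : UnitAddCircle → ℂ) (-((n + 1 : ℕ) : ℤ))
      = ∫ t, f t * circlePoint t ^ (n + 1) ∂circleMeasure := by
    intro n
    rw [fourierCoeff]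
    refine integral_congr_ae (Eventually.of_forall fun t => ?_)
    simp only [neg_neg, smul_eq_mul, fourier_natCast, mul_comm]
  constructor
  · intro hf n
    rw [← h]
    exact hf _ (by push_cast; omega)
  · intro hf n hn
    obtain ⟨m, rfl⟩ : ∃ m : ℕ, n = -((m + 1 : ℕ) : ℤ) :=
      ⟨(-n - 1).toNat, by push_cast; omega⟩
    rw [h, hf]

theorem toLp_mem_hardy_iff {u : UnitAddCircle → ℂ} (hu : MemLp u 2 circleMeasure) :
    hu.toLp u ∈ hardy ↔ ∀ n : ℕ, ∫ t, u t * circlePoint t ^ (n + 1) ∂circleMeasure = 0 := by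
  rw [mem_hardy_iff]
  refine forall_congr' fun n => ?_
  rw [integral_congr_ae (g := fun t => u t * circlePoint t ^ (n + 1))]
  filter_upwards [hu.coeFn_toLp] with t ht
  rw [ht]

theorem HasBoundaryValues.toLp_mem_hardy {F : ℂ → ℂ} {f : UnitAddCircle → ℂ}
    (hF : HasBoundaryValues F f) : (hF.memLp 2).toLp f ∈ hardy := by
  rw [toLp_mem_hardy_iff]
  intro n
  rw [(hF.mul (HasBoundaryValues.pow_id (n + 1))).integral_eq]
  simp

theorem inner_fourierBasis_eq_zero_of_mem_hardy {g : L2} (hg : g ∈ hardy) {i : ℤ} (hi : i < 0) :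
    inner ℂ (fourierBasis i) g = 0 := by
  rw [← HilbertBasis.repr_apply_apply, fourierBasis_repr]
  exact hg i hi

/-- A function orthogonal to `1, z, z², …` is orthogonal to `H²`. -/
theorem inner_eq_zero_of_mem_hardy {u : L2}
    (hu : ∀ n : ℕ, ∫ t, u t * conj (circlePoint t ^ n) ∂circleMeasure = 0) {g : L2}
    (hg : g ∈ hardy) : inner ℂ g u = 0 := by
  rw [← fourierBasis.tsum_inner_mul_inner g u]
  refine (tsum_congr fun i => ?_).trans tsum_zero
  rcases lt_or_ge i 0 with hi | hi
  · rw [← inner_conj_symm, inner_fourierBasis_eq_zero_of_mem_hardy hg hi]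
    simp
  · obtain ⟨n, rfl⟩ := Int.eq_ofNat_of_zero_le hi
    rw [inner_fourierBasis_natCast, hu, mul_zero]

theorem integral_mul_conj_eq_zero_of_mem_hardy {u : UnitAddCircle → ℂ}
    (hu : MemLp u 2 circleMeasure)
    (h : ∀ n : ℕ, ∫ t, u t * conj (circlePoint t ^ n) ∂circleMeasure = 0) {g : L2}
    (hg : g ∈ hardy) : ∫ t, u t * conj (g t) ∂circleMeasure = 0 := by
  rw [← inner_toLp_right hu]
  refine inner_eq_zero_of_mem_hardy (fun n => ?_) hg
  rw [← h n]
  refine integral_congr_ae ?_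
  filter_upwards [hu.coeFn_toLp] with t ht
  rw [ht]

/-- The Cauchy transform of an `H²` function vanishes in the disk only if the function is zero. -/
theorem eq_zero_of_integral_mul_conj_cauchyKernel {g : L2} (hg : g ∈ hardy)
    (h : ∀ w : ℂ, ‖w‖ < 1 →
      ∫ t, g t * conj (cauchyKernel w (circlePoint t)) ∂circleMeasure = 0) : g = 0 := by
  have hsum : ∀ w : ℂ, ‖w‖ < 1 →
      HasSum (fun n : ℕ => w ^ n • inner ℂ (fourierBasis (n : ℤ)) g) 0 := by
    intro w hw
    have hc := HasBoundaryValues.cauchy hw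
    have h1 := fourierBasis.hasSum_inner_mul_inner ((hc.memLp 2).toLp _) g
    rw [inner_toLp_left, h w hw] at h1
    -- Parseval's sum runs over `ℤ`, but the negative coefficients of `g` vanish. The coefficients
    -- of the Cauchy kernel come from Cauchy's formula for `z ^ n`.
    have h2 := (Function.Injective.hasSum_iff (Nat.cast_injective (R := ℤ)) fun i hi => ?_).mpr h1
    · refine (congrArg (fun F : ℕ → ℂ => HasSum F 0) (funext fun n => ?_)).mpr h2
      rw [Function.comp_apply, inner_toLp_left, smul_eq_mul,
        ← (HasBoundaryValues.pow_id n).integral_mul_conj_cauchyKernel hw]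
      congr 1
      refine integral_congr_ae ?_
      rw [coe_fourierBasis]
      filter_upwards [coeFn_fourierLp (T := 1) 2 (n : ℤ)] with t ht
      rw [ht, fourier_natCast]
    · rw [inner_fourierBasis_eq_zero_of_mem_hardy hg, mul_zero]
      by_contra! h0
      exact hi ⟨i.toNat, Int.toNat_of_nonneg h0⟩
  have h0 : ∀ n : ℕ, inner ℂ (fourierBasis (n : ℤ)) g = 0 := by
    -- The zero function has a power series whose coefficients are the Fourier coefficients of `g`;
    -- uniqueness of power series makes them vanish.
    have hp : HasFPowerSeriesAt (fun _ : ℂ => (0 : ℂ)) (FormalMultilinearSeries.ofScalars ℂ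
        fun n : ℕ => inner ℂ (fourierBasis (n : ℤ)) g) 0 := by
      rw [hasFPowerSeriesAt_iff]
      filter_upwards [ball_mem_nhds (0 : ℂ) one_pos] with w hw
      simpa only [FormalMultilinearSeries.coeff_ofScalars] using hsum w (by simpa using hw)
    have := hp.eq_zero
    rw [FormalMultilinearSeries.ofScalars_series_eq_zero] at this
    exact fun n => congrFun this n
  refine inner_self_eq_zero (𝕜 := ℂ).mp (inner_eq_zero_of_mem_hardy (fun n => ?_) hg)
  rw [← inner_fourierBasis_natCast, h0]

instance completeSpace_hardy : CompleteSpace hardy := isClosed_hardy.completeSpace_coe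

/-! ### Inner functions and the projection onto the model space -/

namespace IsInner

variable {Θ : ℂ → ℂ}

theorem hasBoundaryValues (hΘ : IsInner Θ) : HasBoundaryValues Θ (boundaryFun Θ) where
  analytic := hΘ.analytic
  bounded := hΘ.bounded
  tendsto := by
    filter_upwards [hΘ.unimodular] with t ht
    obtain ⟨w, -, hw⟩ := ht
    exact tendsto_nhds_limUnder ⟨w, hw⟩

theorem norm_boundaryFun (hΘ : IsInner Θ) : ∀ᵐ t ∂circleMeasure, ‖boundaryFun Θ t‖ = 1 := by
  filter_upwards [hΘ.unimodular] with t ht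
  obtain ⟨w, h1, hw⟩ := ht
  rw [boundaryFun, radialLimit, hw.limUnder_eq, h1]

theorem boundaryFun_mul_conj (hΘ : IsInner Θ) :
    ∀ᵐ t ∂circleMeasure, boundaryFun Θ t * conj (boundaryFun Θ t) = 1 := by
  filter_upwards [hΘ.norm_boundaryFun] with t ht
  rw [Complex.mul_conj, Complex.normSq_eq_norm_sq, ht]
  simp

theorem memLp_mul (hΘ : IsInner Θ) {p : ℝ≥0∞} {g : UnitAddCircle → ℂ}
    (hg : MemLp g p circleMeasure) : MemLp (fun t => boundaryFun Θ t * g t) p circleMeasure :=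
  memLp_mul_of_top hΘ.hasBoundaryValues.memLp_top hg

theorem memLp_conj_mul (hΘ : IsInner Θ) {p : ℝ≥0∞} {g : UnitAddCircle → ℂ}
    (hg : MemLp g p circleMeasure) :
    MemLp (fun t => conj (boundaryFun Θ t) * g t) p circleMeasure :=
  memLp_mul_of_top (memLp_conj hΘ.hasBoundaryValues.memLp_top) hg

theorem toLp_mul_mem (hΘ : IsInner Θ) {g : L2} (hg : g ∈ hardy) :
    (hΘ.memLp_mul (Lp.memLp g)).toLp _ ∈ innerMulHardy Θ :=
  ⟨g, hg, MemLp.coeFn_toLp _⟩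

/-- `Θ H² ⊆ H²`. -/
theorem toLp_mul_mem_hardy (hΘ : IsInner Θ) {g : L2} (hg : g ∈ hardy) :
    (hΘ.memLp_mul (Lp.memLp g)).toLp _ ∈ hardy := by
  rw [toLp_mem_hardy_iff]
  intro n
  have hb := hΘ.hasBoundaryValues.mul (HasBoundaryValues.pow_id (n + 1))
  -- By conjugation it suffices that `conj(Θ z^(n+1))` is orthogonal to every `z^m`, and `Θ
  -- z^(n+1+m)` has integral zero because it vanishes at the origin.
  have h := integral_mul_conj_eq_zero_of_mem_hardy (memLp_conj (hb.memLp 2)) (fun m => ?_) hg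
  · have h2 := congrArg conj h
    rw [← integral_conj_circle, map_zero] at h2
    rw [← h2]
    refine integral_congr_ae (Eventually.of_forall fun t => ?_)
    simp only [map_mul, Complex.conj_conj]
    ring
  · simp only [← map_mul]
    rw [integral_conj_circle, (hb.mul (HasBoundaryValues.pow_id m)).integral_eq]
    simp

/-- Orthogonality of `f` to `Θ H²` is orthogonality of `conj(Θ) f` to `H²`, which needs testing on
monomials only. -/
theorem mem_modelSpace_iff (hΘ : IsInner Θ) (f : L2) :
    f ∈ modelSpace Θ ↔ f ∈ hardy ∧
      ∀ n : ℕ, ∫ t, f t * conj (boundaryFun Θ t * circlePoint t ^ n) ∂circleMeasure = 0 := by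
  rw [modelSpace, Submodule.mem_inf]
  refine and_congr_right fun hf => ?_
  rw [Submodule.mem_orthogonal]
  constructor
  · intro h n
    have h1 := h _ (hΘ.toLp_mul_mem (HasBoundaryValues.pow_id n).toLp_mem_hardy)
    rw [inner_toLp_left] at h1
    rw [← h1]
    refine integral_congr_ae ?_
    filter_upwards [((HasBoundaryValues.pow_id n).memLp 2).coeFn_toLp] with t ht
    rw [ht]
  · rintro h u ⟨g, hg, hu⟩
    rw [L2_inner_eq_integral]
    have h1 := integral_mul_conj_eq_zero_of_mem_hardy (hΘ.memLp_conj_mul (Lp.memLp f))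
      (fun n => ?_) hg
    · rw [← h1]
      refine integral_congr_ae ?_
      filter_upwards [hu] with t ht
      rw [ht, map_mul]
      ring
    · rw [← h n]
      refine integral_congr_ae (Eventually.of_forall fun t => ?_)
      simp only [map_mul]
      ring

theorem integral_mul_conj_eq_zero (hΘ : IsInner Θ) {f g : L2} (hf : f ∈ modelSpace Θ)
    (hg : g ∈ hardy) : ∫ t, f t * conj (boundaryFun Θ t * g t) ∂circleMeasure = 0 := by
  rw [modelSpace, Submodule.mem_inf, Submodule.mem_orthogonal] at hf
  rw [← hf.2 _ (hΘ.toLp_mul_mem hg), inner_toLp_left]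

/-- `P_Θ h = P₊ h - Θ P₊ (conj(Θ) h)`. -/
theorem starProjection_modelSpace (hΘ : IsInner Θ) (h : L2) :
    ((modelSpace Θ).starProjection h : UnitAddCircle → ℂ) =ᵐ[circleMeasure]
      fun t => hardy.starProjection h t - boundaryFun Θ t *
        hardy.starProjection ((hΘ.memLp_conj_mul (Lp.memLp h)).toLp _) t := by
  set h' : L2 := (hΘ.memLp_conj_mul (Lp.memLp h)).toLp _ with hh'
  set g : L2 := hardy.starProjection h' with hg
  have hgm : g ∈ hardy := Submodule.starProjection_apply_mem _ _
  set q : L2 := (hΘ.memLp_mul (Lp.memLp g)).toLp _ with hq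
  have key : (modelSpace Θ).starProjection h = hardy.starProjection h - q := by
    refine Submodule.eq_starProjection_of_mem_orthogonal (K := modelSpace Θ) ?_ ?_
    · rw [modelSpace, Submodule.mem_inf]
      refine ⟨hardy.sub_mem (Submodule.starProjection_apply_mem _ _) (hΘ.toLp_mul_mem_hardy hgm),
        ?_⟩
      rw [Submodule.mem_orthogonal]
      rintro u ⟨v, hv, hu⟩
      have hu' : u = (hΘ.memLp_mul (Lp.memLp v)).toLp _ :=
        Lp.ext (hu.trans (MemLp.coeFn_toLp _).symm)
      have huH : u ∈ hardy := by rw [hu']; exact hΘ.toLp_mul_mem_hardy hv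
      -- For `u = Θ v` both terms of the candidate pair with `u` to the same value `⟨u, h⟩`: the
      -- first because `u ∈ H²`, the second because multiplication by `Θ` is isometric.
      have e1 : inner ℂ u (hardy.starProjection h) = inner ℂ u h := by
        have := Submodule.sub_starProjection_mem_orthogonal (K := hardy) h
        rw [Submodule.mem_orthogonal] at this
        have := this u huH
        rw [inner_sub_right, sub_eq_zero] at this
        exact this.symm
      have e2 : inner ℂ v g = inner ℂ v h' := by
        have := Submodule.sub_starProjection_mem_orthogonal (K := hardy) h'
        rw [Submodule.mem_orthogonal] at this
        have := this v hv
        rw [inner_sub_right, sub_eq_zero] at this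
        exact this.symm
      have e3 : inner ℂ u q = inner ℂ v g := by
        rw [hu', hq, inner_toLp_left, L2_inner_eq_integral]
        refine integral_congr_ae ?_
        filter_upwards [MemLp.coeFn_toLp (hΘ.memLp_mul (Lp.memLp g)),
          hΘ.boundaryFun_mul_conj] with t h1 h2
        rw [h1, map_mul]
        linear_combination (g t * conj (v t)) * h2
      have e4 : inner ℂ u h = inner ℂ v h' := by
        rw [hu', hh', inner_toLp_left, inner_toLp_right]
        refine integral_congr_ae (Eventually.of_forall fun t => ?_)
        simp only [map_mul]
        ring
      rw [inner_sub_right, e1, e3, e2, e4, sub_self]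
    -- The remainder is `(h - P₊ h) + Θ g`: the first summand is orthogonal to `H²`, the second lies
    -- in `Θ H²`, and `K_Θ` is orthogonal to both.
    · rw [sub_sub_eq_add_sub, add_sub_right_comm]
      refine Submodule.add_mem _ ?_ ?_
      · exact Submodule.orthogonal_le inf_le_left 
          (Submodule.sub_starProjection_mem_orthogonal (K := hardy) h)
      · refine Submodule.orthogonal_le (inf_le_right (a := hardy)) ?_
        exact Submodule.le_orthogonal_orthogonal _ (hΘ.toLp_mul_mem hgm)
  rw [key]
  filter_upwards [Lp.coeFn_sub (hardy.starProjection h) q,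
    MemLp.coeFn_toLp (hΘ.memLp_mul (Lp.memLp g))] with t h1 h2
  rw [h1, Pi.sub_apply, hq, h2]

end IsInner

/-! ### M. Riesz's theorem: the Riesz projection on `L^p` -/

/-- For even `n`, `|f|²ⁿ` is dominated by `|f + conj(g)|²ⁿ` up to the real part of `(f g)ⁿ`. -/
theorem exists_norm_pow_le {n : ℕ} (hn : Even n) :
    ∃ A : ℝ, 0 ≤ A ∧ ∀ f g : ℂ,
      ‖f‖ ^ (2 * n) ≤ A * ‖f + conj g‖ ^ (2 * n) + 2 * ((f * g) ^ n).re := by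
  -- With `h = f + conj(g)` one has `f g = |f|² (-1 + ω)`, where `ω = f conj(h) / |f|²`. If `h` is
  -- small compared with `f` then `ω` is near `0`, and since `n` is even the real part of `(f g)ⁿ`
  -- exceeds `|f|²ⁿ / 2`.
  have hcont : ContinuousAt (fun ω : ℂ => ((-1 + ω) ^ n).re) 0 := by fun_prop
  have h1 : ∀ᶠ ω : ℂ in 𝓝 0, (1 / 2 : ℝ) < ((-1 + ω) ^ n).re := by
    refine hcont.eventually (lt_mem_nhds ?_)
    simp only [add_zero, hn.neg_one_pow]
    norm_num
  obtain ⟨ε, hε, hball⟩ := Metric.eventually_nhds_iff.mp h1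
  set K := 1 / ε with hK
  have hKpos : 0 < K := by positivity
  refine ⟨K ^ (2 * n) + 2 * (K * (1 + K)) ^ n, by positivity, fun f g => ?_⟩
  set h := f + conj g with hh
  have hg : g = conj h - conj f := by rw [hh]; simp
  have hA : 0 ≤ (K ^ (2 * n) + 2 * (K * (1 + K)) ^ n) * ‖h‖ ^ (2 * n) := by positivity
  rcases lt_or_ge ‖h‖ (ε * ‖f‖) with hlt | hge
  · have hf : f ≠ 0 := by
      rintro rfl
      rw [norm_zero, mul_zero] at hlt
      exact absurd hlt (norm_nonneg _).not_gt
    have hfpos : 0 < ‖f‖ := norm_pos_iff.mpr hf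
    have hfc : conj f * f = (‖f‖ : ℂ) ^ 2 := Complex.conj_mul' f
    have hfc0 : (‖f‖ : ℂ) ≠ 0 := by exact_mod_cast hfpos.ne'
    set ω : ℂ := f * conj h / (‖f‖ : ℂ) ^ 2 with hω
    have hx : f * g = ((‖f‖ ^ 2 : ℝ) : ℂ) * (-1 + ω) := by
      rw [hω, hg]
      push_cast
      field_simp
      linear_combination -hfc
    have hωn : ‖ω‖ < ε := by
      rw [hω, norm_div, norm_mul, RCLike.norm_conj, norm_pow, Complex.norm_real, norm_norm,
        div_lt_iff₀ (by positivity)]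
      nlinarith
    have h2 := hball (y := ω) (by simpa using hωn)
    have h3 : ((f * g) ^ n).re = ‖f‖ ^ (2 * n) * ((-1 + ω) ^ n).re := by
      rw [hx, mul_pow, ← Complex.ofReal_pow, Complex.re_ofReal_mul, pow_mul]
    have h4 : 0 < ‖f‖ ^ (2 * n) := by positivity
    rw [h3]
    nlinarith
  -- Otherwise `|f|` and `|g|` are both bounded by multiples of `|h|`, and so is every term of the
  -- inequality after taking powers.
  · have hfK : ‖f‖ ≤ K * ‖h‖ := by
      rw [hK, one_div_mul_eq_div, le_div_iff₀ hε]; linarith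
    have hgK : ‖g‖ ≤ (1 + K) * ‖h‖ := by
      rw [hg]
      refine (norm_sub_le _ _).trans ?_
      rw [RCLike.norm_conj, RCLike.norm_conj]
      linarith
    have h5 : -(K * (1 + K)) ^ n * ‖h‖ ^ (2 * n) ≤ ((f * g) ^ n).re := by
      have h6 : ‖(f * g) ^ n‖ ≤ (K * (1 + K)) ^ n * ‖h‖ ^ (2 * n) := by
        rw [norm_pow, norm_mul, pow_mul, ← mul_pow]
        refine pow_le_pow_left₀ (by positivity) ?_ n
        calc ‖f‖ * ‖g‖ ≤ (K * ‖h‖) * ((1 + K) * ‖h‖) := by gcongr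
          _ = _ := by ring
      have h7 := (abs_le.mp (Complex.abs_re_le_norm ((f * g) ^ n))).1
      linarith
    have h8 : ‖f‖ ^ (2 * n) ≤ K ^ (2 * n) * ‖h‖ ^ (2 * n) := by
      rw [← mul_pow]
      exact pow_le_pow_left₀ (norm_nonneg _) hfK _
    linarith

theorem HasBoundaryValues.polynomial (p : Polynomial ℂ) :
    HasBoundaryValues (fun z => p.eval z) (fun t => p.eval (circlePoint t)) :=
  HasBoundaryValues.of_continuous p.differentiable.differentiableOn p.continuous.continuousOn

/-- The constant term is put into `P`. With `Q(0) = 0`, the polynomial `P` is exactly the Riesz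
projection, and `P Q` vanishes at the origin. -/
theorem exists_polynomial_of_mem_span_fourierLp {p : ℝ≥0∞} [Fact (1 ≤ p)]
    {h : Lp ℂ p circleMeasure} (hh : h ∈ Submodule.span ℂ (Set.range (fourierLp (T := 1) p))) :
    ∃ P Q : Polynomial ℂ, Q.eval 0 = 0 ∧ (h : UnitAddCircle → ℂ) =ᵐ[circleMeasure]
      fun t => P.eval (circlePoint t) + conj (Q.eval (circlePoint t)) := by
  induction hh using Submodule.span_induction with
  | mem x hx =>
    obtain ⟨n, rfl⟩ := hx
    rcases lt_or_ge n 0 with hn | hn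
    · obtain ⟨m, rfl⟩ : ∃ m : ℕ, n = -((m + 1 : ℕ) : ℤ) := ⟨(-n - 1).toNat, by push_cast; omega⟩
      refine ⟨0, Polynomial.X ^ (m + 1), by simp, ?_⟩
      filter_upwards [coeFn_fourierLp (T := 1) p (-((m + 1 : ℕ) : ℤ))] with t ht
      rw [ht, fourier_neg_natCast]
      simp
    · obtain ⟨m, rfl⟩ := Int.eq_ofNat_of_zero_le hn
      refine ⟨Polynomial.X ^ m, 0, by simp, ?_⟩
      filter_upwards [coeFn_fourierLp (T := 1) p (m : ℤ)] with t ht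
      rw [ht, fourier_natCast]
      simp
  | zero =>
    refine ⟨0, 0, by simp, ?_⟩
    filter_upwards [Lp.coeFn_zero ℂ p circleMeasure] with t ht
    rw [ht]; simp
  | add x y _ _ hx hy =>
    obtain ⟨P, Q, h0, h⟩ := hx
    obtain ⟨P', Q', h0', h'⟩ := hy
    refine ⟨P + P', Q + Q', by simp [h0, h0'], ?_⟩
    filter_upwards [h, h', Lp.coeFn_add x y] with t h1 h2 h3
    rw [h3, Pi.add_apply, h1, h2, Polynomial.eval_add, Polynomial.eval_add, map_add]
    ring
  | smul c x _ hx =>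
    obtain ⟨P, Q, h0, h⟩ := hx
    refine ⟨Polynomial.C c * P, Polynomial.C (conj c) * Q, by simp [h0], ?_⟩
    filter_upwards [h, Lp.coeFn_smul c x] with t h1 h2
    rw [h2, Pi.smul_apply, h1, Polynomial.eval_mul, Polynomial.eval_mul, Polynomial.eval_C,
      Polynomial.eval_C, map_mul, Complex.conj_conj, smul_eq_mul]
    ring

/-- Integrating the inequality of `exists_norm_pow_le` with `f = P`, `g = Q` loses the last term,
since `∫ (P Q)ⁿ = (P Q)ⁿ(0) = 0`. -/
theorem exists_eLpNorm_polynomial_le {n : ℕ} (hn : Even n) (h0 : n ≠ 0) :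
    ∃ C : NNReal, ∀ P Q : Polynomial ℂ, Q.eval 0 = 0 →
      eLpNorm (fun t => P.eval (circlePoint t)) ((2 * n : ℕ) : ℝ≥0∞) circleMeasure ≤
        C * eLpNorm (fun t => P.eval (circlePoint t) + conj (Q.eval (circlePoint t)))
          ((2 * n : ℕ) : ℝ≥0∞) circleMeasure := by
  obtain ⟨A, hA, hpt⟩ := exists_norm_pow_le hn
  refine ⟨(A ^ (((2 * n : ℕ) : ℝ)⁻¹)).toNNReal, fun P Q hQ => ?_⟩
  have hP := HasBoundaryValues.polynomial P
  have hQ' := HasBoundaryValues.polynomial Q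
  have hPQ := HasBoundaryValues.polynomial ((P * Q) ^ n)
  have hsum : MemLp (fun t => P.eval (circlePoint t) + conj (Q.eval (circlePoint t)))
      ((2 * n : ℕ) : ℝ≥0∞) circleMeasure := (hP.memLp _).add (memLp_conj (hQ'.memLp _))
  have hne : ((2 * n : ℕ) : ℝ≥0∞) ≠ 0 := by simpa using h0
  rw [(hP.memLp _).eLpNorm_eq_integral_rpow_norm hne (ENNReal.natCast_ne_top _),
    hsum.eLpNorm_eq_integral_rpow_norm hne (ENNReal.natCast_ne_top _)]
  simp only [ENNReal.toReal_natCast, Real.rpow_natCast]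
  rw [ENNReal.ofNNReal_toNNReal, ← ENNReal.ofReal_mul (by positivity),
    ← Real.mul_rpow hA (by positivity)]
  refine ENNReal.ofReal_le_ofReal (Real.rpow_le_rpow (by positivity) ?_ (by positivity))
  have i1 : Integrable (fun t => ‖P.eval (circlePoint t)‖ ^ (2 * n)) circleMeasure :=
    (hP.memLp _).integrable_norm_pow (by simpa using h0)
  have i2 : Integrable (fun t => ‖P.eval (circlePoint t) + conj (Q.eval (circlePoint t))‖
      ^ (2 * n)) circleMeasure := hsum.integrable_norm_pow (by simpa using h0)
  have i3 : Integrable (fun t => ((P * Q) ^ n).eval (circlePoint t)) circleMeasure :=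
    (hPQ.memLp 1).integrable le_rfl
  have e3 : ∫ t, (((P * Q) ^ n).eval (circlePoint t)).re ∂circleMeasure = 0 := by
    have := integral_re i3
    simp only [RCLike.re_to_complex] at this
    rw [this, hPQ.integral_eq]
    simp [hQ, h0]
  have i4 : Integrable (fun t => 2 * (((P * Q) ^ n).eval (circlePoint t)).re) circleMeasure :=
    i3.re.const_mul 2
  calc ∫ t, ‖P.eval (circlePoint t)‖ ^ (2 * n) ∂circleMeasure
      ≤ ∫ t, (A * ‖P.eval (circlePoint t) + conj (Q.eval (circlePoint t))‖ ^ (2 * n)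
        + 2 * (((P * Q) ^ n).eval (circlePoint t)).re) ∂circleMeasure := by
        refine integral_mono i1 ((i2.const_mul A).add i4) fun t => ?_
        simpa using hpt (P.eval (circlePoint t)) (Q.eval (circlePoint t))
    _ = _ := by
        rw [integral_add (i2.const_mul A) i4, integral_const_mul, integral_const_mul, e3, mul_zero,
          add_zero]

/-- The Riesz projection of a trigonometric polynomial. -/
theorem starProjection_hardy_polynomial (P Q : Polynomial ℂ) (hQ : Q.eval 0 = 0) {h : L2}
    (hh : (h : UnitAddCircle → ℂ) =ᵐ[circleMeasure]
      fun t => P.eval (circlePoint t) + conj (Q.eval (circlePoint t))) :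
    hardy.starProjection h = ((HasBoundaryValues.polynomial P).memLp 2).toLp _ := by
  refine Submodule.eq_starProjection_of_mem_orthogonal (K := hardy)
    (HasBoundaryValues.polynomial P).toLp_mem_hardy ?_
  have hb := HasBoundaryValues.polynomial Q
  have hq := memLp_conj (hb.memLp 2)
  have e : h - ((HasBoundaryValues.polynomial P).memLp 2).toLp _ = hq.toLp _ := by
    refine Lp.ext ?_
    filter_upwards [hh, Lp.coeFn_sub h (((HasBoundaryValues.polynomial P).memLp 2).toLp _),
      ((HasBoundaryValues.polynomial P).memLp 2).coeFn_toLp, hq.coeFn_toLp] with t h1 h2 h3 h4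
    rw [h2, Pi.sub_apply, h1, h3, h4, add_sub_cancel_left]
  rw [e, Submodule.mem_orthogonal]
  intro u hu
  rw [inner_toLp_right]
  refine integral_mul_conj_eq_zero_of_mem_hardy hq (fun n => ?_) hu
  simp only [← map_mul]
  rw [integral_conj_circle, (hb.mul (HasBoundaryValues.pow_id n)).integral_eq, hQ]
  simp

/-- The Riesz projection is bounded on `L^{2n}` for even `n`. -/
theorem exists_eLpNorm_starProjection_hardy_le {n : ℕ} (hn : Even n) (h0 : n ≠ 0) :
    ∃ C : NNReal, ∀ h : L2, MemLp h ((2 * n : ℕ) : ℝ≥0∞) circleMeasure →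
      eLpNorm (hardy.starProjection h) ((2 * n : ℕ) : ℝ≥0∞) circleMeasure ≤
        C * eLpNorm h ((2 * n : ℕ) : ℝ≥0∞) circleMeasure := by
  obtain ⟨C, hC⟩ := exists_eLpNorm_polynomial_le hn h0
  refine ⟨C, fun h hh => ?_⟩
  set N : ℝ≥0∞ := ((2 * n : ℕ) : ℝ≥0∞) with hN
  have h2N : 2 ≤ N := by
    rw [hN]
    exact_mod_cast (show 2 ≤ 2 * n by omega)
  have : Fact (1 ≤ N) := ⟨le_trans (by norm_num) h2N⟩
  have hmem : hh.toLp h ∈ closure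
      (Submodule.span ℂ (Set.range (fourierLp (T := 1) N)) : Set (Lp ℂ N circleMeasure)) := by
    rw [← Submodule.topologicalClosure_coe,
      span_fourierLp_closure_eq_top (ENNReal.natCast_ne_top _)]
    trivial
  -- Trigonometric polynomials approximate `h` in `L^N`, hence in `L²`, where the projection is
  -- continuous. Along a subsequence the projections converge a.e., and Fatou's lemma carries over
  -- the bound.
  obtain ⟨x, hx, hlim⟩ := mem_closure_iff_seq_limit.mp hmem
  choose P Q hQ hPQ using fun j => exists_polynomial_of_mem_span_fourierLp (hx j)
  have hx2 : ∀ j, MemLp (x j) 2 circleMeasure := fun j => (Lp.memLp (x j)).mono_exponent h2N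
  have hlim2 : Tendsto (fun j => (hx2 j).toLp (x j)) atTop (𝓝 h) := by
    rw [Lp.tendsto_Lp_iff_tendsto_eLpNorm']
    rw [Lp.tendsto_Lp_iff_tendsto_eLpNorm'] at hlim
    refine tendsto_of_tendsto_of_tendsto_of_le_of_le tendsto_const_nhds hlim
      (fun _ => zero_le) fun j => ?_
    have e : (((hx2 j).toLp (x j) : UnitAddCircle → ℂ) - (h : UnitAddCircle → ℂ)) =ᵐ[circleMeasure]
        ((x j : UnitAddCircle → ℂ) - (hh.toLp h : UnitAddCircle → ℂ)) := by
      filter_upwards [(hx2 j).coeFn_toLp, hh.coeFn_toLp] with t h1 h2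
      rw [Pi.sub_apply, Pi.sub_apply, h1, h2]
    dsimp only
    rw [eLpNorm_congr_ae e]
    exact eLpNorm_le_eLpNorm_of_exponent_le h2N
      ((Lp.aestronglyMeasurable _).sub (Lp.aestronglyMeasurable _))
  have hproj := (hardy.starProjection.continuous.tendsto h).comp hlim2
  obtain ⟨ns, hns, hae⟩ := (tendstoInMeasure_of_tendsto_Lp hproj).exists_seq_tendsto_ae
  refine (Lp.eLpNorm_lim_le_liminf_eLpNorm (fun _ => Lp.aestronglyMeasurable _) _ hae).trans ?_
  have hnorm : Tendsto (fun j => C * eLpNorm (x (ns j)) N circleMeasure) atTop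
      (𝓝 (C * eLpNorm h N circleMeasure)) := by
    refine ENNReal.Tendsto.const_mul ?_ (Or.inr ENNReal.coe_ne_top)
    have h1 := (hlim.comp hns.tendsto_atTop).enorm
    simp only [Lp.enorm_def] at h1
    rwa [eLpNorm_congr_ae hh.coeFn_toLp] at h1
  rw [← hnorm.liminf_eq]
  refine liminf_le_liminf (Eventually.of_forall fun j => ?_)
  rw [Function.comp_apply, starProjection_hardy_polynomial (P (ns j)) (Q (ns j)) (hQ _)
    ((hx2 _).coeFn_toLp.trans (hPQ _)),
    eLpNorm_congr_ae (MemLp.coeFn_toLp _), eLpNorm_congr_ae (hPQ (ns j))]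
  exact hC _ _ (hQ _)

theorem lintegral_rpow_ite_le {a s : ℝ} (ha : 0 < a) (hs : s < -1) :
    ∫⁻ t in Set.Ioi (0 : ℝ), (if a ≤ t then ENNReal.ofReal (t ^ s) else 0)
      = ENNReal.ofReal (-a ^ (s + 1) / (s + 1)) := by
  rw [← integral_Ioi_rpow_of_lt hs ha,
    ofReal_integral_eq_lintegral_ofReal (integrableOn_Ioi_rpow_of_lt hs ha)
      ((ae_restrict_mem measurableSet_Ioi).mono fun t ht =>
        Real.rpow_nonneg (ha.trans ht).le s)]
  have h : (fun t : ℝ => if a ≤ t then ENNReal.ofReal (t ^ s) else 0)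
      = (Set.Ici a).indicator fun t => ENNReal.ofReal (t ^ s) := by
    funext t
    simp [Set.indicator_apply]
  rw [h, lintegral_indicator measurableSet_Ici, Measure.restrict_restrict measurableSet_Ici,
    Set.inter_eq_left.mpr (Set.Ici_subset_Ioi.mpr ha)]
  exact setLIntegral_congr Ioi_ae_eq_Ici.symm

theorem lintegral_rpow_ite_lt {a s : ℝ} (ha : 0 ≤ a) (hs : -1 < s) :
    ∫⁻ t in Set.Ioi (0 : ℝ), (if t < a then ENNReal.ofReal (t ^ s) else 0)
      = ENNReal.ofReal (a ^ (s + 1) / (s + 1)) := by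
  have h1 : ∫ t in (0 : ℝ)..a, t ^ s = a ^ (s + 1) / (s + 1) := by
    rw [integral_rpow (Or.inl hs), Real.zero_rpow (by linarith), sub_zero]
  have h2 := (intervalIntegrable_iff_integrableOn_Ioc_of_le ha).mp
    (intervalIntegral.intervalIntegrable_rpow' hs (a := 0) (b := a))
  rw [← h1, intervalIntegral.integral_of_le ha,
    ofReal_integral_eq_lintegral_ofReal h2
      ((ae_restrict_mem measurableSet_Ioc).mono fun t ht => Real.rpow_nonneg ht.1.le s)]
  have h : (fun t : ℝ => if t < a then ENNReal.ofReal (t ^ s) else 0)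
      = (Set.Iio a).indicator fun t => ENNReal.ofReal (t ^ s) := by
    funext t
    simp [Set.indicator_apply]
  rw [h, lintegral_indicator measurableSet_Iio, Measure.restrict_restrict measurableSet_Iio,
    Set.inter_comm, Set.Ioi_inter_Iio]
  exact setLIntegral_congr Ioo_ae_eq_Ioc

/-- The Marcinkiewicz interpolation argument between the exponents `2` and `N`. -/
theorem lintegral_rpow_lt_top_of_distribution_le {α : Type*} [MeasurableSpace α] {μ : Measure α}
    [SFinite μ] {U φ : α → ℝ} (hU : 0 ≤ U) (hUm : AEMeasurable U μ) (hφ : 0 ≤ φ)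
    (hφm : Measurable φ) {p N : ℝ} (hp : 2 < p) (hN : p < N) {A : ℝ≥0∞} (hA : A ≠ ∞)
    (hdist : ∀ t : ℝ, 0 < t → μ {x | t < U x} ≤
      A * (ENNReal.ofReal (t ^ (-N)) *
        ∫⁻ x, (if φ x ≤ t then ENNReal.ofReal (φ x ^ N) else 0) ∂μ)
      + ENNReal.ofReal (t ^ (-2 : ℝ)) *
        ∫⁻ x, (if t < φ x then ENNReal.ofReal (φ x ^ (2 : ℝ)) else 0) ∂μ)
    (hfin : ∫⁻ x, ENNReal.ofReal (φ x ^ p) ∂μ < ∞) :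
    ∫⁻ x, ENNReal.ofReal (U x ^ p) ∂μ < ∞ := by
  have mlow : Measurable fun z : ℝ × α => if φ z.2 ≤ z.1 then
      ENNReal.ofReal (z.1 ^ (p - 1 - N)) * ENNReal.ofReal (φ z.2 ^ N) else 0 :=
    Measurable.ite (measurableSet_le (hφm.comp measurable_snd) measurable_fst)
      (by fun_prop) measurable_const
  have mhigh : Measurable fun z : ℝ × α => if z.1 < φ z.2 then
      ENNReal.ofReal (z.1 ^ (p - 3)) * ENNReal.ofReal (φ z.2 ^ (2 : ℝ)) else 0 :=
    Measurable.ite (measurableSet_lt measurable_fst (hφm.comp measurable_snd))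
      (by fun_prop) measurable_const
  -- Tonelli: the integral of `t^(p-1-N)` over `t ≥ φ` is `φ^(p-N) / (N - p)`, finite because `p <
  -- N`.
  have low : ∫⁻ t in Set.Ioi (0 : ℝ), ∫⁻ x, (if φ x ≤ t then
      ENNReal.ofReal (t ^ (p - 1 - N)) * ENNReal.ofReal (φ x ^ N) else 0) ∂μ
      ≤ ENNReal.ofReal (1 / (N - p)) * ∫⁻ x, ENNReal.ofReal (φ x ^ p) ∂μ := by
    rw [lintegral_lintegral_swap mlow.aemeasurable, ← lintegral_const_mul' _ _ ENNReal.ofReal_ne_top]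
    refine lintegral_mono fun x => ?_
    dsimp only
    rcases (hφ x).eq_or_lt with h0 | h0
    · simp only [Pi.zero_apply] at h0
      simp [← h0, Real.zero_rpow (show N ≠ 0 by linarith)]
    · simp only [Pi.zero_apply] at h0
      have e : ∀ t : ℝ, (if φ x ≤ t then
          ENNReal.ofReal (t ^ (p - 1 - N)) * ENNReal.ofReal (φ x ^ N) else 0)
          = (if φ x ≤ t then ENNReal.ofReal (t ^ (p - 1 - N)) else 0)
            * ENNReal.ofReal (φ x ^ N) := by
        intro t; split_ifs <;> simp
      simp only [e]
      rw [lintegral_mul_const' _ _ ENNReal.ofReal_ne_top,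
        lintegral_rpow_ite_le h0 (by linarith), ← ENNReal.ofReal_mul' (by positivity),
        ← ENNReal.ofReal_mul (by rw [one_div_nonneg]; linarith)]
      refine ENNReal.ofReal_le_ofReal (le_of_eq ?_)
      have e2 : φ x ^ p = φ x ^ (p - 1 - N + 1) * φ x ^ N := by
        rw [← Real.rpow_add h0]; congr 1; ring
      rw [e2]
      have h3 : p - 1 - N + 1 ≠ 0 := by linarith
      have h4 : N - p ≠ 0 := by linarith
      field_simp
      ring
  -- Tonelli again: the integral of `t^(p-3)` over `0 < t < φ` is `φ^(p-2) / (p - 2)`, finite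
  -- because `p > 2`.
  have high : ∫⁻ t in Set.Ioi (0 : ℝ), ∫⁻ x, (if t < φ x then
      ENNReal.ofReal (t ^ (p - 3)) * ENNReal.ofReal (φ x ^ (2 : ℝ)) else 0) ∂μ
      ≤ ENNReal.ofReal (1 / (p - 2)) * ∫⁻ x, ENNReal.ofReal (φ x ^ p) ∂μ := by
    rw [lintegral_lintegral_swap mhigh.aemeasurable,
      ← lintegral_const_mul' _ _ ENNReal.ofReal_ne_top]
    refine lintegral_mono fun x => ?_
    have e : ∀ t : ℝ, (if t < φ x then
        ENNReal.ofReal (t ^ (p - 3)) * ENNReal.ofReal (φ x ^ (2 : ℝ)) else 0)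
        = (if t < φ x then ENNReal.ofReal (t ^ (p - 3)) else 0)
          * ENNReal.ofReal (φ x ^ (2 : ℝ)) := by
      intro t; split_ifs <;> simp
    simp only [e]
    have h0 : 0 ≤ φ x := hφ x
    rw [lintegral_mul_const' _ _ ENNReal.ofReal_ne_top,
      lintegral_rpow_ite_lt h0 (by linarith), ← ENNReal.ofReal_mul' (by positivity),
      ← ENNReal.ofReal_mul (by rw [one_div_nonneg]; linarith)]
    refine ENNReal.ofReal_le_ofReal (le_of_eq ?_)
    have e2 : φ x ^ p = φ x ^ (p - 3 + 1) * φ x ^ (2 : ℝ) := by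
      rw [← Real.rpow_add_of_nonneg h0 (by linarith) (by norm_num)]; congr 1; ring
    rw [e2, show p - 3 + 1 = p - 2 by ring]
    ring
  rw [lintegral_rpow_eq_lintegral_meas_lt_mul μ (Eventually.of_forall hU) hUm (by linarith)]
  refine ENNReal.mul_lt_top ENNReal.ofReal_lt_top ?_
  calc ∫⁻ t in Set.Ioi (0 : ℝ), μ {x | t < U x} * ENNReal.ofReal (t ^ (p - 1))
      ≤ ∫⁻ t in Set.Ioi (0 : ℝ), (A * ∫⁻ x, (if φ x ≤ t then
          ENNReal.ofReal (t ^ (p - 1 - N)) * ENNReal.ofReal (φ x ^ N) else 0) ∂μ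
        + ∫⁻ x, (if t < φ x then
          ENNReal.ofReal (t ^ (p - 3)) * ENNReal.ofReal (φ x ^ (2 : ℝ)) else 0) ∂μ) := by
        refine setLIntegral_mono' measurableSet_Ioi fun t ht => ?_
        have ht0 : (0 : ℝ) < t := ht
        refine (mul_le_mul_left (hdist t ht) _).trans (le_of_eq ?_)
        have e1 : ENNReal.ofReal (t ^ (p - 1 - N))
            = ENNReal.ofReal (t ^ (-N)) * ENNReal.ofReal (t ^ (p - 1)) := by
          rw [← ENNReal.ofReal_mul (by positivity), ← Real.rpow_add ht0]
          congr 2; ring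
        have e2 : ENNReal.ofReal (t ^ (p - 3))
            = ENNReal.ofReal (t ^ (-2 : ℝ)) * ENNReal.ofReal (t ^ (p - 1)) := by
          rw [← ENNReal.ofReal_mul (by positivity), ← Real.rpow_add ht0]
          congr 2; ring
        have e3 : ∀ x, (if φ x ≤ t then
            ENNReal.ofReal (t ^ (p - 1 - N)) * ENNReal.ofReal (φ x ^ N) else 0)
            = (ENNReal.ofReal (t ^ (-N)) * ENNReal.ofReal (t ^ (p - 1)))
              * (if φ x ≤ t then ENNReal.ofReal (φ x ^ N) else 0) := by
          intro x; rw [e1]; split_ifs <;> simp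
        have e4 : ∀ x, (if t < φ x then
            ENNReal.ofReal (t ^ (p - 3)) * ENNReal.ofReal (φ x ^ (2 : ℝ)) else 0)
            = (ENNReal.ofReal (t ^ (-2 : ℝ)) * ENNReal.ofReal (t ^ (p - 1)))
              * (if t < φ x then ENNReal.ofReal (φ x ^ (2 : ℝ)) else 0) := by
          intro x; rw [e2]; split_ifs <;> simp
        simp only [e3, e4]
        rw [lintegral_const_mul' _ _ (by finiteness), lintegral_const_mul' _ _ (by finiteness)]
        ring
    _ = A * (∫⁻ t in Set.Ioi (0 : ℝ), ∫⁻ x, (if φ x ≤ t then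
          ENNReal.ofReal (t ^ (p - 1 - N)) * ENNReal.ofReal (φ x ^ N) else 0) ∂μ)
        + ∫⁻ t in Set.Ioi (0 : ℝ), ∫⁻ x, (if t < φ x then
          ENNReal.ofReal (t ^ (p - 3)) * ENNReal.ofReal (φ x ^ (2 : ℝ)) else 0) ∂μ := by
        rw [lintegral_add_left (mlow.lintegral_prod_right'.const_mul A),
          lintegral_const_mul' _ _ hA]
    _ < ∞ := by
        refine ENNReal.add_lt_top.mpr ⟨ENNReal.mul_lt_top hA.lt_top (low.trans_lt ?_),
          high.trans_lt ?_⟩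
        · exact ENNReal.mul_lt_top ENNReal.ofReal_lt_top hfin
        · exact ENNReal.mul_lt_top ENNReal.ofReal_lt_top hfin

theorem lintegral_enorm_rpow_eq {f : UnitAddCircle → ℂ} {p : ℝ} (hp : 0 ≤ p) :
    ∫⁻ t, ‖f t‖ₑ ^ p ∂circleMeasure = ∫⁻ t, ENNReal.ofReal (‖f t‖ ^ p) ∂circleMeasure := by
  refine lintegral_congr fun t => ?_
  rw [← ENNReal.ofReal_rpow_of_nonneg (norm_nonneg _) hp, ofReal_norm]

theorem measure_lt_norm_le {f : UnitAddCircle → ℂ} (hf : AEStronglyMeasurable f circleMeasure)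
    {p : ℝ≥0∞} (h0 : p ≠ 0) (h1 : p ≠ ∞) {t : ℝ} (ht : 0 < t) :
    circleMeasure {x | t < ‖f x‖} ≤
      ENNReal.ofReal (t ^ (-p.toReal)) * eLpNorm f p circleMeasure ^ p.toReal := by
  have h := meas_ge_le_mul_pow_eLpNorm_enorm (μ := circleMeasure) h0 h1 hf
    (ε := ENNReal.ofReal t) (by simpa using ht) (by simp)
  refine (measure_mono fun x hx => ?_).trans (h.trans (le_of_eq ?_))
  · change ENNReal.ofReal t ≤ ‖f x‖ₑ
    rw [← ofReal_norm]
    exact ENNReal.ofReal_le_ofReal (le_of_lt hx)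
  · rw [Real.rpow_neg ht.le, ENNReal.ofReal_inv_of_pos (by positivity),
      ← ENNReal.ofReal_rpow_of_pos ht, ENNReal.inv_rpow]

theorem eLpNorm_rpow_toReal {f : UnitAddCircle → ℂ} {p : ℝ≥0∞} (h0 : p ≠ 0) (h1 : p ≠ ∞) :
    eLpNorm f p circleMeasure ^ p.toReal =
      ∫⁻ t, ENNReal.ofReal (‖f t‖ ^ p.toReal) ∂circleMeasure := by
  rw [← lintegral_enorm_rpow_eq ENNReal.toReal_nonneg,
    eLpNorm_eq_lintegral_rpow_enorm_toReal h0 h1, ← ENNReal.rpow_mul, one_div,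
    inv_mul_cancel₀ (ENNReal.toReal_pos h0 h1).ne', ENNReal.rpow_one]

/-- The M. Riesz theorem: the Riesz projection preserves `L^p`, `2 < p < ∞`. -/
theorem memLp_starProjection_hardy {p : ℝ≥0∞} (hp : 2 < p) (hp' : p < ∞) {g : L2}
    (hg : MemLp g p circleMeasure) : MemLp (hardy.starProjection g) p circleMeasure := by
  have hp0 : p ≠ 0 := (lt_trans (by norm_num) hp).ne'
  have hpr : 2 < p.toReal := by
    have := (ENNReal.toReal_lt_toReal (by norm_num) hp'.ne).mpr hp
    simpa using this
  -- The upper endpoint is `N = 4m = 2 (2m)`: the bound is known at `2n` for even `n`, and `m > p`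
  -- gives `N > p`.
  obtain ⟨m, hm⟩ := exists_nat_gt p.toReal
  have hn : Even (2 * m) := even_two_mul m
  have hn0 : 2 * m ≠ 0 := by
    rintro h
    have : m = 0 := by omega
    rw [this] at hm
    norm_num at hm
    linarith
  obtain ⟨C, hC⟩ := exists_eLpNorm_starProjection_hardy_le hn hn0
  set N : ℝ≥0∞ := ((2 * (2 * m) : ℕ) : ℝ≥0∞) with hN
  have hN0 : N ≠ 0 := by rw [hN]; exact_mod_cast (by omega : 2 * (2 * m) ≠ 0)
  have hNt : N ≠ ∞ := ENNReal.natCast_ne_top _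
  have hpN : p.toReal < N.toReal := by
    rw [hN, ENNReal.toReal_natCast]
    push_cast
    linarith [Nat.cast_nonneg (α := ℝ) m]
  have hgm : Measurable (fun t => ‖g t‖) := (Lp.stronglyMeasurable g).measurable.norm
  -- The factor `1/2` is there because `g` is split in two at height `t`: a sum larger than `2t` has
  -- a summand larger than `t`.
  have key := lintegral_rpow_lt_top_of_distribution_le (μ := circleMeasure)
    (U := fun t => ‖hardy.starProjection g t‖ / 2) (φ := fun t => ‖g t‖) (A := (C : ℝ≥0∞) ^ N.toReal)
    (fun t => by positivity)
    ((Lp.stronglyMeasurable (hardy.starProjection g)).measurable.norm.div_const 2).aemeasurable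
    (fun t => norm_nonneg _) hgm hpr hpN (ENNReal.rpow_ne_top_of_nonneg (by positivity) (by simp))
    (fun t ht => ?_) ?_
  · refine ⟨Lp.aestronglyMeasurable _, ?_⟩
    rw [eLpNorm_lt_top_iff_lintegral_rpow_enorm_lt_top hp0 hp'.ne,
      lintegral_enorm_rpow_eq ENNReal.toReal_nonneg]
    have e : ∀ t, ENNReal.ofReal (‖hardy.starProjection g t‖ ^ p.toReal) =
        ENNReal.ofReal (2 ^ p.toReal) *
          ENNReal.ofReal ((‖hardy.starProjection g t‖ / 2) ^ p.toReal) := by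
      intro t
      rw [← ENNReal.ofReal_mul (by positivity), ← Real.mul_rpow (by norm_num) (by positivity),
        mul_div_cancel₀ _ (two_ne_zero)]
    simp only [e]
    rw [lintegral_const_mul' _ _ ENNReal.ofReal_ne_top]
    exact ENNReal.mul_lt_top ENNReal.ofReal_lt_top key
  -- The part where `|g| ≤ t` is bounded and is handled in `L^N`; the rest is handled in `L²`, where
  -- the projection is a contraction. Both use Chebyshev's inequality.
  · have mS : MeasurableSet {x | ‖g x‖ ≤ t} := measurableSet_le hgm measurable_const
    have mSc : {x | ‖g x‖ ≤ t}ᶜ = {x | t < ‖g x‖} := by ext; simp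
    have l1 : MemLp ({x | ‖g x‖ ≤ t}.indicator g) 2 circleMeasure := (Lp.memLp g).indicator mS
    have l2 : MemLp ({x | ‖g x‖ ≤ t}ᶜ.indicator g) 2 circleMeasure :=
      (Lp.memLp g).indicator mS.compl
    have l3 : MemLp ({x | ‖g x‖ ≤ t}.indicator g) N circleMeasure := by
      refine (memLp_top_of_bound l1.aestronglyMeasurable t ?_).mono_exponent le_top
      refine Eventually.of_forall fun x => ?_
      rw [Set.indicator_apply]
      split_ifs with hx
      · exact hx
      · simpa using ht.le
    have esum : g = l1.toLp _ + l2.toLp _ := by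
      refine Lp.ext ?_
      filter_upwards [l1.coeFn_toLp, l2.coeFn_toLp, Lp.coeFn_add (l1.toLp _) (l2.toLp _)]
        with x h1 h2 h3
      rw [h3, Pi.add_apply, h1, h2]
      exact (Set.indicator_self_add_compl_apply _ _ x).symm
    set a : L2 := l1.toLp _ with ha
    set b : L2 := l2.toLp _ with hb
    have haN : MemLp a N circleMeasure := l3.ae_eq l1.coeFn_toLp.symm
    have hsub : circleMeasure {x | t < ‖hardy.starProjection g x‖ / 2} ≤
        circleMeasure {x | t < ‖hardy.starProjection a x‖}
          + circleMeasure {x | t < ‖hardy.starProjection b x‖} := by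
      refine (measure_mono_ae ?_).trans (measure_union_le _ _)
      have e : hardy.starProjection g = hardy.starProjection a + hardy.starProjection b := by
        rw [← map_add, ← esum]
      filter_upwards [Lp.coeFn_add (hardy.starProjection a) (hardy.starProjection b)] with x hx hlt
      rw [← e] at hx
      change t < ‖hardy.starProjection g x‖ / 2 at hlt
      change t < ‖hardy.starProjection a x‖ ∨ t < ‖hardy.starProjection b x‖
      rw [hx, Pi.add_apply] at hlt
      by_contra! hcon
      linarith [norm_add_le (hardy.starProjection a x) (hardy.starProjection b x)]
    refine hsub.trans (add_le_add ?_ ?_)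
    · refine (measure_lt_norm_le (Lp.aestronglyMeasurable _) hN0 hNt ht).trans ?_
      have h1 : eLpNorm (hardy.starProjection a) N circleMeasure ^ N.toReal ≤
          (C : ℝ≥0∞) ^ N.toReal * eLpNorm a N circleMeasure ^ N.toReal := by
        rw [← ENNReal.mul_rpow_of_nonneg _ _ ENNReal.toReal_nonneg]
        exact ENNReal.rpow_le_rpow (hC a haN) ENNReal.toReal_nonneg
      refine (mul_le_mul_right h1 _).trans (le_of_eq ?_)
      rw [ha, eLpNorm_congr_ae l1.coeFn_toLp, eLpNorm_rpow_toReal hN0 hNt, mul_left_comm]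
      congr 2
      refine lintegral_congr fun x => ?_
      rw [Set.indicator_apply]
      simp only [Set.mem_ofPred_eq]
      split_ifs
      · rfl
      · rw [norm_zero, Real.zero_rpow (ENNReal.toReal_pos hN0 hNt).ne', ENNReal.ofReal_zero]
    · refine (measure_lt_norm_le (Lp.aestronglyMeasurable _) two_ne_zero
        ENNReal.ofNat_ne_top ht).trans ?_
      have h1 : eLpNorm (hardy.starProjection b) 2 circleMeasure ≤ eLpNorm b 2 circleMeasure := by
        rw [← Lp.enorm_def, ← Lp.enorm_def, enorm_le_iff_norm_le]
        exact Submodule.norm_starProjection_apply_le _ _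
      have h2 := ENNReal.rpow_le_rpow h1 (z := (2 : ℝ≥0∞).toReal) ENNReal.toReal_nonneg
      refine (mul_le_mul_right h2 _).trans (le_of_eq ?_)
      rw [hb, eLpNorm_congr_ae l2.coeFn_toLp, eLpNorm_rpow_toReal two_ne_zero ENNReal.ofNat_ne_top,
        ENNReal.toReal_ofNat]
      congr 1
      refine lintegral_congr fun x => ?_
      rw [mSc, Set.indicator_apply]
      simp only [Set.mem_ofPred_eq]
      split_ifs
      · rfl
      · rw [norm_zero, Real.zero_rpow two_ne_zero, ENNReal.ofReal_zero]
  · rw [← lintegral_enorm_rpow_eq ENNReal.toReal_nonneg,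
      ← eLpNorm_lt_top_iff_lintegral_rpow_enorm_lt_top hp0 hp'.ne]
    exact hg.2

/-! ### Reproducing kernels of the model space -/

/-- The reproducing kernel `(1 - conj(Θ(w)) Θ(z)) / (1 - conj(w) z)` of `K_Θ` at a point `w` of the
disk. -/
def diskKernel (Θ : ℂ → ℂ) (w z : ℂ) : ℂ := (1 - conj (Θ w) * Θ z) * cauchyKernel w z

/-- The boundary values of `diskKernel Θ w`. -/
def diskKernelBoundary (Θ : ℂ → ℂ) (w : ℂ) (t : UnitAddCircle) : ℂ :=
  (1 - conj (Θ w) * boundaryFun Θ t) * cauchyKernel w (circlePoint t)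

theorem cauchyKernel_conj_symm (w z : ℂ) : conj (cauchyKernel w z) = cauchyKernel z w := by
  simp [cauchyKernel, mul_comm]

namespace IsInner

variable {Θ : ℂ → ℂ}

theorem hasBoundaryValues_diskKernel (hΘ : IsInner Θ) {w : ℂ} (hw : ‖w‖ < 1) :
    HasBoundaryValues (diskKernel Θ w) (diskKernelBoundary Θ w) :=
  ((HasBoundaryValues.const 1).sub ((HasBoundaryValues.const _).mul hΘ.hasBoundaryValues)).mul
    (HasBoundaryValues.cauchy hw)

/-- The reproducing kernel of `K_Θ` at `w`, as an element of `L²`. -/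
def diskKernelLp (hΘ : IsInner Θ) {w : ℂ} (hw : ‖w‖ < 1) : L2 :=
  ((hΘ.hasBoundaryValues_diskKernel hw).memLp 2).toLp _

theorem coeFn_diskKernelLp (hΘ : IsInner Θ) {w : ℂ} (hw : ‖w‖ < 1) :
    (hΘ.diskKernelLp hw : UnitAddCircle → ℂ) =ᵐ[circleMeasure] diskKernelBoundary Θ w :=
  MemLp.coeFn_toLp _

/-- Since `|Θ| = 1` a.e., `Θ conj(k_w) = (Θ - Θ(w)) conj(c_w)` on the circle. Cauchy's formula at
`w` then makes the pairing with `z ^ n` vanish. -/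
theorem diskKernelLp_mem (hΘ : IsInner Θ) {w : ℂ} (hw : ‖w‖ < 1) :
    hΘ.diskKernelLp hw ∈ modelSpace Θ := by
  rw [hΘ.mem_modelSpace_iff]
  refine ⟨(hΘ.hasBoundaryValues_diskKernel hw).toLp_mem_hardy, fun n => ?_⟩
  have hp := HasBoundaryValues.pow_id n
  have h1 := (hΘ.hasBoundaryValues.mul hp).integral_mul_conj_cauchyKernel hw
  have h2 := hp.integral_mul_conj_cauchyKernel hw
  have hcc := memLp_conj ((HasBoundaryValues.cauchy hw).memLp ∞)
  have i1 : Integrable (fun t => boundaryFun Θ t * circlePoint t ^ n *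
      conj (cauchyKernel w (circlePoint t))) circleMeasure :=
    (memLp_mul_of_top ((hΘ.hasBoundaryValues.mul hp).memLp_top)
      (hcc.mono_exponent le_top)).integrable le_rfl
  have i2 : Integrable (fun t => circlePoint t ^ n *
      conj (cauchyKernel w (circlePoint t))) circleMeasure :=
    (memLp_mul_of_top hp.memLp_top (hcc.mono_exponent le_top)).integrable le_rfl
  have e : ∫ t, (boundaryFun Θ t * circlePoint t ^ n * conj (cauchyKernel w (circlePoint t))
      - Θ w * (circlePoint t ^ n * conj (cauchyKernel w (circlePoint t)))) ∂circleMeasure = 0 := by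
    rw [integral_sub i1 (i2.const_mul _), integral_const_mul, h1, h2, sub_self]
  have e' := congrArg conj e
  rw [← integral_conj_circle, map_zero] at e'
  rw [← e']
  refine integral_congr_ae ?_
  filter_upwards [hΘ.coeFn_diskKernelLp hw, hΘ.boundaryFun_mul_conj] with t h3 h4
  rw [h3, diskKernelBoundary]
  simp only [map_sub, map_mul, Complex.conj_conj]
  linear_combination (-(conj (Θ w) * cauchyKernel w (circlePoint t) *
    conj (circlePoint t ^ n))) * h4

/-- The two kernels differ by a multiple of `Θ c_w`, an element of `Θ H²`, to which `f` is
orthogonal. -/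
theorem integral_mul_conj_diskKernel (hΘ : IsInner Θ) {w : ℂ} (hw : ‖w‖ < 1) {f : L2}
    (hf : f ∈ modelSpace Θ) :
    ∫ t, f t * conj (diskKernelBoundary Θ w t) ∂circleMeasure =
      ∫ t, f t * conj (cauchyKernel w (circlePoint t)) ∂circleMeasure := by
  have hc := HasBoundaryValues.cauchy hw
  have h0 := hΘ.integral_mul_conj_eq_zero hf hc.toLp_mem_hardy
  have i1 : Integrable (fun t => f t * conj (cauchyKernel w (circlePoint t))) circleMeasure :=
    (memLp_mul_of_top (memLp_conj hc.memLp_top) ((Lp.memLp f).mono_exponent (by norm_num))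
      |>.integrable le_rfl).congr (Eventually.of_forall fun t => mul_comm _ _)
  have i2 : Integrable (fun t => f t * conj (boundaryFun Θ t * cauchyKernel w (circlePoint t)))
      circleMeasure :=
    (memLp_mul_of_top (memLp_conj (hΘ.hasBoundaryValues.mul hc).memLp_top)
      ((Lp.memLp f).mono_exponent (by norm_num))
      |>.integrable le_rfl).congr (Eventually.of_forall fun t => mul_comm _ _)
  have h1 : ∫ t, f t * conj (boundaryFun Θ t * cauchyKernel w (circlePoint t)) ∂circleMeasure
      = 0 := by
    rw [← h0]
    refine integral_congr_ae ?_
    filter_upwards [(hc.memLp 2).coeFn_toLp] with t ht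
    rw [ht]
  rw [← sub_zero (∫ t, f t * conj (cauchyKernel w (circlePoint t)) ∂circleMeasure),
    ← mul_zero (Θ w), ← h1, ← integral_const_mul, ← integral_sub i1 (i2.const_mul _)]
  refine integral_congr_ae (Eventually.of_forall fun t => ?_)
  simp only [diskKernelBoundary, map_sub, map_mul, Complex.conj_conj, map_one]
  ring

theorem inner_diskKernelLp (hΘ : IsInner Θ) {w : ℂ} (hw : ‖w‖ < 1) {f : L2}
    (hf : f ∈ modelSpace Θ) :
    inner ℂ (hΘ.diskKernelLp hw) f =
      ∫ t, f t * conj (cauchyKernel w (circlePoint t)) ∂circleMeasure := by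
  rw [diskKernelLp, inner_toLp_left, hΘ.integral_mul_conj_diskKernel hw hf]

/-- The reproducing kernels span a dense subspace of `K_Θ`. -/
theorem eq_zero_of_inner_diskKernelLp (hΘ : IsInner Θ) {f : L2} (hf : f ∈ modelSpace Θ)
    (h : ∀ (w : ℂ) (hw : ‖w‖ < 1), inner ℂ (hΘ.diskKernelLp hw) f = 0) : f = 0 := by
  refine eq_zero_of_integral_mul_conj_cauchyKernel (Submodule.mem_inf.mp hf).1 fun w hw => ?_
  rw [← hΘ.inner_diskKernelLp hw hf, h w hw]

theorem integral_norm_sq_diskKernel (hΘ : IsInner Θ) {w : ℂ} (hw : ‖w‖ < 1) :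
    ∫ t, ‖diskKernelBoundary Θ w t‖ ^ 2 ∂circleMeasure = (1 - ‖Θ w‖ ^ 2) / (1 - ‖w‖ ^ 2) := by
  have h1 := hΘ.inner_diskKernelLp hw (hΘ.diskKernelLp_mem hw)
  have h2 : ∫ t, hΘ.diskKernelLp hw t * conj (cauchyKernel w (circlePoint t)) ∂circleMeasure
      = diskKernel Θ w w := by
    rw [← (hΘ.hasBoundaryValues_diskKernel hw).integral_mul_conj_cauchyKernel hw]
    refine integral_congr_ae ?_
    filter_upwards [hΘ.coeFn_diskKernelLp hw] with t ht
    rw [ht]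
  rw [h2, diskKernelLp, inner_toLp_left] at h1
  have h3 : (∫ t, ((‖diskKernelBoundary Θ w t‖ ^ 2 : ℝ) : ℂ) ∂circleMeasure) =
      diskKernel Θ w w := by
    rw [← h1]
    refine integral_congr_ae ?_
    filter_upwards [hΘ.coeFn_diskKernelLp hw] with t ht
    have ht' := ht
    rw [diskKernelLp] at ht'
    rw [ht', Complex.mul_conj, Complex.normSq_eq_norm_sq]
  rw [integral_complex_ofReal] at h3
  have h4 : diskKernel Θ w w = (((1 - ‖Θ w‖ ^ 2) / (1 - ‖w‖ ^ 2) : ℝ) : ℂ) := by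
    rw [diskKernel, cauchyKernel, Complex.conj_mul', Complex.conj_mul']
    push_cast
    ring
  rw [h4] at h3
  exact_mod_cast h3

/-- The definition of inner only asks for some bound. The bound `1` is read off from the
nonnegativity of `‖k_w‖²`. -/
theorem norm_le_one (hΘ : IsInner Θ) {w : ℂ} (hw : ‖w‖ < 1) : ‖Θ w‖ ≤ 1 := by
  have h := hΘ.integral_norm_sq_diskKernel hw
  have h0 : 0 ≤ ∫ t, ‖diskKernelBoundary Θ w t‖ ^ 2 ∂circleMeasure :=
    integral_nonneg fun t => by positivity
  have h1 : 0 < 1 - ‖w‖ ^ 2 := by nlinarith [norm_nonneg w]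
  rw [h, le_div_iff₀ h1, zero_mul] at h0
  nlinarith [norm_nonneg (Θ w)]

end IsInner

/-! ### The boundary kernel at a Carathéodory point -/

/-- It suffices that no point is isolated. If `{0}` were open it would be clopen, hence the whole
connected circle, yet `1/2` is not `0`. -/
instance nullSingletonClass_circleMeasure : NullSingletonClass circleMeasure := by
  have : (𝓝[≠] (0 : UnitAddCircle)).NeBot := by
    rw [neBot_iff]
    intro h
    have ho : IsOpen ({0} : Set UnitAddCircle) := isOpen_singleton_iff_punctured_nhds _ |>.mpr h
    rcases isClopen_iff.mp ⟨isClosed_singleton, ho⟩ with h1 | h1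
    · exact Set.singleton_ne_empty _ h1
    · have h2 : ((1 / 2 : ℝ) : UnitAddCircle) = 0 := by
        have : ((1 / 2 : ℝ) : UnitAddCircle) ∈ ({0} : Set UnitAddCircle) := by rw [h1]; trivial
        simpa using this
      obtain ⟨n, hn⟩ := (AddCircle.coe_eq_zero_iff (1 : ℝ)).mp h2
      have h3 : ((2 * n : ℤ) : ℝ) = ((1 : ℤ) : ℝ) := by
        push_cast
        rw [zsmul_eq_mul] at hn
        linarith
      have h4 : 2 * n = 1 := by exact_mod_cast h3
      omega
  infer_instance

theorem ae_circlePoint_ne (ζ : Circle) : ∀ᵐ t ∂circleMeasure, circlePoint t ≠ ζ := by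
  have h : {t : UnitAddCircle | ¬ circlePoint t ≠ ζ}.Subsingleton := by
    intro s hs t ht
    simp only [ne_eq, not_not, Set.mem_ofPred_eq] at hs ht
    exact AddCircle.injective_toCircle one_ne_zero (Circle.coe_injective (hs.trans ht.symm))
  exact h.measure_zero _

/-- `Θ` is inner, and at `ζ` it has the unimodular radial limit `a`, with bounded radial difference
quotients. -/
structure IsCaratheodoryPoint (Θ : ℂ → ℂ) (ζ : Circle) (a : ℂ) : Prop where
  isInner : IsInner Θ
  norm_eq_one : ‖a‖ = 1
  tendsto : Tendsto (fun r : ℝ => Θ (r * ζ)) (𝓝[<] 1) (𝓝 a)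
  bound : ∃ C : ℝ, ∀ᶠ r : ℝ in 𝓝[<] 1, ‖a - Θ (r * ζ)‖ ≤ C * (1 - r)

theorem HasNontangentialLimit.tendsto_radial {f : ℂ → ℂ} {ζ : Circle} {w : ℂ}
    (h : HasNontangentialLimit f ζ w) :
    Tendsto (fun r : ℝ => f (r * ζ)) (𝓝[<] 1) (𝓝 w) := by
  -- On the radius `|z - ζ| = 1 - |z|`, so the strict inequality of the Stolz region holds with `M =
  -- 2` but not with `M = 1`.
  refine (h 2).comp (tendsto_nhdsWithin_iff.mpr ⟨tendsto_radius_mul _, ?_⟩)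
  filter_upwards [eventually_radius] with r hr
  have h1 : ‖(r : ℂ) * ζ‖ = r := by
    rw [norm_mul, Circle.norm_coe, mul_one, Complex.norm_real, Real.norm_of_nonneg hr.1]
  have h2 : ‖(r : ℂ) * ζ - ζ‖ = 1 - r := by
    rw [← sub_one_mul, norm_mul, Circle.norm_coe, mul_one, ← Complex.ofReal_one,
      ← Complex.ofReal_sub, Complex.norm_real, Real.norm_of_nonpos (by linarith [hr.2])]
    ring
  refine ⟨h1.trans_lt hr.2, ?_⟩
  rw [h1, h2]
  linarith [hr.2]

/-- `Θ'` is bounded on the radius near `ζ`, so the mean value inequality bounds `Θ(sζ) - Θ(rζ)` by a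
multiple of `1 - r`; then `s → 1`. -/
theorem IsInner.exists_isCaratheodoryPoint {Θ : ℂ → ℂ} (hΘ : IsInner Θ) {ζ : Circle}
    (h : HasAngularDerivative Θ ζ) : ∃ a, IsCaratheodoryPoint Θ ζ a := by
  obtain ⟨a, b, ha, h1, h2⟩ := h
  refine ⟨a, hΘ, ha, h1.tendsto_radial, ‖b‖ + 1, ?_⟩
  have h3 : ∀ᶠ r : ℝ in 𝓝[<] 1, ‖deriv Θ (r * ζ)‖ ≤ ‖b‖ + 1 :=
    (h2.tendsto_radial.norm.eventually (gt_mem_nhds (lt_add_one _))).mono fun r hr => le_of_lt hr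
  obtain ⟨l, hl, hsub⟩ := mem_nhdsLT_iff_exists_Ioo_subset.mp (h3.and eventually_radius)
  filter_upwards [Ioo_mem_nhdsLT hl] with r hr
  have hder : ∀ x ∈ Set.Ioo l 1, HasDerivWithinAt (fun x : ℝ => Θ (x * ζ))
      (deriv Θ (x * ζ) * ζ) (Set.Ioo l 1) x := by
    intro x hx
    have hx' := (hsub hx).2
    have hd : HasDerivAt Θ (deriv Θ (x * ζ)) (x * ζ) :=
      (hΘ.analytic.differentiableAt (isOpen_ball.mem_nhds
        (ofReal_mul_mem_ball hx'.1 hx'.2 (Circle.norm_coe ζ).le))).hasDerivAt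
    have hi : HasDerivAt (fun x : ℝ => (x : ℂ) * ζ) ζ x := by
      simpa using (Complex.ofRealCLM.hasDerivAt (x := x)).mul_const (ζ : ℂ)
    exact (hd.comp x hi).hasDerivWithinAt
  have hlip : ∀ s ∈ Set.Ioo r 1, ‖Θ (s * ζ) - Θ (r * ζ)‖ ≤ (‖b‖ + 1) * (1 - r) := by
    intro s hs
    have := (convex_Ioo l 1).norm_image_sub_le_of_norm_hasDerivWithin_le (C := ‖b‖ + 1) hder
      (fun x hx => ?_) hr ⟨hr.1.trans hs.1, hs.2⟩
    · refine this.trans (mul_le_mul_of_nonneg_left ?_ (by positivity))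
      rw [Real.norm_of_nonneg (by linarith [hs.1])]
      linarith [hs.2]
    · rw [norm_mul, Circle.norm_coe, mul_one]
      exact (hsub hx).1
  refine le_of_tendsto (h1.tendsto_radial.sub_const _).norm ?_
  filter_upwards [Ioo_mem_nhdsLT hr.2] with s hs using hlip s hs

/-- The points `r_n ζ`, converging radially to `ζ`. -/
def radialPoint (ζ : Circle) (n : ℕ) : ℂ := radius n * ζ

theorem norm_radialPoint (ζ : Circle) (n : ℕ) : ‖radialPoint ζ n‖ = radius n := by
  rw [radialPoint, norm_mul, Circle.norm_coe, mul_one, Complex.norm_real,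
    Real.norm_of_nonneg (radius_nonneg n)]

theorem norm_radialPoint_lt (ζ : Circle) (n : ℕ) : ‖radialPoint ζ n‖ < 1 := by
  rw [norm_radialPoint]
  exact radius_lt_one n

theorem tendsto_radialPoint (ζ : Circle) : Tendsto (radialPoint ζ) atTop (𝓝 ζ) :=
  (tendsto_radius_mul ζ).comp tendsto_radius

theorem one_sub_conj_mul_circlePoint_ne_zero {ζ : Circle} {t : UnitAddCircle}
    (h : circlePoint t ≠ ζ) : 1 - conj (ζ : ℂ) * circlePoint t ≠ 0 := by
  intro h0
  apply h
  have h1 : (ζ : ℂ) * conj (ζ : ℂ) = 1 := by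
    rw [Complex.mul_conj, Complex.normSq_eq_norm_sq, Circle.norm_coe]; simp
  linear_combination (-(ζ : ℂ)) * h0 - circlePoint t * h1

theorem norm_circlePoint_sub (ζ : Circle) (t : UnitAddCircle) :
    ‖circlePoint t - ζ‖ = ‖1 - conj (ζ : ℂ) * circlePoint t‖ := by
  have h1 : conj (ζ : ℂ) * ζ = 1 := by
    rw [mul_comm, Complex.mul_conj, Complex.normSq_eq_norm_sq, Circle.norm_coe]; simp
  rw [← h1, ← mul_sub, norm_mul, RCLike.norm_conj, Circle.norm_coe, one_mul, norm_sub_rev]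

/-- The two denominators differ by at most `1 - r_n`, which is itself a lower bound for the one on
the right. -/
theorem norm_one_sub_le_two_mul (ζ : Circle) (t : UnitAddCircle) (n : ℕ) :
    ‖1 - conj (ζ : ℂ) * circlePoint t‖ ≤ 2 * ‖1 - conj (radialPoint ζ n) * circlePoint t‖ := by
  have h1 := one_sub_norm_le (w := radialPoint ζ n) (norm_circlePoint t).le
  rw [norm_radialPoint] at h1
  have h2 : 1 - conj (ζ : ℂ) * circlePoint t = (1 - conj (radialPoint ζ n) * circlePoint t)
      - ((1 - radius n : ℝ) : ℂ) * (conj (ζ : ℂ) * circlePoint t) := by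
    simp only [radialPoint, map_mul, Complex.conj_ofReal]
    push_cast
    ring
  have h3 : ‖((1 - radius n : ℝ) : ℂ) * (conj (ζ : ℂ) * circlePoint t)‖ = 1 - radius n := by
    rw [norm_mul, norm_mul, RCLike.norm_conj, Circle.norm_coe, norm_circlePoint, one_mul, mul_one,
      Complex.norm_real, Real.norm_of_nonneg (by linarith [radius_lt_one n])]
  rw [h2]
  refine (norm_sub_le _ _).trans ?_
  rw [h3]
  linarith

theorem tendsto_cauchyKernel_radialPoint {ζ : Circle} {z : ℂ} (h : 1 - conj (ζ : ℂ) * z ≠ 0) :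
    Tendsto (fun n => cauchyKernel (radialPoint ζ n) z) atTop (𝓝 (cauchyKernel ζ z)) := by
  refine tendsto_const_nhds.div (tendsto_const_nhds.sub
    (Tendsto.mul_const _ ?_)) h
  exact (Complex.continuous_conj.tendsto _).comp (tendsto_radialPoint ζ)

/-- The boundary values of the boundary kernel `k_ζ^Θ`, where `a = Θ(ζ)`. -/
def kernelTrace (Θ : ℂ → ℂ) (ζ : Circle) (a : ℂ) (t : UnitAddCircle) : ℂ :=
  (1 - conj a * boundaryFun Θ t) * cauchyKernel ζ (circlePoint t)

namespace IsCaratheodoryPoint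

variable {Θ : ℂ → ℂ} {ζ : Circle} {a : ℂ}

theorem radialLimit_eq (hC : IsCaratheodoryPoint Θ ζ a) : radialLimit Θ ζ = a :=
  hC.tendsto.limUnder_eq

theorem tendsto_radialPoint (hC : IsCaratheodoryPoint Θ ζ a) :
    Tendsto (fun n => Θ (radialPoint ζ n)) atTop (𝓝 a) := hC.tendsto.comp tendsto_radius

theorem boundaryFun_boundaryKernel (hC : IsCaratheodoryPoint Θ ζ a) :
    boundaryFun (boundaryKernel Θ ζ) =ᵐ[circleMeasure] kernelTrace Θ ζ a := by
  filter_upwards [hC.isInner.hasBoundaryValues.tendsto, ae_circlePoint_ne ζ] with t h1 h2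
  refine Tendsto.limUnder_eq ?_
  simp only [boundaryKernel, hC.radialLimit_eq, kernelTrace, cauchyKernel, mul_one_div]
  exact (tendsto_const_nhds.sub (h1.const_mul _)).div
    (tendsto_const_nhds.sub ((tendsto_radius_mul _).const_mul _))
    (one_sub_conj_mul_circlePoint_ne_zero h2)

theorem boundaryKernel_eq (hC : IsCaratheodoryPoint Θ ζ a) (z : ℂ) :
    boundaryKernel Θ ζ z = (1 - conj a * Θ z) * cauchyKernel ζ z := by
  rw [boundaryKernel, hC.radialLimit_eq, cauchyKernel, mul_one_div]

theorem tendsto_diskKernelBoundary (hC : IsCaratheodoryPoint Θ ζ a) :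
    ∀ᵐ t ∂circleMeasure, Tendsto (fun n => diskKernelBoundary Θ (radialPoint ζ n) t) atTop
      (𝓝 (kernelTrace Θ ζ a t)) := by
  filter_upwards [ae_circlePoint_ne ζ] with t h2
  refine (tendsto_const_nhds.sub (Tendsto.mul_const _ ?_)).mul
    (tendsto_cauchyKernel_radialPoint (one_sub_conj_mul_circlePoint_ne_zero h2))
  exact (Complex.continuous_conj.tendsto _).comp hC.tendsto_radialPoint

theorem exists_bound (hC : IsCaratheodoryPoint Θ ζ a) :
    ∃ C : ℝ, 0 ≤ C ∧ ∀ᶠ n in atTop, ‖a - Θ (radialPoint ζ n)‖ ≤ C * (1 - radius n) := by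
  obtain ⟨C, hb⟩ := hC.bound
  refine ⟨max C 0, le_max_right _ _, ?_⟩
  filter_upwards [tendsto_radius.eventually hb] with n hn
  exact hn.trans (mul_le_mul_of_nonneg_right (le_max_left _ _) (by linarith [radius_lt_one n]))

/-- The boundary kernel is square integrable. -/
theorem memLp_kernelTrace (hC : IsCaratheodoryPoint Θ ζ a) :
    MemLp (kernelTrace Θ ζ a) 2 circleMeasure := by
  have hΘ := hC.isInner
  obtain ⟨C, hC0, hb⟩ := hC.exists_bound
  have hm : ∀ n, MemLp (diskKernelBoundary Θ (radialPoint ζ n)) 2 circleMeasure := fun n =>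
    (hΘ.hasBoundaryValues_diskKernel (norm_radialPoint_lt ζ n)).memLp 2
  refine ⟨aestronglyMeasurable_of_tendsto_ae atTop (fun n => (hm n).aestronglyMeasurable)
    hC.tendsto_diskKernelBoundary, ?_⟩
  -- Fatou's lemma: `‖k_u‖² = (1 - |Θ(u)|²) / (1 - |u|²)` stays below `2C` along the radius, because
  -- `1 - |Θ(u)| ≤ |a - Θ(u)| ≤ C (1 - |u|)`.
  refine (Lp.eLpNorm_lim_le_liminf_eLpNorm (fun n => (hm n).aestronglyMeasurable) _
    hC.tendsto_diskKernelBoundary).trans_lt ?_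
  refine lt_of_le_of_lt (b := ENNReal.ofReal ((2 * C) ^ (2⁻¹ : ℝ))) ?_ ENNReal.ofReal_lt_top
  refine (liminf_le_liminf (v := fun _ => ENNReal.ofReal ((2 * C) ^ (2⁻¹ : ℝ))) ?_).trans
    (liminf_const _).le
  filter_upwards [hb] with n hn
  have hr1 := radius_lt_one n
  have hr0 := radius_nonneg n
  rw [(hm n).eLpNorm_eq_integral_rpow_norm two_ne_zero ENNReal.ofNat_ne_top]
  simp only [ENNReal.toReal_ofNat, Real.rpow_ofNat]
  rw [hΘ.integral_norm_sq_diskKernel (norm_radialPoint_lt ζ n), norm_radialPoint]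
  have h1 := hΘ.norm_le_one (norm_radialPoint_lt ζ n)
  have h2 : 1 - ‖Θ (radialPoint ζ n)‖ ≤ C * (1 - radius n) := by
    have := norm_sub_norm_le a (Θ (radialPoint ζ n))
    rw [hC.norm_eq_one] at this
    exact this.trans hn
  have h3 : 0 ≤ ‖Θ (radialPoint ζ n)‖ := norm_nonneg _
  refine ENNReal.ofReal_le_ofReal (Real.rpow_le_rpow ?_ ?_ (by norm_num))
  · exact div_nonneg (by nlinarith) (by nlinarith)
  · rw [div_le_iff₀ (by nlinarith)]
    have h4 : 1 - ‖Θ (radialPoint ζ n)‖ ^ 2 ≤ 2 * (1 - ‖Θ (radialPoint ζ n)‖) := by nlinarith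
    have h5 : C * (1 - radius n) ≤ C * (1 - radius n ^ 2) :=
      mul_le_mul_of_nonneg_left (by nlinarith) hC0
    linarith

/-- The numerators differ by at most `C (1 - r_n)`, which the denominator absorbs into the constant
`C`. Changing the denominator costs the factor `2` of `norm_one_sub_le_two_mul`. -/
theorem exists_diskKernelBoundary_le (hC : IsCaratheodoryPoint Θ ζ a) :
    ∃ C : ℝ, ∀ᶠ n in atTop, ∀ᵐ t ∂circleMeasure,
      ‖diskKernelBoundary Θ (radialPoint ζ n) t‖ ≤ 2 * ‖kernelTrace Θ ζ a t‖ + C := by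
  obtain ⟨C, hC0, hb⟩ := hC.exists_bound
  refine ⟨C, ?_⟩
  filter_upwards [hb] with n hn
  filter_upwards [ae_circlePoint_ne ζ, hC.isInner.norm_boundaryFun] with t h1 h2
  have hr1 := radius_lt_one n
  set d := ‖1 - conj (radialPoint ζ n) * circlePoint t‖ with hd
  set D := ‖1 - conj (ζ : ℂ) * circlePoint t‖ with hD
  have hd0 : 1 - radius n ≤ d := by
    have := one_sub_norm_le (w := radialPoint ζ n) (norm_circlePoint t).le
    rwa [norm_radialPoint] at this
  have hdpos : 0 < d := by linarith
  have hDpos : 0 < D := norm_pos_iff.mpr (one_sub_conj_mul_circlePoint_ne_zero h1)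
  have hDd : D ≤ 2 * d := norm_one_sub_le_two_mul ζ t n
  have e1 : ‖diskKernelBoundary Θ (radialPoint ζ n) t‖ =
      ‖1 - conj (Θ (radialPoint ζ n)) * boundaryFun Θ t‖ / d := by
    rw [diskKernelBoundary, cauchyKernel, mul_one_div, norm_div]
  have e2 : ‖kernelTrace Θ ζ a t‖ = ‖1 - conj a * boundaryFun Θ t‖ / D := by
    rw [kernelTrace, cauchyKernel, mul_one_div, norm_div]
  have e3 : ‖1 - conj (Θ (radialPoint ζ n)) * boundaryFun Θ t‖ ≤
      ‖1 - conj a * boundaryFun Θ t‖ + C * (1 - radius n) := by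
    have : 1 - conj (Θ (radialPoint ζ n)) * boundaryFun Θ t = (1 - conj a * boundaryFun Θ t)
        + conj (a - Θ (radialPoint ζ n)) * boundaryFun Θ t := by
      rw [map_sub]; ring
    rw [this]
    refine (norm_add_le _ _).trans (add_le_add le_rfl ?_)
    rw [norm_mul, RCLike.norm_conj, h2, mul_one]
    exact hn
  rw [e1, e2, div_le_iff₀ hdpos]
  refine e3.trans ?_
  have h5 : ‖1 - conj a * boundaryFun Θ t‖ ≤
      2 * (‖1 - conj a * boundaryFun Θ t‖ / D) * d := by
    rw [mul_assoc, div_mul_eq_mul_div, mul_div_assoc', le_div_iff₀ hDpos]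
    nlinarith [norm_nonneg (1 - conj a * boundaryFun Θ t)]
  nlinarith [mul_le_mul_of_nonneg_left hd0 hC0]

/-- Dominated convergence. Through this limit, identities for the kernels `k_u` in the disk pass to
`k_ζ`. -/
theorem tendsto_integral_diskKernel_mul (hC : IsCaratheodoryPoint Θ ζ a) {v : UnitAddCircle → ℂ}
    (hv : MemLp v ∞ circleMeasure) :
    Tendsto (fun n => ∫ t, diskKernelBoundary Θ (radialPoint ζ n) t * v t ∂circleMeasure) atTop
      (𝓝 (∫ t, kernelTrace Θ ζ a t * v t ∂circleMeasure)) := by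
  obtain ⟨C, hb⟩ := hC.exists_diskKernelBoundary_le
  have hk := hC.memLp_kernelTrace
  refine tendsto_integral_filter_of_dominated_convergence
    (fun t => (2 * ‖kernelTrace Θ ζ a t‖ + C) * (eLpNorm v ∞ circleMeasure).toReal)
    (Eventually.of_forall fun n => ?_) ?_ ?_ ?_
  · exact (hC.isInner.hasBoundaryValues_diskKernel
      (norm_radialPoint_lt ζ n)).aestronglyMeasurable.mul hv.aestronglyMeasurable
  · filter_upwards [hb] with n hn
    filter_upwards [hn, ae_norm_le_toReal_eLpNorm_top hv] with t h1 h2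
    rw [norm_mul]
    exact mul_le_mul h1 h2 (norm_nonneg _) ((norm_nonneg _).trans h1)
  · exact ((((hk.mono_exponent (by norm_num)).integrable le_rfl).norm.const_mul 2).add
      (integrable_const C)).mul_const _
  · filter_upwards [hC.tendsto_diskKernelBoundary] with t ht using ht.mul_const _

/-- The boundary kernel, as an element of `L²`. -/
def kernelLp (hC : IsCaratheodoryPoint Θ ζ a) : L2 := hC.memLp_kernelTrace.toLp _

theorem coeFn_kernelLp (hC : IsCaratheodoryPoint Θ ζ a) :
    (hC.kernelLp : UnitAddCircle → ℂ) =ᵐ[circleMeasure] kernelTrace Θ ζ a := MemLp.coeFn_toLp _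

theorem kernelLp_mem (hC : IsCaratheodoryPoint Θ ζ a) : hC.kernelLp ∈ modelSpace Θ := by
  have hΘ := hC.isInner
  have hmem := fun n => hΘ.diskKernelLp_mem (norm_radialPoint_lt ζ n)
  rw [hΘ.mem_modelSpace_iff]
  constructor
  · rw [kernelLp, toLp_mem_hardy_iff]
    intro m
    refine tendsto_nhds_unique
      (hC.tendsto_integral_diskKernel_mul (memLp_circlePoint_pow (m + 1) ∞)) ?_
    refine tendsto_const_nhds.congr fun n => ?_
    exact ((toLp_mem_hardy_iff _).mp (Submodule.mem_inf.mp (hmem n)).1 m).symm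
  · intro m
    have hv := memLp_conj (hΘ.hasBoundaryValues.mul (HasBoundaryValues.pow_id m)).memLp_top
    have h1 : ∫ t, kernelTrace Θ ζ a t * conj (boundaryFun Θ t * circlePoint t ^ m)
        ∂circleMeasure = 0 := by
      refine tendsto_nhds_unique (hC.tendsto_integral_diskKernel_mul hv) ?_
      refine tendsto_const_nhds.congr fun n => ?_
      rw [← ((hΘ.mem_modelSpace_iff _).mp (hmem n)).2 m]
      refine integral_congr_ae ?_
      filter_upwards [hΘ.coeFn_diskKernelLp (norm_radialPoint_lt ζ n)] with t ht
      rw [ht]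
    rw [← h1]
    refine integral_congr_ae ?_
    filter_upwards [hC.coeFn_kernelLp] with t ht
    rw [ht]

theorem tendsto_diskKernel (hC : IsCaratheodoryPoint Θ ζ a) {w : ℂ} (hw : ‖w‖ < 1) :
    Tendsto (fun n => diskKernel Θ (radialPoint ζ n) w) atTop (𝓝 (boundaryKernel Θ ζ w)) := by
  rw [hC.boundaryKernel_eq]
  refine (tendsto_const_nhds.sub (Tendsto.mul_const _ ?_)).mul
    (tendsto_cauchyKernel_radialPoint ?_)
  · exact (Complex.continuous_conj.tendsto _).comp hC.tendsto_radialPoint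
  · have h := one_sub_conj_mul_ne_zero hw (Circle.norm_coe ζ).le
    intro h0
    apply h
    simpa [mul_comm] using congrArg conj h0

theorem integral_mul_conj_cauchyKernel (hC : IsCaratheodoryPoint Θ ζ a) {w : ℂ} (hw : ‖w‖ < 1) :
    ∫ t, kernelTrace Θ ζ a t * conj (cauchyKernel w (circlePoint t)) ∂circleMeasure =
      boundaryKernel Θ ζ w := by
  refine tendsto_nhds_unique (hC.tendsto_integral_diskKernel_mul
    (memLp_conj (HasBoundaryValues.cauchy hw).memLp_top)) ?_
  refine (hC.tendsto_diskKernel hw).congr fun n => ?_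
  exact ((hC.isInner.hasBoundaryValues_diskKernel
    (norm_radialPoint_lt ζ n)).integral_mul_conj_cauchyKernel hw).symm

theorem integral_mul_diskPoissonKernel (hC : IsCaratheodoryPoint Θ ζ a) {w : ℂ} (hw : ‖w‖ < 1) :
    ∫ t, kernelTrace Θ ζ a t * diskPoissonKernel w t ∂circleMeasure = boundaryKernel Θ ζ w := by
  refine tendsto_nhds_unique (hC.tendsto_integral_diskKernel_mul (memLp_diskPoissonKernel hw)) ?_
  refine (hC.tendsto_diskKernel hw).congr fun n => ?_
  exact ((hC.isInner.hasBoundaryValues_diskKernel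
    (norm_radialPoint_lt ζ n)).integral_mul_diskPoissonKernel hw).symm

theorem inner_diskKernelLp_kernelLp (hC : IsCaratheodoryPoint Θ ζ a) {w : ℂ} (hw : ‖w‖ < 1) :
    inner ℂ (hC.isInner.diskKernelLp hw) hC.kernelLp = boundaryKernel Θ ζ w := by
  rw [hC.isInner.inner_diskKernelLp hw hC.kernelLp_mem, ← hC.integral_mul_conj_cauchyKernel hw]
  refine integral_congr_ae ?_
  filter_upwards [hC.coeFn_kernelLp] with t ht
  rw [ht]

end IsCaratheodoryPoint

/-! ### Sarason's symbol as a radial limit -/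

/-- Writing `d` for the distance of `conj(r_n ζ) z` from `1`, one has `|z - ζ| ≤ 2d` and `1 - r_n ≤
d`. So a factor that is Lipschitz at `ζ` and vanishes there keeps the Poisson integrands uniformly
bounded. -/
theorem norm_sub_mul_diskPoissonKernel_le (ζ : Circle) (t : UnitAddCircle) (n : ℕ) :
    ‖circlePoint t - ζ‖ * diskPoissonKernel (radialPoint ζ n) t ≤ 4 := by
  have hr0 := radius_nonneg n
  have hr1 := radius_lt_one n
  have h1 := one_sub_norm_le (w := radialPoint ζ n) (norm_circlePoint t).le
  rw [norm_radialPoint] at h1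
  have h2 := norm_one_sub_le_two_mul ζ t n
  rw [norm_circlePoint_sub, diskPoissonKernel, norm_radialPoint, cauchyKernel, norm_div, norm_one]
  set d := ‖1 - conj (radialPoint ζ n) * circlePoint t‖
  have hd : 0 < d := by linarith
  calc ‖1 - conj (ζ : ℂ) * circlePoint t‖ * ((1 - radius n ^ 2) * (1 / d) ^ 2)
      ≤ (2 * d) * ((1 - radius n ^ 2) * (1 / d) ^ 2) :=
        mul_le_mul_of_nonneg_right h2 (mul_nonneg (by nlinarith) (by positivity))
    _ = 2 * (1 + radius n) * (1 - radius n) / d := by field_simp; ring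
    _ ≤ 4 := by
        rw [div_le_iff₀ hd]
        nlinarith

theorem tendsto_diskPoissonKernel_radialPoint {ζ : Circle} {t : UnitAddCircle}
    (h : circlePoint t ≠ ζ) :
    Tendsto (fun n => diskPoissonKernel (radialPoint ζ n) t) atTop (𝓝 0) := by
  have h1 : Tendsto (fun n => 1 - ‖radialPoint ζ n‖ ^ 2) atTop (𝓝 (1 - ‖(ζ : ℂ)‖ ^ 2)) :=
    tendsto_const_nhds.sub ((tendsto_radialPoint ζ).norm.pow 2)
  have h2 := (tendsto_cauchyKernel_radialPoint
    (one_sub_conj_mul_circlePoint_ne_zero h)).norm.pow 2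
  have h3 := h1.mul h2
  rw [Circle.norm_coe] at h3
  simpa [diskPoissonKernel] using h3

/-- Radial limits at `ζ` of Poisson integrals of `g h`, where `g` has a bounded analytic extension
with a radial limit at `ζ` and `h` is Lipschitz at `ζ`. -/
theorem HasBoundaryValues.tendsto_integral_mul_diskPoissonKernel {G : ℂ → ℂ}
    {g : UnitAddCircle → ℂ} (hG : HasBoundaryValues G g) {ζ : Circle} {a : ℂ}
    (ha : Tendsto (fun n => G (radialPoint ζ n)) atTop (𝓝 a)) {h : UnitAddCircle → ℂ}
    (hc : Continuous h) {h₀ : ℂ} {K : ℝ} (hK : ∀ t, ‖h t - h₀‖ ≤ K * ‖circlePoint t - ζ‖) :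
    Tendsto (fun n => ∫ t, g t * h t * diskPoissonKernel (radialPoint ζ n) t ∂circleMeasure) atTop
      (𝓝 (a * h₀)) := by
  set B := (eLpNorm g ∞ circleMeasure).toReal
  have hB := ae_norm_le_toReal_eLpNorm_top hG.memLp_top
  have hmeas : ∀ n, AEStronglyMeasurable (fun t => g t * (h t - h₀) *
      (diskPoissonKernel (radialPoint ζ n) t : ℂ)) circleMeasure := fun n =>
    (hG.aestronglyMeasurable.mul (hc.sub continuous_const).aestronglyMeasurable).mul
      (memLp_diskPoissonKernel (norm_radialPoint_lt ζ n)).aestronglyMeasurable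
  have hbd : ∀ n, ∀ᵐ t ∂circleMeasure, ‖g t * (h t - h₀) *
      (diskPoissonKernel (radialPoint ζ n) t : ℂ)‖ ≤ B * (|K| * 4) := by
    intro n
    filter_upwards [hB] with t ht
    have hP := diskPoissonKernel_nonneg (norm_radialPoint_lt ζ n) t
    rw [mul_assoc, norm_mul, norm_mul, Complex.norm_real, Real.norm_of_nonneg hP]
    refine mul_le_mul ht ?_ (mul_nonneg (norm_nonneg _) hP) ENNReal.toReal_nonneg
    calc ‖h t - h₀‖ * diskPoissonKernel (radialPoint ζ n) t
        ≤ (|K| * ‖circlePoint t - ζ‖) * diskPoissonKernel (radialPoint ζ n) t :=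
          mul_le_mul_of_nonneg_right ((hK t).trans
            (mul_le_mul_of_nonneg_right (le_abs_self K) (norm_nonneg _))) hP
      _ = |K| * (‖circlePoint t - ζ‖ * diskPoissonKernel (radialPoint ζ n) t) := by ring
      _ ≤ |K| * 4 := mul_le_mul_of_nonneg_left
          (norm_sub_mul_diskPoissonKernel_le ζ t n) (abs_nonneg K)
  -- Split `g h = g (h - h₀) + h₀ g`. The first part tends to zero by dominated convergence. The
  -- second is exactly `h₀ G(r_n ζ)`, so no continuity of `g` at `ζ` is needed.
  have h1 : Tendsto (fun n => ∫ t, g t * (h t - h₀) *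
      (diskPoissonKernel (radialPoint ζ n) t : ℂ) ∂circleMeasure) atTop (𝓝 0) := by
    have := tendsto_integral_of_dominated_convergence (μ := circleMeasure) (f := fun _ => (0 : ℂ))
      (fun _ => B * (|K| * 4)) hmeas (integrable_const _) hbd ?_
    · simpa using this
    · filter_upwards [ae_circlePoint_ne ζ] with t ht
      have h2 := (Complex.continuous_ofReal.tendsto _).comp
        (tendsto_diskPoissonKernel_radialPoint ht)
      have h3 := h2.const_mul (g t * (h t - h₀))
      simpa using h3
  have h4 := h1.add (ha.mul_const h₀)
  rw [zero_add] at h4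
  refine h4.congr fun n => ?_
  have hw := norm_radialPoint_lt ζ n
  have i1 : Integrable (fun t => g t * (h t - h₀) *
      (diskPoissonKernel (radialPoint ζ n) t : ℂ)) circleMeasure :=
    (integrable_const (B * (|K| * 4))).mono' (hmeas n) (hbd n)
  have i2 : Integrable (fun t => g t * (diskPoissonKernel (radialPoint ζ n) t : ℂ)) circleMeasure :=
    (memLp_mul_of_top hG.memLp_top
      ((memLp_diskPoissonKernel hw).mono_exponent le_top)).integrable le_rfl
  rw [← hG.integral_mul_diskPoissonKernel hw, ← integral_mul_const,
    ← integral_add i1 (i2.mul_const _)]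
  refine integral_congr_ae (Eventually.of_forall fun t => ?_)
  ring

theorem norm_cauchyKernel_sub_le {w : ℂ} (hw : ‖w‖ < 1) (ζ : Circle) (t : UnitAddCircle) :
    ‖cauchyKernel w (circlePoint t) - cauchyKernel w ζ‖ ≤
      (1 / (1 - ‖w‖)) ^ 2 * ‖circlePoint t - ζ‖ := by
  have hz := norm_cauchyKernel_le hw (norm_circlePoint t).le
  have hζ := norm_cauchyKernel_le hw (Circle.norm_coe ζ).le
  have h0 := one_sub_conj_mul_ne_zero hw (norm_circlePoint t).le
  have h1 := one_sub_conj_mul_ne_zero hw (Circle.norm_coe ζ).le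
  have e : cauchyKernel w (circlePoint t) - cauchyKernel w ζ =
      cauchyKernel w (circlePoint t) * cauchyKernel w ζ * (conj w * (circlePoint t - ζ)) := by
    simp only [cauchyKernel]
    field_simp
    ring
  have hp : 0 < 1 - ‖w‖ := by linarith
  rw [e, norm_mul, norm_mul, norm_mul, RCLike.norm_conj, pow_two]
  have : ‖w‖ * ‖circlePoint t - ζ‖ ≤ ‖circlePoint t - ζ‖ := by
    nlinarith [norm_nonneg (circlePoint t - ζ)]
  exact mul_le_mul (mul_le_mul hz hζ (norm_nonneg _) (by positivity)) this (by positivity)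
    (by positivity)

theorem norm_cauchyKernel_mul_conj_sub_le {v w : ℂ} (hv : ‖v‖ < 1) (hw : ‖w‖ < 1) (ζ : Circle) :
    ∃ K : ℝ, ∀ t : UnitAddCircle, ‖cauchyKernel v (circlePoint t) *
      conj (cauchyKernel w (circlePoint t)) - cauchyKernel v ζ * conj (cauchyKernel w ζ)‖ ≤
        K * ‖circlePoint t - ζ‖ := by
  refine ⟨1 / (1 - ‖v‖) * (1 / (1 - ‖w‖)) ^ 2 + (1 / (1 - ‖v‖)) ^ 2 * (1 / (1 - ‖w‖)),
    fun t => ?_⟩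
  have e : cauchyKernel v (circlePoint t) * conj (cauchyKernel w (circlePoint t))
      - cauchyKernel v ζ * conj (cauchyKernel w ζ) =
      cauchyKernel v (circlePoint t) * conj (cauchyKernel w (circlePoint t) - cauchyKernel w ζ)
      + (cauchyKernel v (circlePoint t) - cauchyKernel v ζ) * conj (cauchyKernel w ζ) := by
    rw [map_sub]; ring
  have hv' : 0 < 1 - ‖v‖ := by linarith
  have hw' : 0 < 1 - ‖w‖ := by linarith
  rw [e, add_mul]
  refine (norm_add_le _ _).trans (add_le_add ?_ ?_)
  · rw [norm_mul, RCLike.norm_conj, mul_assoc]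
    exact mul_le_mul (norm_cauchyKernel_le hv (norm_circlePoint t).le)
      (norm_cauchyKernel_sub_le hw ζ t) (norm_nonneg _) (by positivity)
  · rw [norm_mul, RCLike.norm_conj, mul_right_comm]
    exact mul_le_mul (norm_cauchyKernel_sub_le hv ζ t)
      (norm_cauchyKernel_le hw (Circle.norm_coe ζ).le) (norm_nonneg _) (by positivity)

/-- On the circle `Θ conj(k_w) = (Θ - Θ(w)) conj(c_w)`, so the integral is Cauchy's formula at `w`
for an analytic function vanishing at `w`. -/
theorem IsInner.integral_diskKernel_mul_conj_mul (hΘ : IsInner Θ) {v w u : ℂ} (hv : ‖v‖ < 1)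
    (hw : ‖w‖ < 1) (hu : ‖u‖ < 1) :
    ∫ t, diskKernelBoundary Θ v t * conj (diskKernelBoundary Θ w t) *
      (boundaryFun Θ t * cauchyKernel u (circlePoint t)) ∂circleMeasure = 0 := by
  have h := (((hΘ.hasBoundaryValues_diskKernel hv).mul (HasBoundaryValues.cauchy hu)).mul
    (hΘ.hasBoundaryValues.sub (HasBoundaryValues.const (Θ w)))).integral_mul_conj_cauchyKernel hw
  rw [sub_self, mul_zero] at h
  rw [← h]
  refine integral_congr_ae ?_
  filter_upwards [hΘ.boundaryFun_mul_conj] with t ht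
  simp only [diskKernelBoundary, map_mul, map_sub, map_one, Complex.conj_conj]
  linear_combination (-((1 - conj (Θ v) * boundaryFun Θ t) * cauchyKernel v (circlePoint t) * Θ w *
    conj (cauchyKernel w (circlePoint t)) * cauchyKernel u (circlePoint t))) * ht

namespace IsInner

variable {Θ : ℂ → ℂ}

theorem memLp_diskKernel_mul_conj (hΘ : IsInner Θ) {v w : ℂ} (hv : ‖v‖ < 1) (hw : ‖w‖ < 1) :
    MemLp (fun t => diskKernelBoundary Θ v t * conj (diskKernelBoundary Θ w t)) ∞ circleMeasure :=
  memLp_mul_of_top (hΘ.hasBoundaryValues_diskKernel hv).memLp_top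
    (memLp_conj (hΘ.hasBoundaryValues_diskKernel hw).memLp_top)

/-- On products `k_v conj(k_w)`, the symbol `k_u + conj(k_u) - 1` acts as the Poisson kernel. -/
theorem integral_diskKernel_mul_conj_mul_symbol (hΘ : IsInner Θ) {v w u : ℂ} (hv : ‖v‖ < 1)
    (hw : ‖w‖ < 1) (hu : ‖u‖ < 1) :
    ∫ t, diskKernelBoundary Θ v t * conj (diskKernelBoundary Θ w t) *
      (diskKernelBoundary Θ u t + conj (diskKernelBoundary Θ u t) - 1) ∂circleMeasure =
    ∫ t, diskKernelBoundary Θ v t * conj (diskKernelBoundary Θ w t) *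
      diskPoissonKernel u t ∂circleMeasure := by
  -- The symbol minus the Poisson kernel is `-conj(Θ(u)) Θ c_u - Θ(u) conj(Θ c_u)`. The first term
  -- integrates to zero by `h1`, the second by the conjugate statement with `v` and `w` exchanged.
  have h1 := hΘ.integral_diskKernel_mul_conj_mul hv hw hu
  have h2 := congrArg conj (hΘ.integral_diskKernel_mul_conj_mul hw hv hu)
  rw [← integral_conj_circle, map_zero] at h2
  have m1 := hΘ.memLp_diskKernel_mul_conj hv hw
  have m2 := hΘ.memLp_diskKernel_mul_conj hw hv
  have mu := (hΘ.hasBoundaryValues.mul (HasBoundaryValues.cauchy hu)).memLp 1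
  have i1 := (memLp_mul_of_top m1 mu).integrable le_rfl
  have i2 := (memLp_conj (memLp_mul_of_top m2 mu)).integrable le_rfl
  have i3 := (memLp_mul_of_top m1
    ((memLp_diskPoissonKernel hu).mono_exponent (p := 1) le_top)).integrable le_rfl
  rw [← sub_zero (∫ t, diskKernelBoundary Θ v t * conj (diskKernelBoundary Θ w t) *
    diskPoissonKernel u t ∂circleMeasure), ← mul_zero (conj (Θ u)), ← h1, ← integral_const_mul,
    ← integral_sub i3 (i1.const_mul _), ← sub_zero (∫ t, (_ - _) ∂circleMeasure),
    ← mul_zero (Θ u), ← h2, ← integral_const_mul,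
    ← integral_sub (i3.sub' (i1.const_mul _)) (i2.const_mul _)]
  refine integral_congr_ae (Eventually.of_forall fun t => ?_)
  simp only [diskPoissonKernel_eq hu]
  simp only [diskKernelBoundary, map_mul, map_sub, map_one, Complex.conj_conj]
  ring

end IsInner

namespace IsCaratheodoryPoint

variable {Θ : ℂ → ℂ} {ζ : Circle} {a : ℂ}

/-- With `h = c_v conj(c_w)` and `|Θ| = 1`, the product `k_v conj(k_w)` is a combination of `h`, `Θ
h` and `conj(Θ) h`. Their Poisson integrals converge separately, and `a conj(a) = 1` reassembles the
limits into a product. -/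
theorem tendsto_integral_diskKernel_mul_conj (hC : IsCaratheodoryPoint Θ ζ a) {v w : ℂ}
    (hv : ‖v‖ < 1) (hw : ‖w‖ < 1) :
    Tendsto (fun n => ∫ t, diskKernelBoundary Θ v t * conj (diskKernelBoundary Θ w t) *
      diskPoissonKernel (radialPoint ζ n) t ∂circleMeasure) atTop
      (𝓝 (conj (boundaryKernel Θ ζ v) * boundaryKernel Θ ζ w)) := by
  have hΘ := hC.isInner
  set h : UnitAddCircle → ℂ := fun t =>
    cauchyKernel v (circlePoint t) * conj (cauchyKernel w (circlePoint t)) with hh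
  set h₀ : ℂ := cauchyKernel v ζ * conj (cauchyKernel w ζ) with hh₀
  have hhc : Continuous h := (continuous_cauchyKernel_circlePoint hv).mul
    (Complex.continuous_conj.comp (continuous_cauchyKernel_circlePoint hw))
  obtain ⟨K, hK⟩ := norm_cauchyKernel_mul_conj_sub_le hv hw ζ
  have hK' : ∀ t, ‖conj (h t) - conj h₀‖ ≤ K * ‖circlePoint t - ζ‖ := fun t => by
    rw [← map_sub, RCLike.norm_conj]
    exact hK t
  have l1 := (HasBoundaryValues.const 1).tendsto_integral_mul_diskPoissonKernel (ζ := ζ)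
    tendsto_const_nhds hhc hK
  have l2 := hΘ.hasBoundaryValues.tendsto_integral_mul_diskPoissonKernel
    hC.tendsto_radialPoint hhc hK
  -- `conj(Θ)` has no analytic extension, so the limit is taken for `Θ conj(h)` and conjugated.
  have l3 := (Complex.continuous_conj.tendsto _).comp
    (hΘ.hasBoundaryValues.tendsto_integral_mul_diskPoissonKernel
    hC.tendsto_radialPoint (Complex.continuous_conj.comp hhc) hK')
  have l4 := ((l1.const_mul (1 + conj (Θ v) * Θ w)).sub (l2.const_mul (conj (Θ v)))).sub
    (l3.const_mul (Θ w))
  have e : (1 + conj (Θ v) * Θ w) * (1 * h₀) - conj (Θ v) * (a * h₀)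
      - Θ w * conj (a * conj h₀) = conj (boundaryKernel Θ ζ v) * boundaryKernel Θ ζ w := by
    have ha : a * conj a = 1 := by
      rw [Complex.mul_conj, Complex.normSq_eq_norm_sq, hC.norm_eq_one]; simp
    rw [hC.boundaryKernel_eq, hC.boundaryKernel_eq, hh₀]
    simp only [map_mul, map_sub, map_one, Complex.conj_conj, cauchyKernel_conj_symm]
    linear_combination (-(conj (Θ v) * Θ w * cauchyKernel v ζ * cauchyKernel ζ w)) * ha
  rw [e] at l4
  refine l4.congr fun n => ?_
  have hP := memLp_diskPoissonKernel (norm_radialPoint_lt ζ n)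
  have mh : MemLp h ∞ circleMeasure := memLp_mul_of_top (HasBoundaryValues.cauchy hv).memLp_top
    (memLp_conj (HasBoundaryValues.cauchy hw).memLp_top)
  have mP := hP.mono_exponent (p := 1) le_top
  have i1 := (memLp_mul_of_top (memLp_mul_of_top
    (HasBoundaryValues.const 1).memLp_top mh) mP).integrable le_rfl
  have i2 := (memLp_mul_of_top (memLp_mul_of_top
    hΘ.hasBoundaryValues.memLp_top mh) mP).integrable le_rfl
  have i3 := (memLp_conj (memLp_mul_of_top (memLp_mul_of_top
    hΘ.hasBoundaryValues.memLp_top (memLp_conj mh)) mP)).integrable le_rfl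
  simp only [Function.comp_apply]
  rw [← integral_conj_circle, ← integral_const_mul, ← integral_const_mul, ← integral_const_mul,
    ← integral_sub (i1.const_mul _) (i2.const_mul _),
    ← integral_sub ((i1.const_mul _).sub' (i2.const_mul _)) (i3.const_mul _)]
  refine integral_congr_ae ?_
  filter_upwards [hΘ.boundaryFun_mul_conj] with t ht
  simp only [diskKernelBoundary, hh, map_mul, map_sub, map_one, Complex.conj_conj,
    Complex.conj_ofReal]
  linear_combination (-(conj (Θ v) * Θ w * cauchyKernel v (circlePoint t) *
    conj (cauchyKernel w (circlePoint t)) * diskPoissonKernel (radialPoint ζ n) t)) * ht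

/-- Sarason's symbol `k_ζ + conj(k_ζ) - 1`. -/
theorem integral_diskKernel_mul_conj_mul_symbol (hC : IsCaratheodoryPoint Θ ζ a) {v w : ℂ}
    (hv : ‖v‖ < 1) (hw : ‖w‖ < 1) :
    ∫ t, diskKernelBoundary Θ v t * conj (diskKernelBoundary Θ w t) *
      (kernelTrace Θ ζ a t + conj (kernelTrace Θ ζ a t) - 1) ∂circleMeasure =
    conj (boundaryKernel Θ ζ v) * boundaryKernel Θ ζ w := by
  have hΘ := hC.isInner
  -- The identity at `u = r_n ζ` equates the Poisson integrals with pairings against the symbol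
  -- built from `k_u`. Those pairings converge to the one with `k_ζ`.
  refine tendsto_nhds_unique ?_ (hC.tendsto_integral_diskKernel_mul_conj hv hw)
  set F : UnitAddCircle → ℂ :=
    fun t => diskKernelBoundary Θ v t * conj (diskKernelBoundary Θ w t) with hF
  have mF : MemLp F ∞ circleMeasure := hΘ.memLp_diskKernel_mul_conj hv hw
  have split : ∀ {κ : UnitAddCircle → ℂ}, MemLp κ 2 circleMeasure →
      ∫ t, F t * (κ t + conj (κ t) - 1) ∂circleMeasure = ∫ t, κ t * F t ∂circleMeasure
        + conj (∫ t, κ t * conj (F t) ∂circleMeasure) - ∫ t, F t ∂circleMeasure := by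
    intro κ hκ
    have i1 := (memLp_mul_of_top mF (hκ.mono_exponent (p := 1) (by norm_num))).integrable le_rfl
    have i2 := (memLp_mul_of_top mF
      (memLp_conj (hκ.mono_exponent (p := 1) (by norm_num)))).integrable le_rfl
    have i3 : Integrable F circleMeasure := mF.integrable le_top
    rw [← integral_conj_circle]
    have i1' : Integrable (fun t => κ t * F t) circleMeasure :=
      i1.congr (Eventually.of_forall fun t => mul_comm _ _)
    have i2' : Integrable (fun t => conj (κ t * conj (F t))) circleMeasure :=
      i2.congr (Eventually.of_forall fun t => by simp [mul_comm])
    rw [← integral_add i1' i2', ← integral_sub (i1'.fun_add i2') i3]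
    refine integral_congr_ae (Eventually.of_forall fun t => ?_)
    simp only [map_mul, Complex.conj_conj]
    ring
  rw [split hC.memLp_kernelTrace]
  have h1 := hC.tendsto_integral_diskKernel_mul mF
  have h2 := (Complex.continuous_conj.tendsto _).comp
    (hC.tendsto_integral_diskKernel_mul (memLp_conj mF))
  refine ((h1.add h2).sub_const (∫ t, F t ∂circleMeasure)).congr fun n => ?_
  have hn := norm_radialPoint_lt ζ n
  rw [← hΘ.integral_diskKernel_mul_conj_mul_symbol hv hw hn,
    split ((hΘ.hasBoundaryValues_diskKernel hn).memLp 2)]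
  rfl

end IsCaratheodoryPoint

/-! ### The operator `k_ζ ⊗ k_ζ` and the equivalence in (a) -/

theorem coeFn_mulBounded (Θ : ℂ → ℂ) (φ : L2) (f : boundedPart Θ) :
    (mulBounded Θ φ f : UnitAddCircle → ℂ) =ᵐ[circleMeasure]
      fun t => φ t * ((f : modelSpace Θ) : L2) t := MemLp.coeFn_toLp _

theorem inner_truncatedToeplitz (Θ : ℂ → ℂ) (φ : L2) (f : boundedPart Θ) (g : modelSpace Θ) :
    inner ℂ g ((modelSpace Θ).orthogonalProjectionOnto (mulBounded Θ φ f)) =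
      ∫ t, φ t * ((f : modelSpace Θ) : L2) t * conj ((g : L2) t) ∂circleMeasure := by
  rw [Submodule.inner_orthogonalProjectionOnto_eq_of_mem_left, L2_inner_eq_integral]
  refine integral_congr_ae ?_
  filter_upwards [coeFn_mulBounded Θ φ f] with t ht
  rw [ht]

theorem inner_smul_modelSpace {Θ : ℂ → ℂ} (g x : modelSpace Θ) (c : ℂ) :
    inner ℂ g (c • x) = c * inner ℂ g x := inner_smul_right g x c

namespace IsInner

variable {Θ : ℂ → ℂ}

/-- The reproducing kernel of `K_Θ` at `w`, as a bounded element of `K_Θ`. -/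
def boundedKernel (hΘ : IsInner Θ) {w : ℂ} (hw : ‖w‖ < 1) : boundedPart Θ :=
  ⟨⟨hΘ.diskKernelLp hw, hΘ.diskKernelLp_mem hw⟩,
    (hΘ.hasBoundaryValues_diskKernel hw).memLp_top.ae_eq (hΘ.coeFn_diskKernelLp hw).symm⟩

theorem coeFn_boundedKernel (hΘ : IsInner Θ) {w : ℂ} (hw : ‖w‖ < 1) :
    (((hΘ.boundedKernel hw : modelSpace Θ) : L2) : UnitAddCircle → ℂ) =ᵐ[circleMeasure]
      diskKernelBoundary Θ w := hΘ.coeFn_diskKernelLp hw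

theorem ext_inner_boundedKernel (hΘ : IsInner Θ) {x y : modelSpace Θ}
    (h : ∀ (w : ℂ) (hw : ‖w‖ < 1), inner ℂ (hΘ.boundedKernel hw : modelSpace Θ) x =
      inner ℂ (hΘ.boundedKernel hw : modelSpace Θ) y) : x = y := by
  rw [← sub_eq_zero]
  refine Subtype.ext (hΘ.eq_zero_of_inner_diskKernelLp (x - y).2 fun w hw => ?_)
  change inner ℂ (hΘ.boundedKernel hw : modelSpace Θ) (x - y) = 0
  rw [inner_sub_right, h w hw, sub_self]

/-- `P_Θ` preserves `L^p`, `2 < p < ∞`. -/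
theorem memLp_orthogonalProjectionOnto (hΘ : IsInner Θ) {p : ℝ≥0∞} (hp : 2 < p) (hp' : p < ∞)
    {h : L2} (hh : MemLp h p circleMeasure) :
    MemLp (((modelSpace Θ).orthogonalProjectionOnto h : modelSpace Θ) : L2) p circleMeasure := by
  rw [← Submodule.starProjection_apply]
  have h1 : MemLp ((hΘ.memLp_conj_mul (Lp.memLp h)).toLp _) p circleMeasure :=
    (hΘ.memLp_conj_mul hh).ae_eq (MemLp.coeFn_toLp _).symm
  exact MemLp.ae_eq (hΘ.starProjection_modelSpace h).symm
    ((memLp_starProjection_hardy hp hp' hh).sub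
      (hΘ.memLp_mul (memLp_starProjection_hardy hp hp' h1)))

end IsInner

namespace IsCaratheodoryPoint

variable {Θ : ℂ → ℂ} {ζ : Circle} {a : ℂ}

/-- The boundary kernel, as an element of `K_Θ`. -/
def kernel (hC : IsCaratheodoryPoint Θ ζ a) : modelSpace Θ := ⟨hC.kernelLp, hC.kernelLp_mem⟩

theorem isBoundaryKernel (hC : IsCaratheodoryPoint Θ ζ a) : IsBoundaryKernel Θ ζ hC.kernel :=
  hC.coeFn_kernelLp.trans hC.boundaryFun_boundaryKernel.symm

theorem inner_boundedKernel_kernel (hC : IsCaratheodoryPoint Θ ζ a) {w : ℂ} (hw : ‖w‖ < 1) :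
    inner ℂ (hC.isInner.boundedKernel hw : modelSpace Θ) hC.kernel = boundaryKernel Θ ζ w :=
  hC.inner_diskKernelLp_kernelLp hw

theorem memLp_symbol {p : ℝ≥0∞}
    (h : MemLp (kernelTrace Θ ζ a) p circleMeasure) :
    MemLp (fun t => kernelTrace Θ ζ a t + conj (kernelTrace Θ ζ a t) - 1) p circleMeasure :=
  (h.add (memLp_conj h)).sub (memLp_const 1)

/-- The symbol `k_ζ + conj(k_ζ) - 1`. -/
def symbol (hC : IsCaratheodoryPoint Θ ζ a) : L2 := (memLp_symbol hC.memLp_kernelTrace).toLp _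

theorem coeFn_symbol (hC : IsCaratheodoryPoint Θ ζ a) :
    (hC.symbol : UnitAddCircle → ℂ) =ᵐ[circleMeasure]
      fun t => kernelTrace Θ ζ a t + conj (kernelTrace Θ ζ a t) - 1 := MemLp.coeFn_toLp _

theorem orthogonalProjectionOnto_symbol_boundedKernel (hC : IsCaratheodoryPoint Θ ζ a) {v : ℂ}
    (hv : ‖v‖ < 1) :
    (modelSpace Θ).orthogonalProjectionOnto
      (mulBounded Θ hC.symbol (hC.isInner.boundedKernel hv)) =
      inner ℂ hC.kernel (hC.isInner.boundedKernel hv : modelSpace Θ) • hC.kernel := by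
  have hΘ := hC.isInner
  refine hΘ.ext_inner_boundedKernel fun w hw => ?_
  rw [inner_truncatedToeplitz, inner_smul_modelSpace, ← inner_conj_symm hC.kernel,
    hC.inner_boundedKernel_kernel, hC.inner_boundedKernel_kernel,
    ← hC.integral_diskKernel_mul_conj_mul_symbol hv hw]
  refine integral_congr_ae ?_
  filter_upwards [hC.coeFn_symbol, hΘ.coeFn_boundedKernel hv, hΘ.coeFn_boundedKernel hw]
    with t h1 h2 h3
  rw [h1, h2, h3]
  ring

/-- `k_ζ ⊗ k_ζ` is a truncated Toeplitz operator with symbol `k_ζ + conj(k_ζ) - 1`. -/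
theorem isSymbol_symbol (hC : IsCaratheodoryPoint Θ ζ a) :
    IsSymbol Θ hC.symbol (InnerProductSpace.rankOne ℂ hC.kernel hC.kernel) := by
  have hΘ := hC.isInner
  suffices H : ∀ f : boundedPart Θ, (modelSpace Θ).orthogonalProjectionOnto
      (mulBounded Θ hC.symbol f) = inner ℂ hC.kernel (f : modelSpace Θ) • hC.kernel from H
  intro f
  refine hΘ.ext_inner_boundedKernel fun w hw => ?_
  -- The symbol is real valued, so `⟨k_w, A f⟩` is the conjugate of `⟨f, A k_w⟩`. This carries the
  -- formula from kernels to every bounded `f` without approximating `f`.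
  have h1 := congrArg (fun x => conj (inner ℂ (f : modelSpace Θ) x))
    (hC.orthogonalProjectionOnto_symbol_boundedKernel hw)
  simp only [inner_truncatedToeplitz, inner_smul_modelSpace, map_mul] at h1
  rw [inner_truncatedToeplitz, inner_smul_modelSpace, mul_comm,
    ← inner_conj_symm (hΘ.boundedKernel hw : modelSpace Θ) hC.kernel,
    ← inner_conj_symm hC.kernel (f : modelSpace Θ), ← h1, ← integral_conj_circle]
  refine integral_congr_ae ?_
  filter_upwards [hC.coeFn_symbol] with t h1
  rw [h1]
  simp only [map_mul, map_sub, map_add, map_one, Complex.conj_conj]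
  ring

theorem hasSymbolIn_of_memLp (hC : IsCaratheodoryPoint Θ ζ a) {p : ℝ≥0∞}
    (h : MemLp (kernelTrace Θ ζ a) p circleMeasure) :
    HasSymbolIn Θ p (InnerProductSpace.rankOne ℂ hC.kernel hC.kernel) :=
  ⟨hC.symbol, (memLp_symbol h).ae_eq hC.coeFn_symbol.symm, hC.isSymbol_symbol⟩

/-- If `k_ζ(0) = 0`, then `Θ` is constant and `k_ζ = 0`. -/
theorem kernelTrace_eq_zero (hC : IsCaratheodoryPoint Θ ζ a) (h : boundaryKernel Θ ζ 0 = 0) :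
    kernelTrace Θ ζ a =ᵐ[circleMeasure] 0 := by
  have hΘ := hC.isInner
  rw [hC.boundaryKernel_eq, cauchyKernel, mul_zero, sub_zero, div_one, mul_one] at h
  have ha : a * conj a = 1 := by
    rw [Complex.mul_conj, Complex.normSq_eq_norm_sq, hC.norm_eq_one]; simp
  -- As `|Θ(0)| = |a| = 1`, the norm of the kernel at the origin is zero; that kernel is `1 -
  -- conj(a) Θ`, the numerator of `k_ζ`.
  have h0 : Θ 0 = a := by linear_combination (-a) * h - Θ 0 * ha
  have h1 := hΘ.integral_norm_sq_diskKernel (w := 0) (by simp)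
  rw [h0, hC.norm_eq_one] at h1
  norm_num at h1
  rw [integral_eq_zero_iff_of_nonneg (fun t => by positivity)
    (((hΘ.hasBoundaryValues_diskKernel (w := 0) (by simp)).memLp 2).integrable_norm_pow
      two_ne_zero)] at h1
  filter_upwards [h1] with t ht
  have h2 : diskKernelBoundary Θ 0 t = 0 := by simpa using ht
  rw [diskKernelBoundary, h0, cauchyKernel, map_zero, zero_mul, sub_zero, div_one, mul_one] at h2
  rw [kernelTrace, h2, zero_mul, Pi.zero_apply]

/-- The operator maps the bounded kernel `k_0` to `conj(k_ζ(0)) k_ζ`, which is also `P_Θ(ψ k_0)` and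
hence in `L^p`. If `k_ζ(0) = 0`, the kernel itself vanishes. -/
theorem memLp_of_hasSymbolIn (hC : IsCaratheodoryPoint Θ ζ a) {p : ℝ≥0∞} (hp : 2 < p)
    (hp' : p < ∞) (h : HasSymbolIn Θ p (InnerProductSpace.rankOne ℂ hC.kernel hC.kernel)) :
    MemLp (kernelTrace Θ ζ a) p circleMeasure := by
  have hΘ := hC.isInner
  by_cases h0 : boundaryKernel Θ ζ 0 = 0
  · exact (MemLp.zero (ε := ℂ)).ae_eq (hC.kernelTrace_eq_zero h0).symm
  obtain ⟨ψ, hψ, hsym⟩ := h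
  have hw : ‖(0 : ℂ)‖ < 1 := by simp
  have h1 := hsym (hΘ.boundedKernel hw)
  change (modelSpace Θ).orthogonalProjectionOnto (mulBounded Θ ψ (hΘ.boundedKernel hw)) = _ at h1
  rw [InnerProductSpace.rankOne_apply, ← inner_conj_symm, hC.inner_boundedKernel_kernel] at h1
  have h2 : MemLp (mulBounded Θ ψ (hΘ.boundedKernel hw)) p circleMeasure :=
    ((memLp_mul_of_top (hΘ.boundedKernel hw).2 hψ).ae_eq
      (Eventually.of_forall fun t => mul_comm _ _)).ae_eq (coeFn_mulBounded Θ ψ _).symm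
  have h3 := (hΘ.memLp_orthogonalProjectionOnto hp hp' h2).const_smul
    (conj (boundaryKernel Θ ζ 0))⁻¹
  rw [h1] at h3
  refine h3.ae_eq ?_
  filter_upwards [hC.coeFn_kernelLp, Lp.coeFn_smul (conj (boundaryKernel Θ ζ 0)) hC.kernelLp]
    with t h4 h5
  rw [Pi.smul_apply]
  change _ • ((conj (boundaryKernel Θ ζ 0) • hC.kernelLp : L2) : UnitAddCircle → ℂ) t = _
  rw [h5, Pi.smul_apply, smul_smul, inv_mul_cancel₀ (by simpa using h0), one_smul, h4]

theorem hasSymbolIn_iff (hC : IsCaratheodoryPoint Θ ζ a) {p : ℝ≥0∞} (hp : 2 < p) (hp' : p < ∞) :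
    HasSymbolIn Θ p (InnerProductSpace.rankOne ℂ hC.kernel hC.kernel) ↔
      MemLp (boundaryFun (boundaryKernel Θ ζ)) p circleMeasure := by
  rw [memLp_congr_ae hC.boundaryFun_boundaryKernel]
  exact ⟨hC.memLp_of_hasSymbolIn hp hp', hC.hasSymbolIn_of_memLp⟩

theorem not_hasSymbolIn_top (hC : IsCaratheodoryPoint Θ ζ a) {p : ℝ≥0∞} (hp : 2 < p) (hp' : p < ∞)
    (h : ¬ MemLp (boundaryFun (boundaryKernel Θ ζ)) p circleMeasure) :
    ¬ HasSymbolIn Θ ∞ (InnerProductSpace.rankOne ℂ hC.kernel hC.kernel) := by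
  rintro ⟨ψ, hψ, hsym⟩
  exact h ((hC.hasSymbolIn_iff hp hp').mp ⟨ψ, hψ.mono_exponent le_top, hsym⟩)

end IsCaratheodoryPoint

/-! ### A singular inner function whose boundary kernel is not in `L⁴` -/

/-- If the boundary kernel is in `L⁴`, its size at `w` is bounded by its `L⁴` norm; optimising `T`
gives the growth `(1 - |w|)^{-1/4}`. -/
theorem IsCaratheodoryPoint.norm_boundaryKernel_le {Θ : ℂ → ℂ} {ζ : Circle} {a : ℂ}
    (hC : IsCaratheodoryPoint Θ ζ a) (h : MemLp (kernelTrace Θ ζ a) 4 circleMeasure) {w : ℂ}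
    (hw : ‖w‖ < 1) {T : ℝ} (hT : 0 < T) :
    ‖boundaryKernel Θ ζ w‖ ≤
      T + 2 / (1 - ‖w‖) / T ^ 3 * ∫ t, ‖kernelTrace Θ ζ a t‖ ^ 4 ∂circleMeasure := by
  have hP := (memLp_diskPoissonKernel hw).mono_exponent (p := 1) le_top
  have i1 : Integrable (fun t => diskPoissonKernel w t) circleMeasure :=
    (hP.integrable le_rfl).re
  have i2 : Integrable (fun t => ‖kernelTrace Θ ζ a t‖ ^ 4) circleMeasure :=
    h.integrable_norm_pow (by norm_num)
  have hB : 0 ≤ 2 / (1 - ‖w‖) := div_nonneg zero_le_two (by linarith)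
  rw [← hC.integral_mul_diskPoissonKernel hw]
  calc ‖∫ t, kernelTrace Θ ζ a t * diskPoissonKernel w t ∂circleMeasure‖
      ≤ ∫ t, (T * diskPoissonKernel w t +
          2 / (1 - ‖w‖) / T ^ 3 * ‖kernelTrace Θ ζ a t‖ ^ 4) ∂circleMeasure := by
        refine norm_integral_le_of_norm_le ((i1.const_mul _).add (i2.const_mul _))
          (Eventually.of_forall fun t => ?_)
        have hP0 := diskPoissonKernel_nonneg hw t
        have hP1 := diskPoissonKernel_le hw t
        rw [norm_mul, Complex.norm_real, Real.norm_of_nonneg hP0]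
        set x := ‖kernelTrace Θ ζ a t‖ with hx
        have hx0 : 0 ≤ x := norm_nonneg _
        -- The term `T` is integrated against a probability density; for the other term the Poisson
        -- kernel is replaced by its supremum bound.
        have h1 : x ≤ T + x ^ 4 / T ^ 3 := by
          rcases le_total x T with h2 | h2
          · have : 0 ≤ x ^ 4 / T ^ 3 := by positivity
            linarith
          · have : x ≤ x ^ 4 / T ^ 3 := by
              rw [le_div_iff₀ (by positivity)]
              calc x * T ^ 3 ≤ x * x ^ 3 := by gcongr
                _ = x ^ 4 := by ring
            linarith
        calc x * diskPoissonKernel w t ≤ (T + x ^ 4 / T ^ 3) * diskPoissonKernel w t :=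
              mul_le_mul_of_nonneg_right h1 hP0
          _ = T * diskPoissonKernel w t + diskPoissonKernel w t * (x ^ 4 / T ^ 3) := by ring
          _ ≤ T * diskPoissonKernel w t + 2 / (1 - ‖w‖) * (x ^ 4 / T ^ 3) := by gcongr
          _ = _ := by ring
    _ = _ := by
        rw [integral_add (i1.const_mul _) (i2.const_mul _), integral_const_mul,
          integral_const_mul, integral_diskPoissonKernel hw, mul_one]

/-- The Herglotz kernel has nonnegative real part in the disk and is imaginary on the circle. -/
theorem re_herglotz {ξ z : ℂ} (hξ : ‖ξ‖ = 1) :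
    ((ξ + z) / (ξ - z)).re = (1 - ‖z‖ ^ 2) / ‖ξ - z‖ ^ 2 := by
  have h := congrFun (poissonKernel_eq_re_herglotzRieszKernel (c := 0) (w := z)) ξ
  simp only [poissonKernel_def, Function.comp_apply, herglotzRieszKernel_def, sub_zero, hξ] at h
  rw [← h]
  norm_num

/-- The points `s_n = 2^{-n}`. -/
def atomScale (n : ℕ) : ℝ := (1 / 2) ^ n

theorem atomScale_pos (n : ℕ) : 0 < atomScale n := by unfold atomScale; positivity

theorem atomScale_le_one (n : ℕ) : atomScale n ≤ 1 :=
  pow_le_one₀ (by norm_num) (by norm_num)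

theorem summable_atomScale : Summable atomScale :=
  summable_geometric_of_lt_one (by norm_num) (by norm_num)

theorem tendsto_atomScale : Tendsto atomScale atTop (𝓝 0) :=
  tendsto_pow_atTop_nhds_zero_of_lt_one (by norm_num) (by norm_num)

/-- The atoms `ζ_n = (1 + i s_n) / (1 - i s_n)` of the singular measure. -/
def atom (n : ℕ) : ℂ := (1 + Complex.I * atomScale n) / (1 - Complex.I * atomScale n)

theorem norm_one_sub_I_mul (s : ℝ) : ‖1 - Complex.I * s‖ ^ 2 = 1 + s ^ 2 := by
  rw [← Complex.normSq_eq_norm_sq, Complex.normSq_apply]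
  simp
  ring

theorem one_sub_I_mul_ne_zero (s : ℝ) : 1 - Complex.I * s ≠ 0 := by
  intro h
  have h1 := norm_one_sub_I_mul s
  rw [h, norm_zero] at h1
  nlinarith [sq_nonneg s]

theorem norm_atom (n : ℕ) : ‖atom n‖ = 1 := by
  have h : 1 + Complex.I * atomScale n = conj (1 - Complex.I * atomScale n) := by simp
  rw [atom, norm_div, h, RCLike.norm_conj,
    div_self (norm_ne_zero_iff.mpr (one_sub_I_mul_ne_zero _))]

theorem norm_atom_sub_one (n : ℕ) :
    ‖atom n - 1‖ = 2 * atomScale n / ‖1 - Complex.I * atomScale n‖ := by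
  have h : atom n - 1 = 2 * Complex.I * atomScale n / (1 - Complex.I * atomScale n) := by
    rw [atom]
    have := one_sub_I_mul_ne_zero (atomScale n)
    field_simp
    ring
  rw [h, norm_div]
  simp [abs_of_pos (atomScale_pos n)]

theorem atomScale_le_norm_atom_sub_one (n : ℕ) : atomScale n ≤ ‖atom n - 1‖ := by
  have h := norm_one_sub_I_mul (atomScale n)
  have h0 := norm_pos_iff.mpr (one_sub_I_mul_ne_zero (atomScale n))
  have h1 := atomScale_pos n
  have h2 := atomScale_le_one n
  rw [norm_atom_sub_one, le_div_iff₀ h0]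
  have h3 : ‖1 - Complex.I * atomScale n‖ ≤ 2 := by
    refine abs_le_of_sq_le_sq' ?_ zero_le_two |>.2
    rw [h]
    nlinarith
  nlinarith

theorem norm_atom_sub_one_le (n : ℕ) : ‖atom n - 1‖ ≤ 2 * atomScale n := by
  have h := norm_one_sub_I_mul (atomScale n)
  have h0 := norm_pos_iff.mpr (one_sub_I_mul_ne_zero (atomScale n))
  have h1 := atomScale_pos n
  rw [norm_atom_sub_one, div_le_iff₀ h0]
  have h3 : 1 ≤ ‖1 - Complex.I * atomScale n‖ := by
    refine abs_le_of_sq_le_sq' ?_ h0.le |>.2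
    rw [h]
    nlinarith
  nlinarith

theorem tendsto_atom : Tendsto atom atTop (𝓝 1) := by
  rw [tendsto_iff_norm_sub_tendsto_zero]
  refine squeeze_zero (fun n => norm_nonneg _) norm_atom_sub_one_le ?_
  simpa using tendsto_atomScale.const_mul 2

/-- The summands of the Herglotz transform of the measure `∑ s_n³ δ_{ζ_n}`. -/
def herglotzTerm (n : ℕ) (z : ℂ) : ℂ := (atomScale n : ℂ) ^ 3 * ((atom n + z) / (atom n - z))

/-- The Herglotz transform of the measure `∑ s_n³ δ_{ζ_n}`. -/
def herglotzSum (z : ℂ) : ℂ := ∑' n, herglotzTerm n z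

/-- The singular inner function of the measure `∑ s_n³ δ_{ζ_n}`. -/
def singularInner (z : ℂ) : ℂ := Complex.exp (-herglotzSum z)

theorem one_sub_norm_le_norm_atom_sub (n : ℕ) (z : ℂ) : 1 - ‖z‖ ≤ ‖atom n - z‖ := by
  have := norm_sub_norm_le (atom n) z
  rwa [norm_atom] at this

theorem atom_sub_ne_zero {z : ℂ} (hz : ‖z‖ < 1) (n : ℕ) : atom n - z ≠ 0 := by
  rw [← norm_pos_iff]
  linarith [one_sub_norm_le_norm_atom_sub n z]

theorem norm_herglotzTerm_le {z : ℂ} (hz : ‖z‖ ≤ 1) (n : ℕ) {d : ℝ} (hd : 0 < d)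
    (h : d ≤ ‖atom n - z‖) : ‖herglotzTerm n z‖ ≤ 2 * atomScale n ^ 3 / d := by
  have h1 : ‖atom n + z‖ ≤ 2 := (norm_add_le _ _).trans (by rw [norm_atom]; linarith)
  have h0 := atomScale_pos n
  rw [herglotzTerm, norm_mul, norm_div, norm_pow, Complex.norm_real, Real.norm_of_nonneg h0.le,
    mul_div_assoc', mul_comm (atomScale n ^ 3)]
  gcongr

theorem hasDerivAt_herglotzTerm {z : ℂ} (hz : ‖z‖ < 1) (n : ℕ) :
    HasDerivAt (herglotzTerm n) ((atomScale n : ℂ) ^ 3 * (2 * atom n / (atom n - z) ^ 2)) z := by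
  have h := atom_sub_ne_zero hz n
  have h1 := (((hasDerivAt_id z).const_add (atom n)).div ((hasDerivAt_id z).const_sub (atom n))
    h).const_mul ((atomScale n : ℂ) ^ 3)
  refine h1.congr_deriv ?_
  simp only [id]
  ring

theorem atomScale_pow_le (n : ℕ) {k : ℕ} (hk : k ≠ 0) : atomScale n ^ k ≤ atomScale n :=
  pow_le_of_le_one (atomScale_pos n).le (atomScale_le_one n) hk

theorem norm_herglotzTerm_le_of_mem_ball {ρ : ℝ} (hρ : ρ < 1) (n : ℕ) {z : ℂ}
    (hz : z ∈ ball (0 : ℂ) ρ) : ‖herglotzTerm n z‖ ≤ 2 / (1 - ρ) * atomScale n := by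
  rw [mem_ball_zero_iff] at hz
  refine (norm_herglotzTerm_le (by linarith) n (d := 1 - ρ) (by linarith)
    (by linarith [one_sub_norm_le_norm_atom_sub n z])).trans ?_
  rw [mul_div_right_comm]
  exact mul_le_mul_of_nonneg_left (atomScale_pow_le n (by norm_num))
    (div_nonneg zero_le_two (by linarith))

theorem exists_radius_mem_ball {z : ℂ} (hz : ‖z‖ < 1) : ∃ ρ < 1, z ∈ ball (0 : ℂ) ρ := by
  obtain ⟨ρ, h1, h2⟩ := exists_between hz
  exact ⟨ρ, h2, mem_ball_zero_iff.mpr h1⟩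

theorem differentiableOn_herglotzTerm {ρ : ℝ} (hρ : ρ < 1) (n : ℕ) :
    DifferentiableOn ℂ (herglotzTerm n) (ball 0 ρ) := fun _ hz =>
  (hasDerivAt_herglotzTerm ((mem_ball_zero_iff.mp hz).trans hρ)
    n).differentiableAt.differentiableWithinAt

theorem summable_herglotzTerm {z : ℂ} (hz : ‖z‖ < 1) : Summable fun n => herglotzTerm n z := by
  obtain ⟨ρ, hρ, hm⟩ := exists_radius_mem_ball hz
  exact Summable.of_norm_bounded (summable_atomScale.mul_left _)
    fun n => norm_herglotzTerm_le_of_mem_ball hρ n hm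

theorem differentiableAt_herglotzSum {z : ℂ} (hz : ‖z‖ < 1) :
    DifferentiableAt ℂ herglotzSum z := by
  obtain ⟨ρ, hρ, hm⟩ := exists_radius_mem_ball hz
  exact (Complex.differentiableOn_tsum_of_summable_norm (summable_atomScale.mul_left _)
    (differentiableOn_herglotzTerm hρ) isOpen_ball
    fun n z hz => norm_herglotzTerm_le_of_mem_ball hρ n hz).differentiableAt
    (isOpen_ball.mem_nhds hm)

theorem deriv_herglotzSum {z : ℂ} (hz : ‖z‖ < 1) :
    deriv herglotzSum z = ∑' n, (atomScale n : ℂ) ^ 3 * (2 * atom n / (atom n - z) ^ 2) := by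
  obtain ⟨ρ, hρ, hm⟩ := exists_radius_mem_ball hz
  have h := Complex.hasSum_deriv_of_summable_norm (summable_atomScale.mul_left _)
    (differentiableOn_herglotzTerm hρ) isOpen_ball
    (fun n z hz => norm_herglotzTerm_le_of_mem_ball hρ n hz) hm
  rw [show herglotzSum = fun w => ∑' n, herglotzTerm n w from rfl, ← h.tsum_eq]
  exact tsum_congr fun n => (hasDerivAt_herglotzTerm hz n).deriv

theorem re_herglotzTerm (n : ℕ) (z : ℂ) :
    (herglotzTerm n z).re = atomScale n ^ 3 * ((1 - ‖z‖ ^ 2) / ‖atom n - z‖ ^ 2) := by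
  rw [herglotzTerm, ← Complex.ofReal_pow, Complex.re_ofReal_mul, re_herglotz (norm_atom n)]

theorem re_herglotzTerm_nonneg {z : ℂ} (hz : ‖z‖ ≤ 1) (n : ℕ) : 0 ≤ (herglotzTerm n z).re := by
  rw [re_herglotzTerm]
  have := atomScale_pos n
  have : 0 ≤ 1 - ‖z‖ ^ 2 := by nlinarith [norm_nonneg z]
  positivity

theorem norm_singularInner (z : ℂ) : ‖singularInner z‖ = Real.exp (-(herglotzSum z).re) := by
  rw [singularInner, Complex.norm_exp, Complex.neg_re]

theorem re_herglotzTerm_le_re_herglotzSum {z : ℂ} (hz : ‖z‖ < 1) (n : ℕ) :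
    (herglotzTerm n z).re ≤ (herglotzSum z).re := by
  have hs := summable_herglotzTerm hz
  rw [herglotzSum, Complex.re_tsum hs]
  exact (Complex.hasSum_re hs.hasSum).summable.le_tsum n
    fun m _ => re_herglotzTerm_nonneg hz.le m

theorem norm_singularInner_eq_one {ξ : ℂ} (hξ : ‖ξ‖ = 1)
    (hs : Summable fun n => herglotzTerm n ξ) : ‖singularInner ξ‖ = 1 := by
  have h0 : ∀ n, (herglotzTerm n ξ).re = 0 := fun n => by rw [re_herglotzTerm, hξ]; simp
  rw [norm_singularInner, herglotzSum, Complex.re_tsum hs]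
  simp [h0]

/-- The filter is left free so that the same argument serves the radial limits a.e. and the
nontangential limit at `1`. -/
theorem tendsto_singularInner {ξ : ℂ} (hne : ∀ n, atom n ≠ ξ) {l : Filter ℂ}
    (hl : l ≤ 𝓝 ξ) {b : ℕ → ℝ} (hb : Summable b)
    (hle : ∀ᶠ z in l, ∀ n, ‖herglotzTerm n z‖ ≤ b n) :
    Tendsto singularInner l (𝓝 (singularInner ξ)) := by
  have hcont : ∀ n, Tendsto (herglotzTerm n) l (𝓝 (herglotzTerm n ξ)) := fun n => by
    refine Tendsto.const_mul _ ?_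
    exact ((tendsto_id.mono_left hl).const_add (atom n)).div
      ((tendsto_id.mono_left hl).const_sub (atom n)) (sub_ne_zero.mpr (hne n))
  exact (Complex.continuous_exp.tendsto _).comp
    (tendsto_tsum_of_dominated_convergence hb hcont hle).neg

theorem isInner_singularInner : IsInner singularInner where
  analytic := fun z hz => by
    have h := differentiableAt_herglotzSum (mem_ball_zero_iff.mp hz)
    exact h.neg.cexp.differentiableWithinAt
  bounded := by
    refine ⟨1, fun z hz => ?_⟩
    have hz' := mem_ball_zero_iff.mp hz
    rw [norm_singularInner, Real.exp_le_one_iff, neg_nonpos]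
    exact (re_herglotzTerm_nonneg hz'.le 0).trans (re_herglotzTerm_le_re_herglotzSum hz' 0)
  unimodular := by
    have h1 := ae_all_iff.mpr fun n => ae_circlePoint_ne
      ⟨atom n, mem_sphere_zero_iff_norm.mpr (norm_atom n)⟩
    filter_upwards [h1, ae_circlePoint_ne 1] with t ht ht1
    have hne : ∀ n, atom n ≠ circlePoint t := fun n h => ht n h.symm
    -- The atoms accumulate only at `1`, so away from them and from `1` the distances to the atoms
    -- are bounded below.
    have h2 : Tendsto (fun n => ‖atom n - circlePoint t‖⁻¹) atTop
        (𝓝 ‖1 - circlePoint t‖⁻¹) := by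
      refine (tendsto_atom.sub_const _).norm.inv₀ ?_
      rw [norm_ne_zero_iff, sub_ne_zero]
      exact fun h => ht1 (by rw [← h]; rfl)
    obtain ⟨B, hB⟩ := h2.bddAbove_range
    have hB' : ∀ n, ‖atom n - circlePoint t‖⁻¹ ≤ B := fun n => hB ⟨n, rfl⟩
    have hbound : ∀ z : ℂ, ‖z‖ ≤ 1 → ∀ n, ‖atom n - circlePoint t‖ / 2 ≤ ‖atom n - z‖ →
        ‖herglotzTerm n z‖ ≤ 4 * B * atomScale n := by
      intro z hz n h3
      have hpos : 0 < ‖atom n - circlePoint t‖ := norm_pos_iff.mpr (sub_ne_zero.mpr (hne n))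
      refine (norm_herglotzTerm_le hz n (half_pos hpos) h3).trans ?_
      have h7 := hB' n
      have h8 := atomScale_pow_le n (k := 3) (by norm_num)
      have h9 : 0 ≤ atomScale n ^ 3 := pow_nonneg (atomScale_pos n).le 3
      calc 2 * atomScale n ^ 3 / (‖atom n - circlePoint t‖ / 2)
          = 4 * ‖atom n - circlePoint t‖⁻¹ * atomScale n ^ 3 := by field_simp; ring
        _ ≤ 4 * B * atomScale n := by
            refine mul_le_mul (by linarith) h8 h9 ?_
            have : 0 < ‖atom n - circlePoint t‖⁻¹ := by positivity
            linarith
    have hsum := summable_atomScale.mul_left (4 * B)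
    have hle : ∀ᶠ z in map (fun r : ℝ => (r : ℂ) * circlePoint t) (𝓝[<] 1),
        ∀ n, ‖herglotzTerm n z‖ ≤ 4 * B * atomScale n := by
      rw [eventually_map]
      filter_upwards [eventually_radius] with r hr n
      have hz := ofReal_mul_mem_ball hr.1 hr.2 (norm_circlePoint t).le
      rw [mem_ball_zero_iff] at hz
      have hn : ‖(r : ℂ) * circlePoint t‖ = r := by
        rw [norm_mul, norm_circlePoint, mul_one, Complex.norm_real, Real.norm_of_nonneg hr.1]
      -- On the radius to `ξ`, `|rξ - ξ| = 1 - r ≤ |ζ_n - rξ|`, so `|ζ_n - ξ| ≤ 2 |ζ_n - rξ|`.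
      refine hbound _ hz.le n ?_
      have h4 := one_sub_norm_le_norm_atom_sub n (r * circlePoint t)
      rw [hn] at h4
      have h5 : ‖(r : ℂ) * circlePoint t - circlePoint t‖ = 1 - r := by
        rw [← sub_one_mul, norm_mul, norm_circlePoint, mul_one, ← Complex.ofReal_one,
          ← Complex.ofReal_sub, Complex.norm_real, Real.norm_of_nonpos (by linarith [hr.2])]
        ring
      have h6 := norm_sub_le_norm_sub_add_norm_sub (atom n) (r * circlePoint t) (circlePoint t)
      linarith
    refine ⟨singularInner (circlePoint t),
      norm_singularInner_eq_one (norm_circlePoint t) (Summable.of_norm_bounded hsum fun n =>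
        hbound _ (norm_circlePoint t).le n (half_le_self (norm_nonneg _))),
      tendsto_map'_iff.mp (tendsto_singularInner hne (tendsto_radius_mul _) hsum hle)⟩

theorem atom_ne_one (n : ℕ) : atom n ≠ 1 := by
  rw [← sub_ne_zero, ← norm_pos_iff]
  exact (atomScale_pos n).trans_le (atomScale_le_norm_atom_sub_one n)

/-- In a Stolz region `|z - 1| < M (1 - |z|) ≤ M |ζ_n - z|`, so the triangle inequality gives `s_n ≤
|ζ_n - 1| ≤ (1 + M) |ζ_n - z|`. -/
theorem atomScale_div_le_norm_atom_sub {M : ℝ} {z : ℂ}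
    (hz : ‖z‖ < 1 ∧ ‖z - 1‖ < M * (1 - ‖z‖)) (n : ℕ) :
    0 < M ∧ atomScale n / (1 + M) ≤ ‖atom n - z‖ := by
  have hM : 0 < M := by
    by_contra! h
    nlinarith [norm_nonneg (z - 1)]
  refine ⟨hM, ?_⟩
  rw [div_le_iff₀ (by linarith)]
  have h1 := atomScale_le_norm_atom_sub_one n
  have h2 := one_sub_norm_le_norm_atom_sub n z
  have h3 := norm_sub_le_norm_sub_add_norm_sub (atom n) z 1
  nlinarith

/-- In a Stolz region the terms of the exponent are of order at most `s³ / s` and those of its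
derivative at most `s³ / s²`. The cube makes the latter summable, uniformly in the region, so both
limits may be taken term by term. -/
theorem hasAngularDerivative_singularInner : HasAngularDerivative singularInner 1 := by
  have hb : ∀ M : ℝ, ∀ᶠ z in 𝓝[{z : ℂ | ‖z‖ < 1 ∧ ‖z - 1‖ < M * (1 - ‖z‖)}] (1 : ℂ),
      ∀ n, ‖herglotzTerm n z‖ ≤ 2 * (1 + M) * atomScale n := by
    intro M
    filter_upwards [self_mem_nhdsWithin] with z hz n
    obtain ⟨hM, h1⟩ := atomScale_div_le_norm_atom_sub hz n
    have h0 := atomScale_pos n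
    refine (norm_herglotzTerm_le hz.1.le n (by positivity) h1).trans ?_
    calc 2 * atomScale n ^ 3 / (atomScale n / (1 + M)) = 2 * (1 + M) * atomScale n ^ 2 := by
          field_simp
      _ ≤ 2 * (1 + M) * atomScale n := by
          gcongr
          exact atomScale_pow_le n two_ne_zero
  have hlim : ∀ M : ℝ, Tendsto singularInner
      (𝓝[{z : ℂ | ‖z‖ < 1 ∧ ‖z - 1‖ < M * (1 - ‖z‖)}] (1 : ℂ)) (𝓝 (singularInner 1)) := fun M =>
    tendsto_singularInner atom_ne_one nhdsWithin_le_nhds (summable_atomScale.mul_left _) (hb M)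
  have hnorm : ‖singularInner 1‖ = 1 := by
    refine norm_singularInner_eq_one norm_one
      (Summable.of_norm_bounded (summable_atomScale.mul_left 2) fun n => ?_)
    have h0 := atomScale_pos n
    refine (norm_herglotzTerm_le norm_one.le n h0 (atomScale_le_norm_atom_sub_one n)).trans ?_
    calc 2 * atomScale n ^ 3 / atomScale n = 2 * atomScale n ^ 2 := by field_simp
      _ ≤ 2 * atomScale n := by
          gcongr
          exact atomScale_pow_le n two_ne_zero
  set g : ℕ → ℂ → ℂ := fun n z => (atomScale n : ℂ) ^ 3 * (2 * atom n / (atom n - z) ^ 2) with hg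
  have hderiv : ∀ z : ℂ, ‖z‖ < 1 →
      deriv singularInner z = singularInner z * -(∑' n, g n z) := fun z hz => by
    rw [hg, ← deriv_herglotzSum hz]
    exact (differentiableAt_herglotzSum hz).hasDerivAt.neg.cexp.deriv
  refine ⟨singularInner 1, singularInner 1 * -(∑' n, g n 1), hnorm, ?_, ?_⟩
  · intro M
    simpa only [Circle.coe_one] using hlim M
  · intro M
    rw [Circle.coe_one]
    refine Tendsto.congr' (f₁ := fun z => singularInner z * -(∑' n, g n z)) ?_ ?_
    · filter_upwards [self_mem_nhdsWithin] with z hz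
      exact (hderiv z hz.1).symm
    · refine (hlim M).mul (Tendsto.neg ?_)
      refine tendsto_tsum_of_dominated_convergence
        (bound := fun n => 2 * (1 + M) ^ 2 * atomScale n) (summable_atomScale.mul_left _)
        (fun n => ?_) ?_
      · refine Tendsto.const_mul _ (Tendsto.div tendsto_const_nhds
          (((tendsto_id.mono_left nhdsWithin_le_nhds).const_sub (atom n)).pow 2)
          (pow_ne_zero 2 (sub_ne_zero.mpr (atom_ne_one n))))
      · filter_upwards [self_mem_nhdsWithin] with z hz n
        obtain ⟨hM, h1⟩ := atomScale_div_le_norm_atom_sub hz n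
        have h0 := atomScale_pos n
        have h2 : 0 < atomScale n / (1 + M) := by positivity
        rw [hg, norm_mul, norm_div, norm_mul, norm_atom, norm_pow, norm_pow, Complex.norm_real,
          Real.norm_of_nonneg h0.le, Complex.norm_ofNat, mul_one]
        calc atomScale n ^ 3 * (2 / ‖atom n - z‖ ^ 2)
            ≤ atomScale n ^ 3 * (2 / (atomScale n / (1 + M)) ^ 2) := by gcongr
          _ = 2 * (1 + M) ^ 2 * atomScale n := by field_simp

/-- The boundary kernel of `singularInner` at `1` is not in `L⁴`: on the radius to the atom
`ζ_n`, at distance `s_n³` from the circle, it is of size at least `s_n⁻¹ / 6`. -/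
theorem not_memLp_boundaryKernel_singularInner {a : ℂ}
    (hC : IsCaratheodoryPoint singularInner 1 a) :
    ¬ MemLp (boundaryFun (boundaryKernel singularInner 1)) 4 circleMeasure := by
  rw [memLp_congr_ae hC.boundaryFun_boundaryKernel]
  intro h
  set I := ∫ t, ‖kernelTrace singularInner 1 a t‖ ^ 4 ∂circleMeasure
  have key : ∀ n, 1 ≤ 12 * 3456 * I * atomScale n := by
    intro n
    set s := atomScale n with hs
    have hs0 : 0 < s := atomScale_pos n
    have hs1 : s ≤ 1 := atomScale_le_one n
    have hc0 : 0 < s ^ 3 := by positivity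
    have hc1 : s ^ 3 ≤ s := atomScale_pow_le n (by norm_num)
    set w : ℂ := ((1 - s ^ 3 : ℝ) : ℂ) * atom n with hw
    have hnw : ‖w‖ = 1 - s ^ 3 := by
      rw [hw, norm_mul, norm_atom, mul_one, Complex.norm_real, Real.norm_of_nonneg (by linarith)]
    have hw1 : ‖w‖ < 1 := by linarith
    have haw : ‖atom n - w‖ = s ^ 3 := by
      have : atom n - w = ((s ^ 3 : ℝ) : ℂ) * atom n := by rw [hw]; push_cast; ring
      rw [this, norm_mul, norm_atom, mul_one, Complex.norm_real, Real.norm_of_nonneg hc0.le]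
    -- The distance from `w` to the atom equals the mass `s³`, so this single atom already
    -- contributes `2 - s³ ≥ 1`.
    have hre : 1 ≤ (herglotzSum w).re := by
      refine le_trans ?_ (re_herglotzTerm_le_re_herglotzSum hw1 n)
      have : s ^ 3 * ((1 - (1 - s ^ 3) ^ 2) / (s ^ 3) ^ 2) = 2 - s ^ 3 := by
        field_simp
        ring
      rw [re_herglotzTerm, hnw, haw, ← hs, this]
      linarith
    have hhalf : ‖singularInner w‖ ≤ 1 / 2 := by
      rw [norm_singularInner]
      refine (Real.exp_le_exp.mpr (neg_le_neg hre)).trans ?_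
      linarith [Real.exp_neg_one_lt_d9]
    have hdist : ‖1 - w‖ ≤ 3 * s := by
      have h1 := norm_sub_le_norm_sub_add_norm_sub w (atom n) 1
      rw [norm_sub_rev w (atom n), haw, norm_sub_rev w 1] at h1
      linarith [norm_atom_sub_one_le n]
    have hnum : 1 / 2 ≤ ‖1 - conj a * singularInner w‖ := by
      have h1 := norm_sub_norm_le (1 : ℂ) (conj a * singularInner w)
      rw [norm_mul, RCLike.norm_conj, hC.norm_eq_one, one_mul, norm_one] at h1
      linarith
    have hpos : 0 < ‖1 - w‖ := by
      refine norm_pos_iff.mpr (sub_ne_zero.mpr fun h => ?_)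
      rw [← h, norm_one] at hw1
      exact lt_irrefl _ hw1
    have hlow : 1 / (6 * s) ≤ ‖boundaryKernel singularInner 1 w‖ := by
      rw [hC.boundaryKernel_eq, cauchyKernel, Circle.coe_one, map_one, one_mul, norm_mul,
        norm_div, norm_one, mul_one_div]
      calc 1 / (6 * s) = 1 / 2 / (3 * s) := by field_simp; norm_num
        _ ≤ ‖1 - conj a * singularInner w‖ / ‖1 - w‖ := by gcongr
    -- `T` is half the lower bound `1 / (6 s)`. Then `1 / T³` is a multiple of `s³` and cancels `1 /
    -- (1 - |w|) = s⁻³`, leaving `3456 = 2 · 12³`, so `1 / (12 s) ≤ 3456 I` for all `n`, which fails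
    -- as `s → 0`.
    have hup := hC.norm_boundaryKernel_le h hw1 (T := 1 / (12 * s)) (by positivity)
    rw [hnw] at hup
    have h1 : 2 / (1 - (1 - s ^ 3)) / (1 / (12 * s)) ^ 3 * I = 3456 * I := by
      field_simp
      ring
    have h2 : 1 / (6 * s) = 2 * (1 / (12 * s)) := by field_simp; norm_num
    change _ ≤ _ + _ * I at hup
    rw [h1] at hup
    have h3 : 1 / (12 * s) ≤ 3456 * I := by linarith
    rw [div_le_iff₀ (by positivity)] at h3
    linarith
  have hlim := tendsto_atomScale.const_mul (12 * 3456 * I)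
  rw [mul_zero] at hlim
  have := ge_of_tendsto' hlim key
  norm_num at this

end

end TruncatedToeplitz

theorem mainTheorem1 :
    (∀ (Θ : ℂ → ℂ) (ζ : Circle), IsInner Θ → HasAngularDerivative Θ ζ →
      ∃ k : modelSpace Θ, IsBoundaryKernel Θ ζ k ∧
        IsTruncatedToeplitz Θ (InnerProductSpace.rankOne ℂ k k) ∧
        (∀ p : ℝ≥0∞, 2 < p → p < ∞ →
          (HasSymbolIn Θ p (InnerProductSpace.rankOne ℂ k k) ↔
            MemLp (boundaryFun (boundaryKernel Θ ζ)) p circleMeasure)) ∧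
        ((∃ p : ℝ≥0∞, 2 < p ∧ p < ∞ ∧
            ¬ MemLp (boundaryFun (boundaryKernel Θ ζ)) p circleMeasure) →
          ¬ HasSymbolIn Θ ∞ (InnerProductSpace.rankOne ℂ k k))) ∧
    (∃ (Θ : ℂ → ℂ) (ζ : Circle) (k : modelSpace Θ),
      IsInner Θ ∧ HasAngularDerivative Θ ζ ∧ IsBoundaryKernel Θ ζ k ∧
        IsTruncatedToeplitz Θ (InnerProductSpace.rankOne ℂ k k) ∧
        ¬ HasSymbolIn Θ ∞ (InnerProductSpace.rankOne ℂ k k)) := by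
  refine ⟨fun Θ ζ hΘ h => ?_, ?_⟩
  · obtain ⟨a, hC⟩ := hΘ.exists_isCaratheodoryPoint h
    exact ⟨hC.kernel, hC.isBoundaryKernel, ⟨hC.symbol, hC.isSymbol_symbol⟩,
      fun p hp hp' => hC.hasSymbolIn_iff hp hp',
      fun ⟨p, hp, hp', hk⟩ => hC.not_hasSymbolIn_top hp hp' hk⟩
  · obtain ⟨a, hC⟩ :=
      isInner_singularInner.exists_isCaratheodoryPoint hasAngularDerivative_singularInner
    exact ⟨singularInner, 1, hC.kernel, isInner_singularInner, hasAngularDerivative_singularInner,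
      hC.isBoundaryKernel, ⟨hC.symbol, hC.isSymbol_symbol⟩,
      hC.not_hasSymbolIn_top (p := 4) (by norm_num) (by norm_num)
        (not_memLp_boundaryKernel_singularInner hC)⟩
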